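/- **The model.** A *glue* is a label (a finite string) together with a strength in $\mathbb{N}$. A *tile type* is a non-rotatable unit square with a glue on each of its four sides. An *assembly* over a finite tile set $T$ is a partial function $\alpha:\mathbb{Z}^2\dashrightarrow T$. Two adjacent tiles are joined by an edge of weight $s$ in the *binding graph* if their abutting glues are equal (in label and strength) and have strength $s>0$. The assembly is *$\tau$-stable* if every cut of its binding graph into two non-empty parts has weight at least $\tau$. The *supertile* $\tilde\alpha$ of $\alpha$ is the set of all translations of $\alpha$. $C^\tau_{\tilde\alpha,\tilde\beta}$ is the set of supertiles of the $\tau$-stable unions $\alpha\cup\beta$ with $\alpha\in\tilde\alpha$, $\beta\in\tilde\beta$ and $\operatorname{dom}\alpha\cap\operatorname{dom}\beta=\emptyset$. A *2HAM system* $\mathcal T=(T,\sigma,\tau)$ consists of a finite tile set $T$, a set $\sigma$ (the initial state) of non-empty $\tau$-stable supertiles over $T$, each present with infinite multiplicity, and a temperature $\tau\in\mathbb{N}$. Write $\|\sigma\|$ for the number of distinct supertiles in $\sigma$. Call a supertile *reached* if it is obtained from $\sigma$ by finitely many combinations ($\tilde\gamma\in C^\tau_{\tilde\alpha,\tilde\beta}$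 with $\tilde\alpha,\tilde\beta$ reached). A supertile is *producible*, $\tilde\alpha\in\mathcal A[\mathcal T]$, if it is the result (the union) of a finite or infinite sequence of $\tau$-stable attachments of reached supertiles that starts with an element of $\sigma$. Write $\tilde\alpha\to^1_{\mathcal T}\tilde\beta$ if $\tilde\beta\in C^\tau_{\tilde\alpha,\tilde\delta}$ for some producible $\tilde\delta$; write $\tilde\alpha\to^{\le1}_{\mathcal T}\tilde\beta$ if $\tilde\alpha=\tilde\beta$ or $\tilde\alpha\to^1_{\mathcal T}\tilde\beta$; and write $\tilde\alpha\to_{\mathcal T}\tilde\beta$ if $\tilde\beta$ is the result of a finite or infinite sequence of $\tau$-stable attachments of producible supertiles that starts with $\tilde\alpha$. **Simulation.** Let $m\ge1$. An *$m$-block* over $U$ is a partial function $\{0,\dots,m-1\}^2\dashrightarrow U$; for an assembly $\alpha$ put $\alpha^m_{x,y}(i,j)=\alpha(mx+i,my+j)$. Let $R$ be a partial function from $m$-blocks over $U$ to $T$, and define $R^*(\alpha)(x,y)=R(\alpha^m_{x,y})$. We say that $\alpha$ *maps cleanly* to $\beta$ if every non-empty block $\alpha^m_{x,y}$ satisfies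 $(x+u,y+v)\in\operatorname{dom}\beta$ for some $u,v\in\{-1,0,1\}$ with $u^2+v^2<2$, or $\alpha$ has at most one non-empty block. For a supertile $\tilde\alpha$ over $U$ let $\tilde R(\tilde\alpha)$ be the set of all *non-empty* assemblies $R^*(\alpha)$ with $\alpha\in\tilde\alpha$. Call $\tilde\alpha$ *blank* if $\tilde R(\tilde\alpha)=\emptyset$. We say that $\tilde\alpha$ maps cleanly if every $\alpha\in\tilde\alpha$ with $R^*(\alpha)\neq\emptyset$ maps cleanly to $R^*(\alpha)$, and at least one $\alpha\in\tilde\alpha$ maps cleanly to $R^*(\alpha)$. A system $\mathcal U$ with tile set $U$ *simulates* $\mathcal T$ at scale $m$ if for some such $R$: 1. (equivalent productions) $\{\tilde R(\tilde\alpha):\tilde\alpha\in\mathcal A[\mathcal U]\text{ not blank}\}=\mathcal A[\mathcal T]$, and every $\tilde\alpha\in\mathcal A[\mathcal U]$ maps cleanly; 2. ($\mathcal T$ follows $\mathcal U$) if $\tilde\alpha,\tilde\beta\in\mathcal A[\mathcal U]$, $\tilde\alpha\to^1_{\mathcal U}\tilde\beta$ and $\tilde\alpha$ is not blank, then $\tilde\beta$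 is not blank and $\tilde R(\tilde\alpha)\to^{\le1}_{\mathcal T}\tilde R(\tilde\beta)$; 3. ($\mathcal U$ weakly models $\mathcal T$) if $\tilde\alpha,\tilde\beta\in\mathcal A[\mathcal T]$ and $\tilde\alpha\to^1_{\mathcal T}\tilde\beta$, then for every $\tilde\alpha'\in\mathcal A[\mathcal U]$ with $\tilde R(\tilde\alpha')=\tilde\alpha$ there are $\tilde\alpha'',\tilde\beta'\in\mathcal A[\mathcal U]$ with $\tilde R(\tilde\alpha'')=\tilde\alpha$, $\tilde R(\tilde\beta')=\tilde\beta$, $\tilde\alpha'\to_{\mathcal U}\tilde\alpha''$ and $\tilde\alpha''\to^1_{\mathcal U}\tilde\beta'$. **Theorem.** There is an absolute constant $C$ such that for every integer $\tau\ge2$ there is a single tile set $U_\tau$ with $|U_\tau|\le C\log\tau$ and the following property. For every 2HAM system $\mathcal T=(T,\sigma,\tau)$ there is a set $I_{\mathcal T}$ of at most $C\,(|T|+\|\sigma\|)$ input supertiles such that $\mathcal U_{\mathcal T}=(U_\tau,\;U_{\tau,\mathrm{sup}}\cup I_{\mathcal T},\;\tau)$ is a 2HAM system and simulates $\mathcal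 T$ at some scale $m\ge 1$ with $m\le C\sqrt{\log|T|+\log\tau}$. Here $U_{\tau,\mathrm{sup}}$ is the set of single-tile supertiles of $U_\tau$. (By convention $\log|T|=0$ if $T=\emptyset$; the bound on $|I_{\mathcal T}|$ is void if $\|\sigma\|=\infty$.) -/

import Mathlib

namespace TwoHAM

/-! ### Tiles and assemblies -/

/-- A glue: a label (a finite string) and a strength (a non-negative integer). -/
structure Glue where
  label : List Bool
  strength : ℕ
deriving DecidableEq

/-- The four sides of a unit square. -/
inductive Dir where
  | north
  | east
  | south
  | west
deriving DecidableEq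

/-- The unit vector pointing in a given direction. -/
def Dir.vec : Dir → ℤ × ℤ
  | .north => (0, 1)
  | .east => (1, 0)
  | .south => (0, -1)
  | .west => (-1, 0)

/-- The opposite direction. -/
def Dir.opp : Dir → Dir
  | .north => .south
  | .east => .west
  | .south => .north
  | .west => .east

/-- A tile type: a (non-rotatable) unit square with one glue on each side. -/
structure TileType where
  north : Glue
  east : Glue
  south : Glue
  west : Glue
deriving DecidableEq

/-- The glue of a tile type on a given side. -/
def TileType.glue (t : TileType) : Dir → Glue
  | .north => t.north
  | .east => t.east
  | .south => t.south
  | .west => t.west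

/-- An assembly: a partial function from the integer lattice to tile types. -/
def Assembly : Type := ℤ × ℤ → Option TileType

namespace Assembly

/-- The set of positions that carry a tile. -/
def dom (α : Assembly) : Set (ℤ × ℤ) := {p | α p ≠ none}

/-- All tiles of the assembly belong to the tile set `T`. -/
def Over (T : Finset TileType) (α : Assembly) : Prop :=
  ∀ p t, α p = some t → t ∈ T

/-- The translation `α + u`. -/
def shift (u : ℤ × ℤ) (α : Assembly) : Assembly := fun x => α (x - u)

/-- The union of two assemblies (only used for disjoint ones). -/
def union (α β : Assembly) : Assembly := fun x => (α x).or (β x)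

/-- `α` is a subassembly of `β`. -/
def Sub (α β : Assembly) : Prop := ∀ p t, α p = some t → β p = some t

/-- The assembly with exactly one tile, of type `t`, at the origin. -/
def single (t : TileType) : Assembly := fun p => if p = 0 then some t else none

/-- The weight of the edge of the binding graph that joins `p` to its neighbour in direction `d`:
the strength of the common glue if both positions carry tiles whose abutting glues are equal
(in label and strength), and `0` otherwise (no edge). -/
def bond (α : Assembly) (p : ℤ × ℤ) (d : Dir) : ℕ :=
  match α p, α (p + d.vec) with
  | some s, some t => if s.glue d = t.glue d.opp then (s.glue d).strength else 0
  | _, _ => 0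

/-- `τ`-stability: every cut of the binding graph into two non-empty parts `A` and `dom α \ A` has
weight at least `τ`. The weight of a cut may be infinite, so the condition asks for finitely many
cut edges of total weight at least `τ`; an edge of the cut is written once, from its end in `A`. -/
def Stable (τ : ℕ) (α : Assembly) : Prop :=
  ∀ A : Set (ℤ × ℤ), A ⊆ α.dom → A.Nonempty → A ≠ α.dom →
    ∃ F : Finset ((ℤ × ℤ) × Dir),
      (∀ e ∈ F, e.1 ∈ A ∧ e.1 + e.2.vec ∉ A) ∧ τ ≤ ∑ e ∈ F, α.bond e.1 e.2

end Assembly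

/-! ### Supertiles -/

/-- Being translations of one another. -/
def translationSetoid : Setoid Assembly where
  r α β := ∃ u, Assembly.shift u α = β
  iseqv :=
    { refl := fun α => ⟨0, funext fun x => by simp [Assembly.shift]⟩
      symm := by
        rintro α β ⟨u, rfl⟩
        exact ⟨-u, funext fun x => by simp [Assembly.shift]⟩
      trans := by
        rintro α β γ ⟨u, rfl⟩ ⟨v, rfl⟩
        exact ⟨u + v, funext fun x => by simp [Assembly.shift, sub_sub, add_comm]⟩ }

/-- A supertile: an assembly up to translation. -/
def Supertile : Type := Quotient translationSetoid

/-- The supertile of an assembly. Thus `α` is a member of the supertile `A` iff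
`Supertile.of α = A`. -/
def Supertile.of (α : Assembly) : Supertile := Quotient.mk translationSetoid α

/-- The combination set of two supertiles at temperature `τ`: all `τ`-stable supertiles obtained as
the disjoint union of a member of `A` and a member of `B`. -/
def combine (τ : ℕ) (A B : Supertile) : Set Supertile :=
  {C | ∃ α β : Assembly, Supertile.of α = A ∧ Supertile.of β = B ∧ Disjoint α.dom β.dom ∧
    (α.union β).Stable τ ∧ Supertile.of (α.union β) = C}

/-- The singleton supertiles of the tiles of a tile set. -/
def singletons (T : Finset TileType) : Set Supertile :=
  {A | ∃ t ∈ T, A = Supertile.of (Assembly.single t)}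

/-! ### Two-handed tile assembly systems -/

/-- A two-handed tile assembly system: a finite tile set, an initial state, and a temperature.
The initial state is given by the set of its supertiles, each present in infinitely many copies;
they are non-empty stable supertiles over the tile set. -/
structure TAS where
  tiles : Finset TileType
  init : Set Supertile
  temp : ℕ
  init_over : ∀ α, Supertile.of α ∈ init → α.Over tiles
  init_nonempty : ∀ α, Supertile.of α ∈ init → α.dom.Nonempty
  init_stable : ∀ α, Supertile.of α ∈ init → α.Stable temp

/-- The assembly `β` results from `α` by the `τ`-stable attachment of a supertile taken
from `P`. -/
def AttachFrom (P : Set Supertile) (τ : ℕ) (α β : Assembly) : Prop :=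
  ∃ δ : Assembly, Supertile.of δ ∈ P ∧ Disjoint α.dom δ.dom ∧ (α.union δ).Stable τ ∧
    β = α.union δ

/-- There is a finite or infinite supertile assembly sequence that starts with `A` and has
result `B`, in which each step attaches a supertile taken from `P`. (Steps may be idle, so a
finite sequence is one that is eventually idle.) -/
def GrowsFrom (P : Set Supertile) (τ : ℕ) (A B : Supertile) : Prop :=
  ∃ (a : ℕ → Assembly) (b : Assembly), Supertile.of (a 0) = A ∧ Supertile.of b = B ∧
    (∀ i, a (i + 1) = a i ∨ AttachFrom P τ (a i) (a (i + 1))) ∧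
    (∀ i, (a i).Sub b) ∧ b.dom = ⋃ i, (a i).dom

namespace TAS

/-- The supertiles that occur in the states reached from the initial state by finitely many
combinations. -/
inductive Reached (𝒯 : TAS) : Supertile → Prop
  | init {A : Supertile} : A ∈ 𝒯.init → Reached 𝒯 A
  | combine {A B C : Supertile} :
      Reached 𝒯 A → Reached 𝒯 B → C ∈ TwoHAM.combine 𝒯.temp A B → Reached 𝒯 C

/-- The producible supertiles: the results of the finite or infinite supertile assembly sequences
that start from the initial state. -/
def producible (𝒯 : TAS) : Set Supertile :=
  {B | ∃ A ∈ 𝒯.init, GrowsFrom {D | 𝒯.Reached D} 𝒯.temp A B}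

/-- `A →¹ B`: one attachment of a producible supertile to `A` yields `B`. -/
def Step (𝒯 : TAS) (A B : Supertile) : Prop :=
  ∃ D ∈ 𝒯.producible, B ∈ combine 𝒯.temp A D

/-- `A →^{≤ 1} B`. -/
def StepLE (𝒯 : TAS) (A B : Supertile) : Prop := A = B ∨ 𝒯.Step A B

/-- `A → B`: a finite or infinite sequence of attachments of producible supertiles leads
from `A` to `B`. -/
def Grows (𝒯 : TAS) (A B : Supertile) : Prop := GrowsFrom 𝒯.producible 𝒯.temp A B

end TAS

/-! ### Simulation -/

/-- An `m`-block: a partial function from `{0, …, m - 1}²` to tile types. -/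
def Block (m : ℕ) : Type := Fin m → Fin m → Option TileType

/-- The `m`-block of `α` at the block position `p`. -/
def Assembly.block (m : ℕ) (α : Assembly) (p : ℤ × ℤ) : Block m :=
  fun i j => α (m * p.1 + i, m * p.2 + j)

/-- The block contains at least one tile. -/
def Block.HasTile {m : ℕ} (b : Block m) : Prop := ∃ i j, b i j ≠ none

/-- The assembly representation function `R*` of a block representation function `R`, a partial
function from `m`-blocks to tile types. -/
def repAssembly {m : ℕ} (R : Block m → Option TileType) (α : Assembly) : Assembly :=
  fun p => R (α.block m p)

/-- `α` maps cleanly to `β`: either every non-empty block of `α` sits at, or directly north, east,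
south or west of, a position of `β`, or `α` has at most one non-empty block. -/
def MapsCleanly (m : ℕ) (α β : Assembly) : Prop :=
  (∀ p, (α.block m p).HasTile → p ∈ β.dom ∨ ∃ d : Dir, p + d.vec ∈ β.dom) ∨
  (∀ p q, (α.block m p).HasTile → (α.block m q).HasTile → p = q)

/-- The supertile representation function: the set of all non-empty images of the members
of `A` under `R*`. Members of `A` with empty image (such as those that are not aligned with the
grid of blocks) are ignored. -/
def repSupertile {m : ℕ} (R : Block m → Option TileType) (A : Supertile) : Set Assembly :=
  {β | β.dom.Nonempty ∧ ∃ α, Supertile.of α = A ∧ repAssembly R α = β}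

/-- `A` represents the supertile `B`: the set of images of the members of `A` is the set of
members of `B`. -/
def Represents {m : ℕ} (R : Block m → Option TileType) (A B : Supertile) : Prop :=
  repSupertile R A = {β | Supertile.of β = B}

/-- `A` represents nothing. -/
def Blank {m : ℕ} (R : Block m → Option TileType) (A : Supertile) : Prop :=
  repSupertile R A = ∅

/-- The supertile `A` maps cleanly: each member with a non-empty image maps cleanly to it, and some
member maps cleanly to its image (so that a blank supertile fits into a single block). -/
def CleanSupertile {m : ℕ} (R : Block m → Option TileType) (A : Supertile) : Prop :=
  (∀ α, Supertile.of α = A → (repAssembly R α).dom.Nonempty →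
    MapsCleanly m α (repAssembly R α)) ∧
  ∃ α, Supertile.of α = A ∧ MapsCleanly m α (repAssembly R α)

/-- `𝒰` and `𝒯` have equivalent productions: the non-blank producible supertiles of `𝒰`
represent exactly the producible supertiles of `𝒯`, and all producible supertiles of `𝒰` map
cleanly. -/
def EquivalentProductions {m : ℕ} (R : Block m → Option TileType) (𝒰 𝒯 : TAS) : Prop :=
  (∀ A ∈ 𝒰.producible, Blank R A ∨ ∃ B ∈ 𝒯.producible, Represents R A B) ∧
  (∀ B ∈ 𝒯.producible, ∃ A ∈ 𝒰.producible, Represents R A B) ∧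
  (∀ A ∈ 𝒰.producible, CleanSupertile R A)

/-- `𝒯` follows `𝒰`: an attachment in `𝒰` to a non-blank supertile represents at most one
attachment in `𝒯`. -/
def Follows {m : ℕ} (R : Block m → Option TileType) (𝒰 𝒯 : TAS) : Prop :=
  ∀ A' ∈ 𝒰.producible, ∀ B' ∈ 𝒰.producible, 𝒰.Step A' B' →
    ∀ A, Represents R A' A → ∃ B, Represents R B' B ∧ 𝒯.StepLE A B

/-- `𝒰` (weakly) models `𝒯`. -/
def WeaklyModels {m : ℕ} (R : Block m → Option TileType) (𝒰 𝒯 : TAS) : Prop :=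
  ∀ A ∈ 𝒯.producible, ∀ B ∈ 𝒯.producible, 𝒯.Step A B →
    ∀ A' ∈ 𝒰.producible, Represents R A' A →
      ∃ A'' ∈ 𝒰.producible, Represents R A'' A ∧ 𝒰.Grows A' A'' ∧
        ∃ B' ∈ 𝒰.producible, Represents R B' B ∧ 𝒰.Step A'' B'

/-- `𝒰` simulates `𝒯` at scale `m`, for the representation function `R`, which maps `m`-blocks to
tile types of `𝒯`. -/
def SimulatesVia {m : ℕ} (R : Block m → Option TileType) (𝒰 𝒯 : TAS) : Prop :=
  (∀ b t, R b = some t → t ∈ 𝒯.tiles) ∧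
  EquivalentProductions R 𝒰 𝒯 ∧ Follows R 𝒰 𝒯 ∧ WeaklyModels R 𝒰 𝒯

/-- `𝒰` simulates `𝒯` at scale `m`. -/
def Simulates (m : ℕ) (𝒰 𝒯 : TAS) : Prop :=
  ∃ R : Block m → Option TileType, SimulatesVia R 𝒰 𝒯

end TwoHAM

namespace TwoHAM

/-! ### Basic facts on assemblies -/

/-! Only about log τ universal tiles are available, and each is present as a free single tile. So
glues can express how strongly two sides bind, but everything specific to 𝒯 has to be expressed by
shape. Strength is expressed by labels whose strengths form a family of about log τ numbers in which
every strength up to τ is a subset sum (`exists_weights`). A code word is written as a square array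
of bumps and dents in interlocking combs. No code word contains another (`exists_code`), so two
facing combs avoid overlap only if they show the same word (`fit_of_disjoint`). Packing the bits and
labels into a square array is what gives the square root in the scale.

A tile becomes a macrotile. A side of it shows its glue through two detachable pads. A pad docks to
its macrotile with strength τ in a comb coded by the tile type, and it meets the opposite pad in a
comb coded by the glue. Since pads are optional, sides with different glues can lie next to each
other, as the model allows. The glue strength, capped at τ, is divided between the two pads, and
neither part reaches τ, so a free pad attaches only where its own macrotile is present
(`exists_body_of_joint_pad`).

The shapes consist of 2 × 2 squares held together by an internal glue of strength ⌈τ/2⌉, so every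
cut of a piece crosses two internal edges (`stable_of_cells`). Internal glues face only positions of
the same piece. Hence a single tile meets a configuration in at most one bond, which is weaker than
τ, and single tiles never attach (`not_joint_single_asm`). A label also determines a position modulo
the block grid, so supertiles that bind are aligned (`aligned_of_joint`).

Consequently each producible supertile is a single tile, a single pad, or a configuration of
macrotiles with docked pads that represents something producible (`producible_cases`). The induction
step is `exists_of_joint`, and `joint_tileAsm` shows that the simulated bonds are not weaker than
the actual ones. Conversely, two configurations whose represented assemblies can bind are made to
bind by adding pads exactly on the bonding sides (`exists_grown`). Infinite sequences are handled by
increasing unions of configurations. -/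

@[simp] theorem Dir.vec_opp (d : Dir) : d.opp.vec = -d.vec := by
  cases d <;> rfl

@[simp] theorem Dir.opp_opp (d : Dir) : d.opp.opp = d := by
  cases d <;> rfl

theorem Dir.vec_ne_zero (d : Dir) : d.vec ≠ 0 := by
  cases d <;> decide

theorem Dir.vec_injective : Function.Injective Dir.vec := by
  intro a b; cases a <;> cases b <;> simp [Dir.vec]

namespace Assembly

theorem mem_dom {α : Assembly} {p : ℤ × ℤ} : p ∈ α.dom ↔ ∃ t, α p = some t := by
  simp [dom, Option.ne_none_iff_exists']

theorem mem_dom_of {α : Assembly} {p : ℤ × ℤ} {t : TileType} (h : α p = some t) : p ∈ α.dom :=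
  mem_dom.2 ⟨t, h⟩

theorem eq_none_of_not_mem {α : Assembly} {p : ℤ × ℤ} (h : p ∉ α.dom) : α p = none := by
  simpa [dom] using h

@[simp] theorem shift_zero (α : Assembly) : shift 0 α = α := by
  funext x; simp [shift]

theorem shift_shift (u v : ℤ × ℤ) (α : Assembly) : shift u (shift v α) = shift (u + v) α := by
  funext x; simp [shift, sub_sub]

@[simp] theorem shift_neg_shift (u : ℤ × ℤ) (α : Assembly) : shift (-u) (shift u α) = α := by
  simp [shift_shift]

theorem mem_dom_shift {u x : ℤ × ℤ} {α : Assembly} : x ∈ (shift u α).dom ↔ x - u ∈ α.dom :=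
  Iff.rfl

theorem disjoint_shift {u : ℤ × ℤ} {α β : Assembly} (h : Disjoint α.dom β.dom) :
    Disjoint (shift u α).dom (shift u β).dom := by
  rw [Set.disjoint_left] at h ⊢
  intro x hx hy
  exact h (mem_dom_shift.1 hx) (mem_dom_shift.1 hy)

theorem dom_union (α β : Assembly) : (α.union β).dom = α.dom ∪ β.dom := by
  ext x
  simp only [dom, union, Set.mem_ofPred_eq, Set.mem_union]
  cases α x <;> simp

theorem sub_refl (α : Assembly) : α.Sub α := fun _ _ h => h

theorem Sub.trans {α β γ : Assembly} (h : α.Sub β) (h' : β.Sub γ) : α.Sub γ :=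
  fun p t hp => h' p t (h p t hp)

theorem Sub.dom_subset {α β : Assembly} (h : α.Sub β) : α.dom ⊆ β.dom := by
  intro x hx
  obtain ⟨t, ht⟩ := mem_dom.1 hx
  exact mem_dom_of (h x t ht)

theorem sub_union_left (α β : Assembly) : α.Sub (α.union β) := by
  intro p t h; simp [union, h]

theorem union_apply_of_not_mem {α β : Assembly} {p : ℤ × ℤ} (h : p ∉ α.dom) :
    (α.union β) p = β p := by
  simp [union, eq_none_of_not_mem h]

theorem sub_union_right {α β : Assembly} (h : Disjoint α.dom β.dom) : β.Sub (α.union β) := by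
  intro p t hp
  rw [union_apply_of_not_mem (Set.disjoint_right.1 h (mem_dom_of hp)), hp]

theorem union_comm {α β : Assembly} (h : Disjoint α.dom β.dom) : α.union β = β.union α := by
  funext x
  by_cases hx : x ∈ α.dom
  · have := eq_none_of_not_mem (Set.disjoint_left.1 h hx)
    simp [union, this]
  · simp [union, eq_none_of_not_mem hx]

theorem union_assoc (α β γ : Assembly) : (α.union β).union γ = α.union (β.union γ) := by
  funext x; simp [union, Option.or_assoc]

theorem Sub.shift {α β : Assembly} (h : α.Sub β) (u : ℤ × ℤ) : (α.shift u).Sub (β.shift u) :=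
  fun p t hp => h (p - u) t hp

theorem union_sub {α β γ : Assembly} (h : α.Sub γ) (h' : β.Sub γ) : (α.union β).Sub γ := by
  intro p t hp
  by_cases hx : p ∈ α.dom
  · obtain ⟨s, hs⟩ := mem_dom.1 hx
    have : (α.union β) p = some s := by simp [union, hs]
    rw [hp] at this; cases this; exact h p _ hs
  · rw [union_apply_of_not_mem hx] at hp; exact h' p t hp

theorem Over.shift {T : Finset TileType} {α : Assembly} (h : α.Over T) (u : ℤ × ℤ) :
    (α.shift u).Over T := fun p t hp => h (p - u) t hp

/-- The strength of the bond from a tile of `α` at `p` to a tile of `β` next to it. -/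
def cross (α β : Assembly) (p : ℤ × ℤ) (d : Dir) : ℕ :=
  match α p, β (p + d.vec) with
  | some s, some t => if s.glue d = t.glue d.opp then (s.glue d).strength else 0
  | _, _ => 0

theorem bond_eq_cross (α : Assembly) (p : ℤ × ℤ) (d : Dir) : α.bond p d = cross α α p d := rfl

theorem cross_of {α β : Assembly} {p : ℤ × ℤ} {d : Dir} {s t : TileType} (hs : α p = some s)
    (ht : β (p + d.vec) = some t) :
    cross α β p d = if s.glue d = t.glue d.opp then (s.glue d).strength else 0 := by
  simp [cross, hs, ht]

theorem exists_of_cross_ne_zero {α β : Assembly} {p : ℤ × ℤ} {d : Dir} (h : cross α β p d ≠ 0) :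
    ∃ s t, α p = some s ∧ β (p + d.vec) = some t ∧ s.glue d = t.glue d.opp ∧
      cross α β p d = (s.glue d).strength := by
  unfold cross at h
  split at h
  · rename_i s t hs ht
    refine ⟨s, t, hs, ht, ?_, ?_⟩
    · by_contra hne; simp [hne] at h
    · rw [cross_of hs ht, if_pos]; by_contra hne; simp [hne] at h
  · simp at h

theorem cross_mono {α β α' β' : Assembly} (h : α.Sub α') (h' : β.Sub β') (p : ℤ × ℤ) (d : Dir) :
    cross α β p d ≤ cross α' β' p d := by
  by_cases h0 : cross α β p d = 0
  · omega
  · obtain ⟨s, t, hs, ht, hg, he⟩ := exists_of_cross_ne_zero h0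
    rw [he, cross_of (h _ _ hs) (h' _ _ ht), if_pos hg]

theorem cross_shift (u : ℤ × ℤ) (α β : Assembly) (p : ℤ × ℤ) (d : Dir) :
    cross (shift u α) (shift u β) p d = cross α β (p - u) d := by
  simp only [cross, shift]
  rw [show p + d.vec - u = p - u + d.vec by abel]

theorem cross_comm (α β : Assembly) (p : ℤ × ℤ) (d : Dir) :
    cross α β p d = cross β α (p + d.vec) d.opp := by
  have hp : p + d.vec + d.opp.vec = p := by simp
  simp only [cross, hp, Dir.opp_opp]
  cases α p <;> cases β (p + d.vec) <;> simp
  rename_i s t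
  by_cases h : s.glue d = t.glue d.opp
  · simp [h]
  · simp [h, Ne.symm h]

/-- The bonds between `α` and `β` have total strength at least `τ`. -/
def Joint (τ : ℕ) (α β : Assembly) : Prop :=
  ∃ F : Finset ((ℤ × ℤ) × Dir), τ ≤ ∑ e ∈ F, cross α β e.1 e.2

theorem Joint.mono {τ : ℕ} {α β α' β' : Assembly} (H : Joint τ α β) (h : α.Sub α')
    (h' : β.Sub β') : Joint τ α' β' := by
  obtain ⟨F, hF⟩ := H
  exact ⟨F, hF.trans (Finset.sum_le_sum fun e _ => cross_mono h h' _ _)⟩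

/-- Reversal of an edge. -/
def revEdge : ((ℤ × ℤ) × Dir) ≃ ((ℤ × ℤ) × Dir) where
  toFun e := (e.1 + e.2.vec, e.2.opp)
  invFun e := (e.1 + e.2.vec, e.2.opp)
  left_inv e := by simp
  right_inv e := by simp

theorem Joint.symm {τ : ℕ} {α β : Assembly} (H : Joint τ α β) : Joint τ β α := by
  obtain ⟨F, hF⟩ := H
  refine ⟨F.map revEdge.toEmbedding, hF.trans (le_of_eq ?_)⟩
  rw [Finset.sum_map]
  exact Finset.sum_congr rfl fun e _ => cross_comm _ _ _ _

theorem Joint.shift {τ : ℕ} {α β : Assembly} (H : Joint τ α β) (u : ℤ × ℤ) :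
    Joint τ (α.shift u) (β.shift u) := by
  obtain ⟨F, hF⟩ := H
  refine ⟨F.map ((Equiv.addRight u).prodCongr (Equiv.refl _)).toEmbedding,
    hF.trans (le_of_eq ?_)⟩
  rw [Finset.sum_map]
  refine Finset.sum_congr rfl fun e _ => ?_
  rw [cross_shift]; simp

/-- There are cut edges of total weight at least `τ` from `A` to its complement. -/
def Cut (τ : ℕ) (α : Assembly) (A : Set (ℤ × ℤ)) : Prop :=
  ∃ F : Finset ((ℤ × ℤ) × Dir),
    (∀ e ∈ F, e.1 ∈ A ∧ e.1 + e.2.vec ∉ A) ∧ τ ≤ ∑ e ∈ F, α.bond e.1 e.2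

/-- A cut that splits `α.dom` restricts to a cut of `α`, and bonds of `α` persist in `β`. -/
theorem Stable.cut_of_sub {τ : ℕ} {α β : Assembly} {A : Set (ℤ × ℤ)} (hs : α.Stable τ)
    (h : α.Sub β) (h1 : ∃ x ∈ α.dom, x ∈ A) (h2 : ∃ x ∈ α.dom, x ∉ A) : Cut τ β A := by
  obtain ⟨x, hx, hxA⟩ := h1
  obtain ⟨y, hy, hyA⟩ := h2
  obtain ⟨F, hF, hw⟩ := hs (A ∩ α.dom) Set.inter_subset_right ⟨x, hxA, hx⟩
    (fun he => by
      have : y ∈ A ∩ α.dom := by rw [he]; exact hy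
      exact hyA this.1)
  -- An edge leaving `A ∩ α.dom` might end in `A` outside `α.dom`. Such an edge has weight 0 and is
  -- dropped.
  refine ⟨F.filter fun e => α.bond e.1 e.2 ≠ 0, ?_, ?_⟩
  · intro e he
    rw [Finset.mem_filter] at he
    obtain ⟨s, t, h1, h2, -⟩ := exists_of_cross_ne_zero he.2
    have := hF e he.1
    exact ⟨this.1.1, fun hA => this.2 ⟨hA, mem_dom_of h2⟩⟩
  · rw [← Finset.sum_filter_ne_zero] at hw
    exact hw.trans (Finset.sum_le_sum fun e _ => cross_mono h h _ _)

theorem Joint.cut {τ : ℕ} {α β γ : Assembly} {A : Set (ℤ × ℤ)} (H : Joint τ α β)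
    (hα : α.Sub γ) (hβ : β.Sub γ) (h1 : α.dom ⊆ A) (h2 : Disjoint β.dom A) : Cut τ γ A := by
  obtain ⟨F, hF⟩ := H
  refine ⟨F.filter fun e => cross α β e.1 e.2 ≠ 0, ?_, ?_⟩
  · intro e he
    rw [Finset.mem_filter] at he
    obtain ⟨s, t, hs, ht, -⟩ := exists_of_cross_ne_zero he.2
    exact ⟨h1 (mem_dom_of hs), Set.disjoint_left.1 h2 (mem_dom_of ht)⟩
  · rw [← Finset.sum_filter_ne_zero] at hF
    exact hF.trans (Finset.sum_le_sum fun e _ => cross_mono hα hβ _ _)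

/-- A cut either splits one of the two parts, which then supplies the weight, or separates the
parts, and then the joint supplies it. -/
theorem Stable.union {τ : ℕ} {α β : Assembly} (hα : α.Stable τ) (hβ : β.Stable τ)
    (hd : Disjoint α.dom β.dom) (H : Joint τ α β) : (α.union β).Stable τ := by
  intro A hA hne hne'
  have sα := sub_union_left α β
  have sβ := sub_union_right hd
  by_cases h1 : (∃ x ∈ α.dom, x ∈ A) ∧ ∃ x ∈ α.dom, x ∉ A
  · exact hα.cut_of_sub sα h1.1 h1.2
  by_cases h2 : (∃ x ∈ β.dom, x ∈ A) ∧ ∃ x ∈ β.dom, x ∉ A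
  · exact hβ.cut_of_sub sβ h2.1 h2.2
  obtain ⟨x, hx⟩ := hne
  obtain ⟨y, hy, hyA⟩ : ∃ y ∈ (α.union β).dom, y ∉ A := by
    by_contra! h; exact hne' (Set.Subset.antisymm hA h)
  have hx' := hA hx
  rw [dom_union] at hy hx'
  push Not at h1 h2
  rcases hx' with hx' | hx' <;> rcases hy with hy | hy
  · exact absurd (h1 ⟨x, hx', hx⟩ y hy) hyA
  · refine H.cut sα sβ (h1 ⟨x, hx', hx⟩) (Set.disjoint_left.2 fun z hz hzA => ?_)
    exact hyA (h2 ⟨z, hz, hzA⟩ y hy)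
  · refine H.symm.cut sβ sα (h2 ⟨x, hx', hx⟩) (Set.disjoint_left.2 fun z hz hzA => ?_)
    exact hyA (h1 ⟨z, hz, hzA⟩ y hy)
  · exact absurd (h2 ⟨x, hx', hx⟩ y hy) hyA

theorem Stable.joint {τ : ℕ} {α β : Assembly} (h : (α.union β).Stable τ)
    (hd : Disjoint α.dom β.dom) (h1 : α.dom.Nonempty) (h2 : β.dom.Nonempty) : Joint τ α β := by
  obtain ⟨F, hF, hw⟩ := h α.dom (by rw [dom_union]; exact Set.subset_union_left) h1 (by
    obtain ⟨x, hx⟩ := h2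
    intro he
    have : x ∈ α.dom := by rw [he, dom_union]; exact Or.inr hx
    exact Set.disjoint_left.1 hd this hx)
  refine ⟨F, hw.trans (Finset.sum_le_sum fun e he => ?_)⟩
  rw [bond_eq_cross]
  by_cases h0 : cross (α.union β) (α.union β) e.1 e.2 = 0
  · omega
  obtain ⟨s, t, hs, ht, hg, hw⟩ := exists_of_cross_ne_zero h0
  obtain ⟨h3, h4⟩ := hF e he
  obtain ⟨s', hs'⟩ := mem_dom.1 h3
  rw [sub_union_left α β _ _ hs'] at hs
  cases hs
  rw [union_apply_of_not_mem h4] at ht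
  rw [hw, cross_of hs' ht, if_pos hg]

theorem Stable.shift {τ : ℕ} {α : Assembly} (h : α.Stable τ) (u : ℤ × ℤ) :
    (α.shift u).Stable τ := by
  intro A hA hne hne'
  obtain ⟨F, hF, hw⟩ := h {x | x + u ∈ A} (fun x hx => by simpa [mem_dom_shift] using hA hx)
    (by obtain ⟨x, hx⟩ := hne; exact ⟨x - u, by simpa using hx⟩)
    (fun he => hne' (Set.Subset.antisymm hA fun x hx => by
      have : x - u ∈ {x | x + u ∈ A} := by rw [he]; exact hx
      simpa using this))
  refine ⟨F.map ((Equiv.addRight u).prodCongr (Equiv.refl _)).toEmbedding, ?_, ?_⟩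
  · intro e he
    rw [Finset.mem_map] at he
    obtain ⟨e, he, rfl⟩ := he
    have := hF e he
    refine ⟨this.1, ?_⟩
    have h2 := this.2
    simp only [Set.mem_ofPred_eq] at h2
    simpa [add_right_comm] using h2
  · rw [Finset.sum_map]
    refine hw.trans (le_of_eq (Finset.sum_congr rfl fun e _ => ?_))
    rw [bond_eq_cross, bond_eq_cross, cross_shift]; simp

theorem single_stable (τ : ℕ) (t : TileType) : (single t).Stable τ := by
  intro A hA ⟨x, hx⟩ hne
  have key : ∀ y, y ∈ (single t).dom → y = 0 := by
    intro y hy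
    by_contra h; simp [dom, single, h] at hy
  exact absurd (Set.Subset.antisymm hA fun y hy => by
    rw [key y hy, ← key x (hA hx)]; exact hx) hne

/-- An increasing union of stable assemblies is stable. -/
theorem stable_of_iUnion {τ : ℕ} {a : ℕ → Assembly} {b : Assembly} (hs : ∀ i, (a i).Stable τ)
    (hm : ∀ i j, i ≤ j → (a i).Sub (a j)) (hb : ∀ i, (a i).Sub b)
    (hd : b.dom = ⋃ i, (a i).dom) : b.Stable τ := by
  intro A hA ⟨x, hx⟩ hne
  obtain ⟨y, hy, hyA⟩ : ∃ y ∈ b.dom, y ∉ A := by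
    by_contra! h; exact hne (Set.Subset.antisymm hA h)
  have hx' := hA hx
  rw [hd, Set.mem_iUnion] at hx' hy
  obtain ⟨i, hi⟩ := hx'
  obtain ⟨j, hj⟩ := hy
  exact (hs (max i j)).cut_of_sub (hb _) ⟨x, (hm i _ (le_max_left _ _)).dom_subset hi, hx⟩
    ⟨y, (hm j _ (le_max_right _ _)).dom_subset hj, hyA⟩

theorem ext_of_sub {α β : Assembly} (h : α.Sub β) (hd : β.dom ⊆ α.dom) : α = β := by
  funext x
  by_cases hx : x ∈ α.dom
  · obtain ⟨t, ht⟩ := mem_dom.1 hx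
    rw [ht, h _ _ ht]
  · rw [eq_none_of_not_mem hx, eq_none_of_not_mem fun hb => hx (hd hb)]

end Assembly

open Assembly

theorem Supertile.of_eq_iff {α β : Assembly} :
    Supertile.of α = Supertile.of β ↔ ∃ u, Assembly.shift u α = β :=
  ⟨fun h => Quotient.exact h, fun h => Quotient.sound h⟩

@[simp] theorem Supertile.of_shift (u : ℤ × ℤ) (α : Assembly) :
    Supertile.of (shift u α) = Supertile.of α :=
  (Supertile.of_eq_iff.2 ⟨u, rfl⟩).symm

theorem Supertile.exists_of (A : Supertile) : ∃ α, Supertile.of α = A := Quotient.exists_rep A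

/-! ### Assembly sequences -/

theorem AttachFrom.shift {P : Set Supertile} {τ : ℕ} {α β : Assembly} (h : AttachFrom P τ α β)
    (u : ℤ × ℤ) : AttachFrom P τ (α.shift u) (β.shift u) := by
  obtain ⟨δ, hδ, hd, hs, rfl⟩ := h
  exact ⟨δ.shift u, by simpa using hδ, disjoint_shift hd, hs.shift u, rfl⟩

theorem AttachFrom.sub {P : Set Supertile} {τ : ℕ} {α β : Assembly} (h : AttachFrom P τ α β) :
    α.Sub β := by
  obtain ⟨δ, hδ, hd, hs, rfl⟩ := h
  exact sub_union_left _ _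

/-- Finite assembly sequences. -/
abbrev AttachStar (P : Set Supertile) (τ : ℕ) : Assembly → Assembly → Prop :=
  Relation.ReflTransGen (AttachFrom P τ)

theorem AttachStar.shift {P : Set Supertile} {τ : ℕ} {α β : Assembly} (h : AttachStar P τ α β)
    (u : ℤ × ℤ) : AttachStar P τ (α.shift u) (β.shift u) := by
  induction h with
  | refl => exact .refl
  | tail _ h ih => exact ih.tail (h.shift u)

theorem AttachStar.sub {P : Set Supertile} {τ : ℕ} {α β : Assembly} (h : AttachStar P τ α β) :
    α.Sub β := by
  induction h with
  | refl => exact sub_refl _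
  | tail _ h ih => exact ih.trans h.sub

/-- An infinite sequence of finite assembly sequences. -/
structure IsSeq (r : Assembly → Assembly → Prop) (c : ℕ → Assembly) (b : Assembly) : Prop where
  step : ∀ i, r (c i) (c (i + 1))
  sub : ∀ i, (c i).Sub b
  dom : b.dom = ⋃ i, (c i).dom

theorem IsSeq.shift {r : Assembly → Assembly → Prop} {c : ℕ → Assembly} {b : Assembly}
    (h : IsSeq r c b) (u : ℤ × ℤ) (hr : ∀ a a', r a a' → r (a.shift u) (a'.shift u)) :
    IsSeq r (fun i => (c i).shift u) (b.shift u) where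
  step i := hr _ _ (h.step i)
  sub i := (h.sub i).shift u
  dom := by
    ext x
    rw [mem_dom_shift, h.dom]
    simp only [Set.mem_iUnion]
    rfl

/-- Single steps, possibly idle. -/
def IdleStep (P : Set Supertile) (τ : ℕ) (a b : Assembly) : Prop := b = a ∨ AttachFrom P τ a b

theorem IdleStep.shift {P : Set Supertile} {τ : ℕ} {α β : Assembly} (h : IdleStep P τ α β)
    (u : ℤ × ℤ) : IdleStep P τ (α.shift u) (β.shift u) := by
  rcases h with rfl | h
  · exact Or.inl rfl
  · exact Or.inr (h.shift u)

theorem IdleStep.star {P : Set Supertile} {τ : ℕ} {α β : Assembly} (h : IdleStep P τ α β) :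
    AttachStar P τ α β := by
  rcases h with rfl | h
  · exact .refl
  · exact .single h

theorem growsFrom_iff {P : Set Supertile} {τ : ℕ} {A B : Supertile} :
    GrowsFrom P τ A B ↔ ∃ c b, Supertile.of (c 0) = A ∧ Supertile.of b = B ∧
      IsSeq (IdleStep P τ) c b :=
  ⟨fun ⟨c, b, h1, h2, h3, h4, h5⟩ => ⟨c, b, h1, h2, h3, h4, h5⟩,
    fun ⟨c, b, h1, h2, h⟩ => ⟨c, b, h1, h2, h.step, h.sub, h.dom⟩⟩

/-- An assembly sequence can be normalised so as to have a given result. -/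
theorem GrowsFrom.exists_seq_to {P : Set Supertile} {τ : ℕ} {A : Supertile} {b : Assembly}
    (h : GrowsFrom P τ A (Supertile.of b)) :
    ∃ c, Supertile.of (c 0) = A ∧ IsSeq (IdleStep P τ) c b := by
  obtain ⟨c, b', h1, h2, h3⟩ := growsFrom_iff.1 h
  obtain ⟨u, rfl⟩ := Supertile.of_eq_iff.1 h2
  exact ⟨_, by simpa using h1, h3.shift u fun _ _ h => h.shift u⟩

theorem IsSeq.star {P : Set Supertile} {τ : ℕ} {c : ℕ → Assembly} {b : Assembly}
    (h : IsSeq (IdleStep P τ) c b) : IsSeq (AttachStar P τ) c b :=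
  ⟨fun i => (h.step i).star, h.sub, h.dom⟩

theorem IsSeq.star_le {P : Set Supertile} {τ : ℕ} {c : ℕ → Assembly} {b : Assembly}
    (h : IsSeq (AttachStar P τ) c b) {i j : ℕ} (hij : i ≤ j) : AttachStar P τ (c i) (c j) := by
  induction hij with
  | refl => exact .refl
  | step _ ih => exact ih.trans (h.step _)

theorem exists_path_of_star {r : Assembly → Assembly → Prop} {x y : Assembly}
    (h : Relation.ReflTransGen r x y) : ∃ n, ∃ f : ℕ → Assembly, f 0 = x ∧ f n = y ∧
      ∀ j < n, r (f j) (f (j + 1)) := by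
  induction h with
  | refl => exact ⟨0, fun _ => x, rfl, rfl, fun j hj => absurd hj (by omega)⟩
  | @tail y z _ h ih =>
    obtain ⟨n, f, h0, h1, h2⟩ := ih
    refine ⟨n + 1, fun j => if j ≤ n then f j else z, by simp [h0], by simp, fun j hj => ?_⟩
    by_cases hjn : j < n
    · simpa [hjn.le, Nat.succ_le_of_lt hjn] using h2 j hjn
    · obtain rfl : j = n := by omega
      simpa [h1] using h

/-- A sequence of finite assembly sequences can be flattened. -/
theorem IsSeq.growsFrom {P : Set Supertile} {τ : ℕ} {c : ℕ → Assembly} {b : Assembly}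
    (h : IsSeq (AttachStar P τ) c b) : GrowsFrom P τ (Supertile.of (c 0)) (Supertile.of b) := by
  choose n f h0 h1 h2 using fun i => exists_path_of_star (h.step i)
  -- The counter `(i, j)` points to the `j`-th assembly of the `i`-th finite sequence. Passing from
  -- the end of one sequence to the start of the next is an idle step, since both assemblies equal
  -- `c (i + 1)`.
  let next : ℕ × ℕ → ℕ × ℕ := fun s => if s.2 < n s.1 then (s.1, s.2 + 1) else (s.1 + 1, 0)
  let st : ℕ → ℕ × ℕ := fun N => next^[N] (0, 0)
  have hst : ∀ N, st (N + 1) = next (st N) := fun N => Function.iterate_succ_apply' _ _ _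
  have hle : ∀ N, (st N).2 ≤ n (st N).1 := by
    intro N
    induction N with
    | zero => exact Nat.zero_le _
    | succ N ih =>
      rw [hst]
      by_cases hl : (st N).2 < n (st N).1
      · simp only [next, if_pos hl]; omega
      · simp [next, if_neg hl]
  have hwalk : ∀ i j, j ≤ n i → ∀ N, st N = (i, 0) → st (N + j) = (i, j) := by
    intro i j
    induction j with
    | zero => intro _ N h; exact h
    | succ j ih =>
      intro hj N hN
      rw [← Nat.add_assoc, hst, ih (by omega) N hN]
      simp only [next]; rw [if_pos (by omega)]
  have hall : ∀ i, ∃ N, st N = (i, 0) := by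
    intro i
    induction i with
    | zero => exact ⟨0, rfl⟩
    | succ i ih =>
      obtain ⟨N, hN⟩ := ih
      refine ⟨N + n i + 1, ?_⟩
      rw [hst, hwalk i _ le_rfl N hN]
      simp [next]
  have hsub : ∀ i j, j ≤ n i → (f i j).Sub b := by
    intro i j hj
    -- Backwards from the last assembly `c (i + 1)` of the sequence, which is known to lie in `b`.
    have : ∀ k, k ≤ n i → (f i (n i - k)).Sub b := by
      intro k
      induction k with
      | zero => intro _; rw [Nat.sub_zero, h1]; exact h.sub _
      | succ k ih =>
        intro hk
        have h3 := h2 i (n i - (k + 1)) (by omega)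
        rw [show n i - (k + 1) + 1 = n i - k by omega] at h3
        exact h3.sub.trans (ih (by omega))
    simpa [Nat.sub_sub_self hj] using this (n i - j) (by omega)
  refine growsFrom_iff.2 ⟨fun N => f (st N).1 (st N).2, b, ?_, rfl, ?_, ?_, ?_⟩
  · exact congrArg _ (h0 0)
  · intro N
    simp only [hst]
    by_cases hl : (st N).2 < n (st N).1
    · simp only [next, if_pos hl]
      exact Or.inr (h2 _ _ hl)
    · simp only [next, if_neg hl]
      left
      rw [h0, ← h1]
      congr 1
      have := hle N; omega
  · exact fun N => hsub _ _ (hle N)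
  · refine Set.Subset.antisymm ?_ (Set.iUnion_subset fun N => (hsub _ _ (hle N)).dom_subset)
    rw [h.dom]
    refine Set.iUnion_subset fun i => ?_
    obtain ⟨N, hN⟩ := hall i
    refine Set.subset_iUnion_of_subset N ?_
    simp [hN, h0]

theorem IsSeq.prefix {P : Set Supertile} {τ : ℕ} {c : ℕ → Assembly} {a b : Assembly}
    (h : IsSeq (AttachStar P τ) c b) (ha : AttachStar P τ a (c 0)) :
    GrowsFrom P τ (Supertile.of a) (Supertile.of b) := by
  have : IsSeq (AttachStar P τ) (fun n => Nat.casesOn n a c) b := by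
    refine ⟨fun i => ?_, fun i => ?_, ?_⟩
    · cases i with
      | zero => exact ha
      | succ i => exact h.step i
    · cases i with
      | zero => exact ha.sub.trans (h.sub 0)
      | succ i => exact h.sub i
    · refine Set.Subset.antisymm ?_ (Set.iUnion_subset fun i => ?_)
      · rw [h.dom]
        exact Set.iUnion_subset fun i => Set.subset_iUnion_of_subset (i + 1) subset_rfl
      · cases i with
        | zero => exact (ha.sub.trans (h.sub 0)).dom_subset
        | succ i => exact (h.sub i).dom_subset
  exact this.growsFrom

theorem IsSeq.const {P : Set Supertile} {τ : ℕ} (a : Assembly) :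
    IsSeq (AttachStar P τ) (fun _ => a) a :=
  ⟨fun _ => .refl, fun _ => sub_refl _, (Set.iUnion_const _).symm⟩

theorem AttachStar.growsFrom {P : Set Supertile} {τ : ℕ} {a b : Assembly}
    (h : AttachStar P τ a b) : GrowsFrom P τ (Supertile.of a) (Supertile.of b) :=
  (IsSeq.const b).prefix h

/-! ### Reached and producible supertiles -/

namespace TAS

variable {𝒯 : TAS}

/-- Following first operands down the tree of combinations leads to an element of the initial state.
Each second operand met on the way is a reached supertile that is attached in one step. -/
theorem Reached.exists_star {D : Supertile} (h : 𝒯.Reached D) :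
    ∀ δ, Supertile.of δ = D → ∃ a, Supertile.of a ∈ 𝒯.init ∧
      AttachStar {D | 𝒯.Reached D} 𝒯.temp a δ := by
  induction h with
  | init h => intro δ hδ; exact ⟨δ, hδ ▸ h, .refl⟩
  | combine hA hB hC ihA _ =>
    rintro δ rfl
    obtain ⟨α, β, rfl, rfl, hd, hs, he⟩ := hC
    obtain ⟨u, rfl⟩ := Supertile.of_eq_iff.1 he
    obtain ⟨a, ha, hst⟩ := ihA α rfl
    exact ⟨a.shift u, by simpa using ha,
      AttachStar.shift (hst.tail ⟨β, hB, hd, hs, rfl⟩) u⟩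

theorem Reached.of_star {α β : Assembly} (h : AttachStar {D | 𝒯.Reached D} 𝒯.temp α β)
    (hα : 𝒯.Reached (Supertile.of α)) : 𝒯.Reached (Supertile.of β) := by
  induction h with
  | refl => exact hα
  | tail _ h ih =>
    obtain ⟨δ, hδ, hd, hs, rfl⟩ := h
    exact .combine ih hδ ⟨_, _, rfl, rfl, hd, hs, rfl⟩

theorem Reached.stable {D : Supertile} (h : 𝒯.Reached D) :
    ∀ δ, Supertile.of δ = D → δ.Stable 𝒯.temp ∧ δ.dom.Nonempty ∧ δ.Over 𝒯.tiles := by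
  induction h with
  | init h => rintro δ rfl; exact ⟨𝒯.init_stable δ h, 𝒯.init_nonempty δ h, 𝒯.init_over δ h⟩
  | combine hA hB hC ihA ihB =>
    rintro δ rfl
    obtain ⟨α, β, h1, h2, hd, hs, he⟩ := hC
    obtain ⟨u, rfl⟩ := Supertile.of_eq_iff.1 he
    refine ⟨hs.shift u, ?_, ?_⟩
    · obtain ⟨x, hx⟩ := (ihA α h1).2.1
      exact ⟨x + u, by rw [mem_dom_shift, dom_union]; left; simpa using hx⟩
    · refine Over.shift ?_ u
      intro p t hp
      by_cases hx : p ∈ α.dom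
      · obtain ⟨s, hs⟩ := mem_dom.1 hx
        rw [sub_union_left α β _ _ hs] at hp; cases hp
        exact (ihA α h1).2.2 _ _ hs
      · rw [union_apply_of_not_mem hx] at hp
        exact (ihB β h2).2.2 _ _ hp

theorem exists_seq_of_producible {b : Assembly} (h : Supertile.of b ∈ 𝒯.producible) :
    ∃ c, IsSeq (IdleStep {D | 𝒯.Reached D} 𝒯.temp) c b ∧ Supertile.of (c 0) ∈ 𝒯.init := by
  obtain ⟨A, hA, hg⟩ := h
  obtain ⟨c, h1, h2⟩ := hg.exists_seq_to
  exact ⟨c, h2, h1 ▸ hA⟩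

theorem producible_of_seq {c : ℕ → Assembly} {b : Assembly}
    (h : IsSeq (AttachStar {D | 𝒯.Reached D} 𝒯.temp) c b)
    (h0 : 𝒯.Reached (Supertile.of (c 0))) : Supertile.of b ∈ 𝒯.producible := by
  obtain ⟨a, ha, hs⟩ := h0.exists_star _ rfl
  exact ⟨_, ha, h.prefix hs⟩

theorem Reached.producible {D : Supertile} (h : 𝒯.Reached D) : D ∈ 𝒯.producible := by
  obtain ⟨δ, rfl⟩ := D.exists_of
  exact producible_of_seq (IsSeq.const δ) h

theorem seq_reached {c : ℕ → Assembly} {b : Assembly}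
    (h : IsSeq (AttachStar {D | 𝒯.Reached D} 𝒯.temp) c b)
    (h0 : 𝒯.Reached (Supertile.of (c 0))) (i : ℕ) : 𝒯.Reached (Supertile.of (c i)) :=
  Reached.of_star (h.star_le (Nat.zero_le i)) h0

theorem producible_stable {b : Assembly} (h : Supertile.of b ∈ 𝒯.producible) :
    b.Stable 𝒯.temp ∧ b.dom.Nonempty ∧ b.Over 𝒯.tiles := by
  obtain ⟨c, hc, h0⟩ := exists_seq_of_producible h
  have hr := fun i => (seq_reached hc.star (.init h0) i).stable _ rfl
  refine ⟨stable_of_iUnion (fun i => (hr i).1) (fun i j hij => (hc.star.star_le hij).sub) hc.sub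
    hc.dom, ?_, ?_⟩
  · obtain ⟨x, hx⟩ := (hr 0).2.1
    exact ⟨x, (hc.sub 0).dom_subset hx⟩
  · intro p t hp
    have := mem_dom_of hp
    rw [hc.dom, Set.mem_iUnion] at this
    obtain ⟨i, hi⟩ := this
    obtain ⟨s, hs⟩ := mem_dom.1 hi
    rw [hc.sub i _ _ hs] at hp; cases hp
    exact (hr i).2.2 _ _ hs

/-- A joint is witnessed by finitely many edges, and the ends of each edge are present from some
stage on. -/
theorem exists_joint_of_seq {τ : ℕ} {a d : ℕ → Assembly} {α δ : Assembly}
    (ha : ∀ i j, i ≤ j → (a i).Sub (a j)) (hd : ∀ i j, i ≤ j → (d i).Sub (d j))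
    (ha' : ∀ i, (a i).Sub α) (hd' : ∀ i, (d i).Sub δ)
    (hα : α.dom = ⋃ i, (a i).dom) (hδ : δ.dom = ⋃ i, (d i).dom) (H : Joint τ α δ) :
    ∃ N, Joint τ (a N) (d N) := by
  obtain ⟨F, hF⟩ := H
  have : ∀ e : (ℤ × ℤ) × Dir, ∃ N, cross α δ e.1 e.2 ≤ cross (a N) (d N) e.1 e.2 := by
    intro e
    by_cases h0 : cross α δ e.1 e.2 = 0
    · exact ⟨0, by omega⟩
    obtain ⟨s, t, hs, ht, hg, he⟩ := exists_of_cross_ne_zero h0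
    have h1 := mem_dom_of hs
    have h2 := mem_dom_of ht
    rw [hα, Set.mem_iUnion] at h1
    rw [hδ, Set.mem_iUnion] at h2
    obtain ⟨i, hi⟩ := h1
    obtain ⟨j, hj⟩ := h2
    obtain ⟨s', hs'⟩ := mem_dom.1 hi
    obtain ⟨t', ht'⟩ := mem_dom.1 hj
    rw [ha' i _ _ hs'] at hs; cases hs
    rw [hd' j _ _ ht'] at ht; cases ht
    refine ⟨max i j, ?_⟩
    rw [he, cross_of (ha i _ (le_max_left _ _) _ _ hs') (hd j _ (le_max_right _ _) _ _ ht'),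
      if_pos hg]
  choose N hN using this
  refine ⟨F.sup N, F, hF.trans (Finset.sum_le_sum fun e he => (hN e).trans ?_)⟩
  exact cross_mono (ha _ _ (Finset.le_sup he)) (hd _ _ (Finset.le_sup he)) _ _

/-- The combination of two producible supertiles is producible. -/
theorem producible_combine {A D C : Supertile} (hA : A ∈ 𝒯.producible) (hD : D ∈ 𝒯.producible)
    (hC : C ∈ combine 𝒯.temp A D) : C ∈ 𝒯.producible := by
  obtain ⟨α, δ, rfl, rfl, hdis, hst, rfl⟩ := hC
  obtain ⟨a, ha, ha0⟩ := exists_seq_of_producible hA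
  obtain ⟨d, hd, hd0⟩ := exists_seq_of_producible hD
  have ham : ∀ i j, i ≤ j → (a i).Sub (a j) := fun i j hij => (ha.star.star_le hij).sub
  have hdm : ∀ i j, i ≤ j → (d i).Sub (d j) := fun i j hij => (hd.star.star_le hij).sub
  have har := seq_reached ha.star (.init ha0)
  have hdr := seq_reached hd.star (.init hd0)
  -- From stage `N` on the two growing assemblies are already bound to each other. They are combined
  -- at stage `N`, and afterwards the steps of the two sequences alternate.
  obtain ⟨N, hN⟩ := exists_joint_of_seq ham hdm ha.sub hd.sub ha.dom hd.dom
    (hst.joint hdis (producible_stable hA).2.1 (producible_stable hD).2.1)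
  have hdisj : ∀ i j, Disjoint (a i).dom (d j).dom := fun i j =>
    Set.disjoint_of_subset (ha.sub i).dom_subset (hd.sub j).dom_subset hdis
  have hsub : ∀ i j, ((a i).union (d j)).Sub (α.union δ) := fun i j =>
    union_sub ((ha.sub i).trans (sub_union_left _ _)) ((hd.sub j).trans (sub_union_right hdis))
  have hun : ∀ i j, N ≤ i → N ≤ j → ((a i).union (d j)).Stable 𝒯.temp := fun i j hi hj =>
    ((har i).stable _ rfl).1.union ((hdr j).stable _ rfl).1 (hdisj i j)
      (hN.mono (ham _ _ hi) (hdm _ _ hj))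
  have hseq : IsSeq (AttachStar {D | 𝒯.Reached D} 𝒯.temp)
      (fun n => (a (N + n)).union (d (N + n))) (α.union δ) := by
    refine ⟨fun n => ?_, fun n => hsub _ _, ?_⟩
    · have h1 : AttachStar {D | 𝒯.Reached D} 𝒯.temp ((a (N + n)).union (d (N + n)))
          ((a (N + n + 1)).union (d (N + n))) := by
        rcases ha.step (N + n) with h | ⟨ε, hε, he, hes, h⟩
        · rw [h]
        · have hdε : Disjoint ((a (N + n)).union (d (N + n))).dom ε.dom := by
            rw [dom_union, Set.disjoint_union_left]
            refine ⟨he, Set.disjoint_of_subset_right ?_ (hdisj (N + n + 1) (N + n)).symm⟩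
            rw [h, dom_union]; exact Set.subset_union_right
          have heq : (a (N + n + 1)).union (d (N + n)) =
              ((a (N + n)).union (d (N + n))).union ε := by
            rw [h, union_assoc, union_assoc]
            congr 1
            refine union_comm (Set.disjoint_of_subset_left ?_ (hdisj (N + n + 1) (N + n)))
            rw [h, dom_union]; exact Set.subset_union_right
          refine .single ⟨ε, hε, hdε, ?_, heq⟩
          rw [← heq]
          exact hun _ _ (by omega) (by omega)
      have h2 : AttachStar {D | 𝒯.Reached D} 𝒯.temp ((a (N + n + 1)).union (d (N + n)))
          ((a (N + n + 1)).union (d (N + n + 1))) := by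
        rcases hd.step (N + n) with h | ⟨ε, hε, he, hes, h⟩
        · rw [h]
        · have heq : (a (N + n + 1)).union (d (N + n + 1)) =
              ((a (N + n + 1)).union (d (N + n))).union ε := by
            rw [h, union_assoc]
          refine .single ⟨ε, hε, ?_, ?_, heq⟩
          · rw [dom_union, Set.disjoint_union_left]
            refine ⟨Set.disjoint_of_subset_right ?_ (hdisj (N + n + 1) (N + n + 1)), he⟩
            rw [h, dom_union]; exact Set.subset_union_right
          · rw [← heq]
            exact hun _ _ (by omega) (by omega)
      exact h1.trans h2
    · refine Set.Subset.antisymm ?_ (Set.iUnion_subset fun n => (hsub _ _).dom_subset)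
      rw [dom_union, ha.dom, hd.dom]
      refine Set.union_subset (Set.iUnion_subset fun i => ?_) (Set.iUnion_subset fun i => ?_)
      · refine Set.subset_iUnion_of_subset i ?_
        rw [dom_union]
        exact Set.subset_union_of_subset_left (ham _ _ (by omega)).dom_subset _
      · refine Set.subset_iUnion_of_subset i ?_
        rw [dom_union]
        exact Set.subset_union_of_subset_right (hdm _ _ (by omega)).dom_subset _
  refine producible_of_seq hseq ?_
  exact .combine (har N) (hdr N) ⟨_, _, rfl, rfl, hdisj _ _, hun _ _ le_rfl le_rfl, rfl⟩

end TAS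

end TwoHAM

namespace TwoHAM

/-! ### Weights and codes -/

/-- Put ⌈n/2⌉ in front of a family for ⌊n/2⌋. A number above ⌊n/2⌋ drops to at most ⌊n/2⌋ after
⌈n/2⌉ is subtracted. Halving makes the family logarithmic, and for `n ≥ 2` every weight stays below
`n`. -/
theorem exists_weights (n : ℕ) : ∃ (K : ℕ) (w : ℕ → ℕ), K ≤ Nat.log 2 n + 1 ∧
    (∀ j, w j ≤ (n + 1) / 2) ∧ ∀ s ≤ n, ∃ S ⊆ Finset.range K, ∑ j ∈ S, w j = s := by
  induction n using Nat.strong_induction_on with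
  | _ n ih =>
    rcases Nat.eq_zero_or_pos n with rfl | hn
    · exact ⟨0, fun _ => 0, by simp, by simp, fun s hs => ⟨∅, by simp, by simp; omega⟩⟩
    obtain ⟨K, w, hK, hw, hS⟩ := ih (n / 2) (by omega)
    -- The induction hypothesis at 0 only gives `K ≤ Nat.log 2 0 + 1 = 1`, one weight too many for
    -- the bound at 1.
    by_cases h1 : n = 1
    · subst h1
      refine ⟨1, fun _ => 1, by simp, by simp, fun s hs => ?_⟩
      interval_cases s
      · exact ⟨∅, by simp, by simp⟩
      · exact ⟨{0}, by simp, by simp⟩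
    refine ⟨K + 1, fun j => Nat.casesOn j ((n + 1) / 2) w, ?_, ?_, ?_⟩
    · rw [Nat.log_of_one_lt_of_le (by norm_num) (by omega)]; omega
    · rintro (_ | j)
      · exact le_rfl
      · exact (hw j).trans (by omega)
    · have key : ∀ s ≤ n / 2, ∃ S ⊆ Finset.range (K + 1), 0 ∉ S ∧
          ∑ j ∈ S, (Nat.casesOn j ((n + 1) / 2) w : ℕ) = s := by
        intro s hs
        obtain ⟨S, hS1, hS2⟩ := hS s hs
        refine ⟨S.map ⟨Nat.succ, Nat.succ_injective⟩, ?_, by simp, ?_⟩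
        · intro x hx
          simp only [Finset.mem_map, Function.Embedding.coeFn_mk] at hx
          obtain ⟨y, hy, rfl⟩ := hx
          have := Finset.mem_range.1 (hS1 hy)
          simp; omega
        · rw [Finset.sum_map]; exact hS2
      intro s hs
      by_cases hs' : s ≤ n / 2
      · obtain ⟨S, h1, -, h2⟩ := key s hs'
        exact ⟨S, h1, h2⟩
      · obtain ⟨S, h1, h0, h2⟩ := key (s - (n + 1) / 2) (by omega)
        refine ⟨insert 0 S, ?_, ?_⟩
        · exact Finset.insert_subset (by simp) h1
        · rw [Finset.sum_insert h0, h2]; simp; omega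

/-- A family of `K` glue strengths below `τ` in which every strength up to `τ` is a subset sum. -/
structure Weights (τ : ℕ) where
  two_le : 2 ≤ τ
  K : ℕ
  w : ℕ → ℕ
  S : ℕ → Finset ℕ
  K_le : K ≤ Nat.log 2 τ + 1
  w_lt : ∀ j, w j < τ
  S_sub : ∀ s, S s ⊆ Finset.range K
  S_sum : ∀ s ≤ τ, ∑ j ∈ S s, w j = s

theorem exists_Weights {τ : ℕ} (h : 2 ≤ τ) : Nonempty (Weights τ) := by
  obtain ⟨K, w, hK, hw, hS⟩ := exists_weights τ
  have : ∀ s, ∃ S ⊆ Finset.range K, s ≤ τ → ∑ j ∈ S, w j = s := by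
    intro s
    by_cases hs : s ≤ τ
    · obtain ⟨S, h1, h2⟩ := hS s hs
      exact ⟨S, h1, fun _ => h2⟩
    · exact ⟨∅, by simp, fun h => absurd h hs⟩
  choose S hS1 hS2 using this
  exact ⟨⟨h, K, w, S, hK, fun j => by have := hw j; omega, hS1, fun s hs => hS2 s hs⟩⟩

theorem Weights.S_nonempty {τ : ℕ} (W : Weights τ) : (W.S τ).Nonempty := by
  by_contra h
  have := W.S_sum τ le_rfl
  rw [Finset.not_nonempty_iff_eq_empty.1 h] at this
  have := W.two_le
  simp at *; omega

/-- Binary codes in which no code word is contained in another. -/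
theorem exists_code {α : Type*} [DecidableEq α] (s : Finset α) (n : ℕ) (hs : s.card ≤ 2 ^ n) :
    ∃ c : α → ℕ → Bool, ∀ a ∈ s, ∀ b ∈ s,
      (∀ i < 2 * n, c a i = true → c b i = true) → a = b := by
  classical
  let f : α → ℕ := fun a => if h : a ∈ s then (s.equivFin ⟨a, h⟩ : ℕ) else 0
  have hf : ∀ a ∈ s, f a < 2 ^ n := by
    intro a ha
    simp only [f, dif_pos ha]
    exact (Fin.is_lt _).trans_le hs
  have hinj : ∀ a ∈ s, ∀ b ∈ s, f a = f b → a = b := by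
    intro a ha b hb h
    simp only [f, dif_pos ha, dif_pos hb] at h
    simpa using s.equivFin.injective (Fin.ext h)
  -- The binary digits followed by their complements: containment in the first half is one
  -- inequality of digits, containment in the second half the reverse one.
  refine ⟨fun a i => if i < n then (f a).testBit i else !(f a).testBit (i - n), ?_⟩
  intro a ha b hb h
  refine hinj a ha b hb (Nat.eq_of_testBit_eq fun i => ?_)
  by_cases hi : i < n
  · have h1 := h i (by omega)
    have h2 := h (i + n) (by omega)
    simp only [if_pos hi] at h1
    simp only [if_neg (show ¬ i + n < n by omega), Nat.add_sub_cancel] at h2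
    cases ha : (f a).testBit i <;> cases hb : (f b).testBit i <;> simp_all
  · rw [Nat.testBit_lt_two_pow ((hf a ha).trans_le (Nat.pow_le_pow_right (by norm_num) (by omega))),
      Nat.testBit_lt_two_pow ((hf b hb).trans_le (Nat.pow_le_pow_right (by norm_num) (by omega)))]

/-! ### The universal tile set -/

/-- Labels of the glues between macrotiles and pads: orientation, half, comb, index. -/
abbrev Lbl : Type := Bool × Bool × ℕ × ℕ

def nullGlue : Glue := ⟨[], 0⟩

/-- Two such bonds reach τ, while one does not when `τ ≥ 2`. -/
def intGlue (τ : ℕ) : Glue := ⟨[], (τ + 1) / 2⟩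

/-- The length encodes the label injectively as long as the comb number is below 3, since then `4 *
c + 2 * o + h < 12`. The summand 1 keeps the string non-empty, hence different from the internal and
the null glue. -/
def labGlue {τ : ℕ} (W : Weights τ) (l : Lbl) : Glue :=
  ⟨List.replicate (12 * l.2.2.2 + 4 * l.2.2.1 + 2 * l.1.toNat + l.2.1.toNat + 1) true,
    W.w l.2.2.2⟩

/-- Lower teeth carry their label on the north side, upper teeth on the south side. -/
def sideDir : Bool → Dir
  | true => .south
  | false => .north

theorem sideDir_not (b : Bool) : sideDir (!b) = (sideDir b).opp := by cases b <;> rfl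

theorem sideDir_injective : Function.Injective sideDir := by
  intro a b; cases a <;> cases b <;> simp [sideDir]

def TileType.ofGlues (f : Dir → Glue) : TileType := ⟨f .north, f .east, f .south, f .west⟩

@[simp] theorem TileType.glue_ofGlues (f : Dir → Glue) (d : Dir) :
    (TileType.ofGlues f).glue d = f d := by cases d <;> rfl

section

variable {τ : ℕ} (W : Weights τ)

/-- The glues of a tile that is joined to its own piece on the sides selected by `b`, and that
may carry a label. -/
def sideGlue (b : Dir → Bool) (mk : Option (Bool × Lbl)) (d : Dir) : Glue :=
  if b d then intGlue τ else
    match mk with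
    | none => nullGlue
    | some (s, l) => if d = sideDir s then labGlue W l else nullGlue

def mkTile (b : Dir → Bool) (mk : Option (Bool × Lbl)) : TileType := .ofGlues (sideGlue W b mk)

def markSet : Finset (Option (Bool × Lbl)) :=
  Finset.insertNone (Finset.univ ×ˢ Finset.univ ×ˢ Finset.univ ×ˢ Finset.range 3 ×ˢ
    Finset.range W.K)

/-- All choices of internally glued sides and of at most one label. The set depends on τ alone and
contains the tiles of every piece of every simulated system. -/
def univTiles : Finset TileType :=
  ((Finset.univ : Finset (Bool × Bool × Bool × Bool)) ×ˢ markSet W).image fun x =>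
    mkTile W (fun | .north => x.1.1 | .east => x.1.2.1 | .south => x.1.2.2.1 | .west => x.1.2.2.2)
      x.2

theorem card_univTiles : (univTiles W).card ≤ 16 * (24 * W.K + 1) := by
  refine Finset.card_image_le.trans ?_
  rw [Finset.card_product, markSet, Finset.card_insertNone]
  simp only [Finset.card_product, Finset.card_range, Finset.card_univ, Fintype.card_prod,
    Fintype.card_bool]
  omega

theorem mkTile_mem (b : Dir → Bool) {mk : Option (Bool × Lbl)} (h : mk ∈ markSet W) :
    mkTile W b mk ∈ univTiles W := by
  refine Finset.mem_image.2 ⟨((b .north, b .east, b .south, b .west), mk), by simp [h], ?_⟩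
  congr 1
  funext d; cases d <;> rfl

theorem exists_of_mem_univTiles {t : TileType} (h : t ∈ univTiles W) :
    ∃ b, ∃ mk ∈ markSet W, t = mkTile W b mk := by
  obtain ⟨x, hx, rfl⟩ := Finset.mem_image.1 h
  exact ⟨_, x.2, (Finset.mem_product.1 hx).2, rfl⟩

theorem some_mem_markSet {s o h : Bool} {c j : ℕ} :
    some (s, o, h, c, j) ∈ markSet W ↔ c < 3 ∧ j < W.K := by
  simp [markSet]

@[simp] theorem mkTile_glue (b : Dir → Bool) (mk : Option (Bool × Lbl)) (d : Dir) :
    (mkTile W b mk).glue d = sideGlue W b mk d := by simp [mkTile]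

theorem labGlue_injective {o h o' h' : Bool} {c j c' j' : ℕ} (hc : c < 3) (hc' : c' < 3)
    (H : labGlue W (o, h, c, j) = labGlue W (o', h', c', j')) :
    o = o' ∧ h = h' ∧ c = c' ∧ j = j' := by
  have H' := congrArg (fun g : Glue => g.label.length) H
  simp only [labGlue, List.length_replicate] at H'
  cases o <;> cases o' <;> cases h <;> cases h' <;> simp at H' ⊢ <;> omega

theorem labGlue_ne_int (l : Lbl) : labGlue W l ≠ intGlue τ := by
  simp [labGlue, intGlue, List.replicate_succ]

theorem labGlue_ne_null (l : Lbl) : labGlue W l ≠ nullGlue := by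
  simp [labGlue, nullGlue, List.replicate_succ]

theorem intGlue_ne_null (W : Weights τ) : intGlue τ ≠ nullGlue := by
  have := W.two_le
  simp [intGlue, nullGlue]; omega

theorem sideGlue_cases (b : Dir → Bool) (mk : Option (Bool × Lbl)) (d : Dir) :
    (b d = true ∧ sideGlue W b mk d = intGlue τ) ∨
    (b d = false ∧ ∃ s l, mk = some (s, l) ∧ d = sideDir s ∧ sideGlue W b mk d = labGlue W l) ∨
    (b d = false ∧ sideGlue W b mk d = nullGlue) := by
  unfold sideGlue
  cases hb : b d
  · rcases mk with _ | ⟨s, l⟩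
    · simp
    · by_cases h : d = sideDir s
      · exact Or.inr (Or.inl ⟨rfl, s, l, rfl, h, by simp [h]⟩)
      · right; right; simp [h]
  · simp

theorem sideGlue_eq_int {b : Dir → Bool} {mk : Option (Bool × Lbl)} {d : Dir} :
    sideGlue W b mk d = intGlue τ ↔ b d = true := by
  rcases sideGlue_cases W b mk d with h | ⟨h, s, l, -, -, h'⟩ | h
  · simp [h]
  · simp [h, h', labGlue_ne_int]
  · simp [h, (intGlue_ne_null W).symm]

theorem sideGlue_eq_lab {b : Dir → Bool} {mk : Option (Bool × Lbl)} {d : Dir} {l : Lbl}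
    (h : sideGlue W b mk d = labGlue W l) :
    ∃ s l', mk = some (s, l') ∧ d = sideDir s ∧ labGlue W l' = labGlue W l := by
  rcases sideGlue_cases W b mk d with h' | ⟨-, s, l', h1, h2, h'⟩ | h'
  · rw [h'.2] at h; exact absurd h.symm (labGlue_ne_int W l)
  · exact ⟨s, l', h1, h2, by rw [← h', h]⟩
  · rw [h'.2] at h; exact absurd h.symm (labGlue_ne_null W l)

/-- No single bond between universal tiles is sufficient for an attachment. This is what makes free
single tiles harmless. -/
theorem strength_lt_of_mem {t : TileType} (h : t ∈ univTiles W) (d : Dir) :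
    (t.glue d).strength < τ := by
  obtain ⟨b, mk, -, rfl⟩ := exists_of_mem_univTiles W h
  have := W.two_le
  rw [mkTile_glue]
  rcases sideGlue_cases W b mk d with h' | ⟨-, s, l', h1, h2, h'⟩ | h'
  · rw [h'.2]; simp [intGlue]; omega
  · rw [h']; exact W.w_lt _
  · rw [h'.2]; simp [nullGlue]; omega

end

/-! ### Numerical bounds -/

theorem half_le_log_two : (0.69 : ℝ) ≤ Real.log 2 := by
  have := Real.log_two_gt_d9; linarith

theorem natLog_two_le (n : ℕ) : (Nat.log 2 n : ℝ) ≤ 1.5 * Real.log n := by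
  rcases Nat.eq_zero_or_pos n with rfl | hn
  · simp
  have h1 : ((2 : ℝ) ^ Nat.log 2 n) ≤ n := by exact_mod_cast Nat.pow_log_le_self 2 hn.ne'
  have h2 := Real.log_le_log (by positivity) h1
  rw [Real.log_pow] at h2
  have h3 := half_le_log_two
  have h4 : (0 : ℝ) ≤ Nat.log 2 n := by positivity
  nlinarith

theorem Weights.K_le_log {τ : ℕ} (W : Weights τ) : (W.K : ℝ) ≤ 3 * Real.log τ := by
  have h1 : (W.K : ℝ) ≤ Nat.log 2 τ + 1 := by exact_mod_cast W.K_le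
  have h2 := natLog_two_le τ
  have h3 : Real.log 2 ≤ Real.log τ :=
    Real.log_le_log (by norm_num) (by exact_mod_cast W.two_le)
  have := half_le_log_two
  linarith

theorem card_univTiles_le_log {τ : ℕ} (W : Weights τ) :
    ((univTiles W).card : ℝ) ≤ 1200 * Real.log τ := by
  have h1 : ((univTiles W).card : ℝ) ≤ 16 * (24 * W.K + 1) := by
    exact_mod_cast card_univTiles W
  have h2 := W.K_le_log
  have h3 : Real.log 2 ≤ Real.log τ :=
    Real.log_le_log (by norm_num) (by exact_mod_cast W.two_le)
  have := half_le_log_two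
  linarith

/-- The number of bits that suffices for the codes of the tiles and glues of `N` tile types. -/
def codeBits (N : ℕ) : ℕ := Nat.log 2 N + 3

/-- The factor 4 leaves room for one glue on each side of each of the `N` tile types. -/
theorem le_two_pow_codeBits (N : ℕ) : 4 * N ≤ 2 ^ codeBits N := by
  have := Nat.lt_pow_succ_log_self (b := 2) (by norm_num) N
  rw [codeBits, pow_add]
  rw [pow_succ] at this
  omega

/-- The side length of the arrays of bits. -/
def gridSize (N K : ℕ) : ℕ := Nat.sqrt (2 * codeBits N + K) + 1

/-- An array has to hold the `2 * codeBits N` digits of a code word as well as `K` labels. -/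
theorem le_gridSize_sq (N K : ℕ) : 2 * codeBits N + K ≤ gridSize N K * gridSize N K :=
  (Nat.lt_succ_sqrt _).le

theorem gridSize_le {τ : ℕ} (W : Weights τ) (N : ℕ) :
    ((16 * (gridSize N W.K + 1) : ℕ) : ℝ) ≤ 200 * √(Real.log N + Real.log τ) := by
  have hτ : Real.log 2 ≤ Real.log τ :=
    Real.log_le_log (by norm_num) (by exact_mod_cast W.two_le)
  have hN : 0 ≤ Real.log N := Real.log_natCast_nonneg N
  have h2 := half_le_log_two
  set L := Real.log N + Real.log τ with hL
  have hL0 : 0.69 ≤ L := by linarith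
  have h1 : ((Nat.sqrt (2 * codeBits N + W.K) : ℕ) : ℝ) ≤ √((2 * codeBits N + W.K : ℕ) : ℝ) :=
    Real.nat_sqrt_le_real_sqrt
  have h3 : ((2 * codeBits N + W.K : ℕ) : ℝ) ≤ 16 * L := by
    have := W.K_le_log
    have := natLog_two_le N
    simp only [codeBits]
    push_cast
    linarith
  have h4 : √((2 * codeBits N + W.K : ℕ) : ℝ) ≤ 4 * √L := by
    refine (Real.sqrt_le_sqrt h3).trans (le_of_eq ?_)
    rw [Real.sqrt_mul (by norm_num), show (16 : ℝ) = 4 ^ 2 by norm_num,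
      Real.sqrt_sq (by norm_num)]
  have h5 : 0.5 ≤ √L := Real.le_sqrt_of_sq_le (by nlinarith)
  simp only [gridSize]
  push_cast
  push_cast at h1 h4
  linarith

end TwoHAM

namespace TwoHAM
open Assembly

/-! ### Shapes made of `2 × 2` squares -/

/-- The cell (a `2 × 2` square) that contains a position. -/
def cell (z : ℤ × ℤ) : ℤ × ℤ := (z.1 / 2, z.2 / 2)

/-- Connectedness of a set of cells: functions that are invariant under steps are constant. -/
def Conn (S : Set (ℤ × ℤ)) : Prop :=
  ∀ f : ℤ × ℤ → Prop, (∀ x d, x ∈ S → x + Dir.vec d ∈ S → (f x ↔ f (x + d.vec))) →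
    ∀ x ∈ S, ∀ y ∈ S, (f x ↔ f y)

/-- Edges of a cut are directed out of `A`, so a crossing edge is reversed if necessary. Restricting
to east and north ensures that neither edge is the reverse of the other. -/
theorem cut_of_two {α : Assembly} {A : Set (ℤ × ℤ)} {τ : ℕ} {x y : ℤ × ℤ} {d e : Dir}
    (hd : d = .east ∨ d = .north) (he : e = .east ∨ e = .north) (hne : (x, d) ≠ (y, e))
    (hx : ¬ (x ∈ A ↔ x + d.vec ∈ A)) (hy : ¬ (y ∈ A ↔ y + e.vec ∈ A))
    (wx : τ ≤ 2 * α.bond x d) (wy : τ ≤ 2 * α.bond y e) : Cut τ α A := by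
  have key : ∀ (x : ℤ × ℤ) (d : Dir), ¬ (x ∈ A ↔ x + d.vec ∈ A) →
      ∃ e, (e = (x, d) ∨ e = revEdge (x, d)) ∧ (e.1 ∈ A ∧ e.1 + e.2.vec ∉ A) ∧
        α.bond e.1 e.2 = α.bond x d := by
    intro x d h
    by_cases hx : x ∈ A
    · exact ⟨(x, d), Or.inl rfl, ⟨hx, by tauto⟩, rfl⟩
    · refine ⟨revEdge (x, d), Or.inr rfl, ⟨by simp only [revEdge, Equiv.coe_fn_mk]; tauto, ?_⟩,
        (cross_comm α α x d).symm⟩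
      simpa [revEdge] using hx
  obtain ⟨e1, h1, h1', w1⟩ := key x d hx
  obtain ⟨e2, h2, h2', w2⟩ := key y e hy
  have h12 : e1 ≠ e2 := by
    rintro rfl
    rcases h1 with rfl | rfl <;> rcases h2 with h | h
    · exact hne h
    · rcases hd with rfl | rfl <;> rcases he with rfl | rfl <;> simp [revEdge, Dir.opp] at h
    · rcases hd with rfl | rfl <;> rcases he with rfl | rfl <;> simp [revEdge, Dir.opp] at h
    · exact hne (revEdge.injective h)
  refine ⟨{e1, e2}, ?_, ?_⟩
  · intro e he
    simp only [Finset.mem_insert, Finset.mem_singleton] at he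
    rcases he with rfl | rfl <;> assumption
  · rw [Finset.sum_pair h12, w1, w2]; omega

/-- The four edges form the cycle P, Q, S, R. A cut crosses an even number of edges of a cycle, so
if no two are crossed then none is. -/
theorem iff_of_two {P Q R S : Prop} (h12 : ¬ (P ↔ Q) → ¬ (P ↔ R) → False)
    (h13 : ¬ (P ↔ Q) → ¬ (R ↔ S) → False) (h14 : ¬ (P ↔ Q) → ¬ (Q ↔ S) → False)
    (h23 : ¬ (P ↔ R) → ¬ (R ↔ S) → False) (h24 : ¬ (P ↔ R) → ¬ (Q ↔ S) → False)
    (h34 : ¬ (R ↔ S) → ¬ (Q ↔ S) → False) : (Q ↔ P) ∧ (R ↔ P) ∧ (S ↔ P) := by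
  by_cases P <;> by_cases Q <;> by_cases R <;> by_cases S <;> simp_all

/-- Each crossed edge contributes at least τ/2, so two crossed edges suffice. A cut inside a 2 × 2
square crosses two edges of its 4-cycle, and a cut between adjacent squares crosses the two parallel
edges that join them. -/
theorem stable_of_cells {S : Set (ℤ × ℤ)} {α : Assembly} {τ : ℕ} (hS : Conn S)
    (hdom : ∀ z, z ∈ α.dom ↔ cell z ∈ S)
    (hb : ∀ z d, cell z ∈ S → cell (z + Dir.vec d) ∈ S → τ ≤ 2 * α.bond z d) : α.Stable τ := by
  intro A hA ⟨x, hx⟩ hne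
  obtain ⟨y, hy, hyA⟩ : ∃ y ∈ α.dom, y ∉ A := by
    by_contra! h; exact hne (Set.Subset.antisymm hA h)
  by_contra hcut
  change ¬ Cut τ α A at hcut
  have hc : ∀ a b : ℤ, ∀ i ∈ ({0, 1} : Set ℤ), ∀ j ∈ ({0, 1} : Set ℤ),
      cell (2 * a + i, 2 * b + j) = (a, b) := by
    intro a b i hi j hj
    simp only [Set.mem_insert_iff, Set.mem_singleton_iff] at hi hj
    simp only [cell, Prod.mk.injEq]
    omega
  have two : ∀ (x y : ℤ × ℤ) (d e : Dir), (d = .east ∨ d = .north) → (e = .east ∨ e = .north) →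
      (x, d) ≠ (y, e) → cell x ∈ S → cell (x + d.vec) ∈ S → cell y ∈ S → cell (y + e.vec) ∈ S →
      ¬ (x ∈ A ↔ x + d.vec ∈ A) → ¬ (y ∈ A ↔ y + e.vec ∈ A) → False :=
    fun x y d e hd he hne h1 h2 h3 h4 hx hy =>
      hcut (cut_of_two hd he hne hx hy (hb _ _ h1 h2) (hb _ _ h3 h4))
  have hsplit : ∀ a b : ℤ, (a, b) ∈ S → ∀ i ∈ ({0, 1} : Set ℤ), ∀ j ∈ ({0, 1} : Set ℤ),
      ((2 * a + i, 2 * b + j) ∈ A ↔ (2 * a, 2 * b) ∈ A) := by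
    intro a b hab
    have c00 := hc a b 0 (by simp) 0 (by simp)
    have c10 := hc a b 1 (by simp) 0 (by simp)
    have c01 := hc a b 0 (by simp) 1 (by simp)
    have c11 := hc a b 1 (by simp) 1 (by simp)
    simp only [add_zero] at c00 c10 c01
    have e1 : ((2 * a, 2 * b) : ℤ × ℤ) + Dir.vec .east = (2 * a + 1, 2 * b) := by simp [Dir.vec]
    have e2 : ((2 * a, 2 * b) : ℤ × ℤ) + Dir.vec .north = (2 * a, 2 * b + 1) := by simp [Dir.vec]
    have e3 : ((2 * a, 2 * b + 1) : ℤ × ℤ) + Dir.vec .east = (2 * a + 1, 2 * b + 1) := by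
      simp [Dir.vec]
    have e4 : ((2 * a + 1, 2 * b) : ℤ × ℤ) + Dir.vec .north = (2 * a + 1, 2 * b + 1) := by
      simp [Dir.vec]
    have t12 := two (2 * a, 2 * b) (2 * a, 2 * b) .east .north (by simp) (by simp) (by simp)
    have t13 := two (2 * a, 2 * b) (2 * a, 2 * b + 1) .east .east (by simp) (by simp) (by simp)
    have t14 := two (2 * a, 2 * b) (2 * a + 1, 2 * b) .east .north (by simp) (by simp) (by simp)
    have t23 := two (2 * a, 2 * b) (2 * a, 2 * b + 1) .north .east (by simp) (by simp) (by simp)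
    have t24 := two (2 * a, 2 * b) (2 * a + 1, 2 * b) .north .north (by simp) (by simp) (by simp)
    have t34 := two (2 * a, 2 * b + 1) (2 * a + 1, 2 * b) .east .north (by simp) (by simp)
      (by simp)
    rw [e1, e2] at t12
    rw [e1, e3] at t13
    rw [e1, e4] at t14
    rw [e2, e3] at t23
    rw [e2, e4] at t24
    rw [e3, e4] at t34
    rw [c00, c10, c01] at t12
    rw [c00, c10, c01, c11] at t13
    rw [c00, c10, c11] at t14
    rw [c00, c01, c11] at t23
    rw [c00, c01, c10, c11] at t24
    rw [c01, c11, c10] at t34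
    obtain ⟨h1, h2, h3⟩ := iff_of_two (t12 hab hab hab hab) (t13 hab hab hab hab)
      (t14 hab hab hab hab) (t23 hab hab hab hab) (t24 hab hab hab hab) (t34 hab hab hab hab)
    intro i hi j hj
    simp only [Set.mem_insert_iff, Set.mem_singleton_iff] at hi hj
    rcases hi with rfl | rfl <;> rcases hj with rfl | rfl
    · simp only [add_zero]
    · rw [add_zero]; exact h2
    · rw [add_zero]; exact h1
    · exact h3
  -- By `hsplit`, membership in `A` depends only on the cell, so `A` may be tested at the lower left
  -- corner of each cell.
  have hf := hS (fun s => (2 * s.1, 2 * s.2) ∈ A)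
  have hstep : ∀ (x : ℤ × ℤ) (d : Dir), (d = .east ∨ d = .north) → x ∈ S → x + d.vec ∈ S →
      ((2 * x.1, 2 * x.2) ∈ A ↔ (2 * (x + d.vec).1, 2 * (x + d.vec).2) ∈ A) := by
    rintro ⟨a, b⟩ d hd hx hxd
    by_contra hn
    rcases hd with rfl | rfl
    · have e0 : ((a, b) : ℤ × ℤ) + Dir.vec .east = (a + 1, b) := by simp [Dir.vec]
      rw [e0] at hxd hn
      have e1 : ((2 * a + 1, 2 * b + 0) : ℤ × ℤ) + Dir.vec .east = (2 * (a + 1) + 0, 2 * b + 0) := by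
        simp [Dir.vec]; ring
      have e2 : ((2 * a + 1, 2 * b + 1) : ℤ × ℤ) + Dir.vec .east = (2 * (a + 1) + 0, 2 * b + 1) := by
        simp [Dir.vec]; ring
      have t := two (2 * a + 1, 2 * b + 0) (2 * a + 1, 2 * b + 1) .east .east (by simp) (by simp)
        (by simp)
      rw [e1, e2, hc a b 1 (by simp) 0 (by simp), hc a b 1 (by simp) 1 (by simp),
        hc (a + 1) b 0 (by simp) 0 (by simp), hc (a + 1) b 0 (by simp) 1 (by simp),
        hsplit a b hx 1 (by simp) 0 (by simp), hsplit a b hx 1 (by simp) 1 (by simp),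
        hsplit (a + 1) b hxd 0 (by simp) 0 (by simp),
        hsplit (a + 1) b hxd 0 (by simp) 1 (by simp)] at t
      exact t hx hxd hx hxd hn hn
    · have e0 : ((a, b) : ℤ × ℤ) + Dir.vec .north = (a, b + 1) := by simp [Dir.vec]
      rw [e0] at hxd hn
      have e1 : ((2 * a + 0, 2 * b + 1) : ℤ × ℤ) + Dir.vec .north = (2 * a + 0, 2 * (b + 1) + 0) := by
        simp [Dir.vec]; ring
      have e2 : ((2 * a + 1, 2 * b + 1) : ℤ × ℤ) + Dir.vec .north = (2 * a + 1, 2 * (b + 1) + 0) := by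
        simp [Dir.vec]; ring
      have t := two (2 * a + 0, 2 * b + 1) (2 * a + 1, 2 * b + 1) .north .north (by simp) (by simp)
        (by simp)
      rw [e1, e2, hc a b 0 (by simp) 1 (by simp), hc a b 1 (by simp) 1 (by simp),
        hc a (b + 1) 0 (by simp) 0 (by simp), hc a (b + 1) 1 (by simp) 0 (by simp),
        hsplit a b hx 0 (by simp) 1 (by simp), hsplit a b hx 1 (by simp) 1 (by simp),
        hsplit a (b + 1) hxd 0 (by simp) 0 (by simp),
        hsplit a (b + 1) hxd 1 (by simp) 0 (by simp)] at t
      exact t hx hxd hx hxd hn hn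
  have hall := hf fun x d hx hxd => by
    cases d with
    | east => exact hstep x _ (by simp) hx hxd
    | north => exact hstep x _ (by simp) hx hxd
    | west =>
      have := hstep (x + Dir.vec .west) .east (by simp) hxd
        (by rw [add_assoc, show Dir.vec .west + Dir.vec .east = 0 from rfl, add_zero]; exact hx)
      rw [add_assoc, show Dir.vec .west + Dir.vec .east = 0 from rfl, add_zero] at this
      exact this.symm
    | south =>
      have := hstep (x + Dir.vec .south) .north (by simp) hxd
        (by rw [add_assoc, show Dir.vec .south + Dir.vec .north = 0 from rfl, add_zero]; exact hx)
      rw [add_assoc, show Dir.vec .south + Dir.vec .north = 0 from rfl, add_zero] at this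
      exact this.symm
  have hmem : ∀ z, z ∈ α.dom → (z ∈ A ↔ (2 * (cell z).1, 2 * (cell z).2) ∈ A) := by
    intro z hz
    have h := hsplit (z.1 / 2) (z.2 / 2) ((hdom z).1 hz) (z.1 % 2)
      (by have := Int.emod_two_eq z.1; simpa using this) (z.2 % 2)
      (by have := Int.emod_two_eq z.2; simpa using this)
    rw [Int.mul_ediv_add_emod, Int.mul_ediv_add_emod] at h
    exact h
  exact hyA ((hmem y hy).2 ((hall _ ((hdom x).1 (hA hx)) _ ((hdom y).1 hy)).1
    ((hmem x (hA hx)).1 hx)))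

end TwoHAM

namespace TwoHAM
open Assembly

/-! ### Coordinates inside the blocks -/

section Coordinates

variable (k : ℕ)

/-- Columns: block, group (eight to a block), index in the group. -/
def colPos (q : ℤ) (g e : ℕ) : ℤ := (k + 1) * (8 * q + g) + e

/-- Rows: block, half, index in the half, kind (of four). -/
def rowPos (q : ℤ) (h r κ : ℕ) : ℤ := 4 * ((k + 1) * (2 * q + h) + r) + κ

def colBlk (a : ℤ) : ℤ := a / (k + 1) / 8

def colGrp (a : ℤ) : ℕ := (a / (k + 1) % 8).toNat

def colIdx (a : ℤ) : ℕ := (a % (k + 1)).toNat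

def rowBlk (b : ℤ) : ℤ := b / 4 / (k + 1) / 2

def rowHalf (b : ℤ) : ℕ := (b / 4 / (k + 1) % 2).toNat

def rowIdx (b : ℤ) : ℕ := (b / 4 % (k + 1)).toNat

def rowKind (b : ℤ) : ℕ := (b % 4).toNat

variable {k}

theorem div_mod_eq {n X e : ℤ} (h0 : 0 ≤ e) (h1 : e < n) :
    (n * X + e) / n = X ∧ (n * X + e) % n = e := by
  have hn : n ≠ 0 := by omega
  constructor
  · rw [add_comm, Int.add_mul_ediv_left _ _ hn, Int.ediv_eq_zero_of_lt h0 h1, zero_add]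
  · rw [add_comm, Int.add_mul_emod_self_left, Int.emod_eq_of_lt h0 h1]

theorem parse_colPos (q : ℤ) {g e : ℕ} (hg : g < 8) (he : e ≤ k) :
    colBlk k (colPos k q g e) = q ∧ colGrp k (colPos k q g e) = g ∧
      colIdx k (colPos k q g e) = e := by
  obtain ⟨h1, h2⟩ := div_mod_eq (n := (k : ℤ) + 1) (X := 8 * q + g) (e := e) (by omega) (by omega)
  simp only [colBlk, colGrp, colIdx, colPos, h1, h2]
  omega

theorem parse_rowPos (q : ℤ) {h r κ : ℕ} (hh : h < 2) (hr : r ≤ k) (hκ : κ < 4) :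
    rowBlk k (rowPos k q h r κ) = q ∧ rowHalf k (rowPos k q h r κ) = h ∧
      rowIdx k (rowPos k q h r κ) = r ∧ rowKind (rowPos k q h r κ) = κ := by
  obtain ⟨h1, h2⟩ := div_mod_eq (n := (k : ℤ) + 1) (X := 2 * q + h) (e := r) (by omega) (by omega)
  obtain ⟨h3, h4⟩ := div_mod_eq (n := 4) (X := (k + 1) * (2 * q + h) + r) (e := κ) (by omega)
    (by omega)
  simp only [rowBlk, rowHalf, rowIdx, rowKind, rowPos, h1, h2, h3, h4]
  omega

theorem colPos_parse (a : ℤ) : colPos k (colBlk k a) (colGrp k a) (colIdx k a) = a := by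
  have h1 := Int.emod_nonneg a (b := (k : ℤ) + 1) (by omega)
  have h2 := Int.mul_ediv_add_emod a ((k : ℤ) + 1)
  have h3 : 8 * (a / (k + 1) / 8) + ((a / (k + 1) % 8).toNat : ℤ) = a / (k + 1) := by omega
  simp only [colPos, colBlk, colGrp, colIdx, h3]
  omega

theorem colGrp_lt (a : ℤ) : colGrp k a < 8 := by simp only [colGrp]; omega

theorem colIdx_le (a : ℤ) : colIdx k a ≤ k := by
  have h1 := Int.emod_nonneg a (b := (k : ℤ) + 1) (by omega)
  have h2 := Int.emod_lt_of_pos a (b := (k : ℤ) + 1) (by omega)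
  simp only [colIdx]; omega

theorem rowPos_parse (b : ℤ) :
    rowPos k (rowBlk k b) (rowHalf k b) (rowIdx k b) (rowKind b) = b := by
  have h1 := Int.emod_nonneg (b / 4) (b := (k : ℤ) + 1) (by omega)
  have h2 := Int.mul_ediv_add_emod (b / 4) ((k : ℤ) + 1)
  have h3 : 2 * (b / 4 / (k + 1) / 2) + ((b / 4 / (k + 1) % 2).toNat : ℤ) = b / 4 / (k + 1) := by
    omega
  simp only [rowPos, rowBlk, rowHalf, rowIdx, rowKind, h3]
  omega

theorem rowHalf_lt (b : ℤ) : rowHalf k b < 2 := by simp only [rowHalf]; omega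

theorem rowIdx_le (b : ℤ) : rowIdx k b ≤ k := by
  have h1 := Int.emod_nonneg (b / 4) (b := (k : ℤ) + 1) (by omega)
  have h2 := Int.emod_lt_of_pos (b / 4) (b := (k : ℤ) + 1) (by omega)
  simp only [rowIdx]; omega

theorem rowKind_lt (b : ℤ) : rowKind b < 4 := by simp only [rowKind]; omega

theorem exists_colPos (a : ℤ) : ∃ q g e, g < 8 ∧ e ≤ k ∧ a = colPos k q g e :=
  ⟨_, _, _, colGrp_lt a, colIdx_le a, (colPos_parse a).symm⟩

theorem exists_rowPos (b : ℤ) : ∃ q h r κ, h < 2 ∧ r ≤ k ∧ κ < 4 ∧ b = rowPos k q h r κ :=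
  ⟨_, _, _, _, rowHalf_lt b, rowIdx_le b, rowKind_lt b, (rowPos_parse b).symm⟩

theorem colBlk_eq_iff {a q : ℤ} :
    colBlk k a = q ↔ 8 * (k + 1) * q ≤ a ∧ a < 8 * (k + 1) * q + 8 * (k + 1) := by
  rw [colBlk, Int.ediv_ediv_of_nonneg (by omega), Int.ediv_eq_iff_of_pos (by omega)]
  constructor
  · rintro ⟨h1, h2⟩; constructor <;> nlinarith
  · rintro ⟨h1, h2⟩; constructor <;> nlinarith

theorem rowBlk_eq_iff {b q : ℤ} :
    rowBlk k b = q ↔ 8 * (k + 1) * q ≤ b ∧ b < 8 * (k + 1) * q + 8 * (k + 1) := by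
  rw [rowBlk, Int.ediv_ediv_of_nonneg (by omega), Int.ediv_ediv_of_nonneg (by omega),
    Int.ediv_eq_iff_of_pos (by omega)]
  constructor
  · rintro ⟨h1, h2⟩; constructor <;> nlinarith
  · rintro ⟨h1, h2⟩; constructor <;> nlinarith

end Coordinates

/-! ### The layout of the blocks -/

/-- Owners of cells, relative to a block: the macrotile of the block, the macrotile of the block
to the north (`false`) or east (`true`), and the pads at the two slots (in two halves), attached
to the macrotile of the block (`false`) or of the neighbouring block (`true`). -/
inductive Who where
  | body
  | far (o : Bool)
  | pad (o h s : Bool)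
deriving DecidableEq

/-- The role of a cell in its block. The cells of the combs carry the orientation and half of
the slot, the number of the comb, an index and the kind of the row. -/
inductive Loc where
  | free
  | solid (w : Who)
  | comb (o h : Bool) (c i κ : ℕ)
deriving DecidableEq

/-- The first four groups of columns serve the slots towards north, the last four those towards
east. In groups 0, 1, 2 of an orientation, column 0 is the spine of the participant with that
number, and the other `k` columns are the comb between this spine and the next. Group 3 is filled by
the neighbouring macrotile. Each half consists of `k + 1` strips of four rows. The lowest strip of
the block is a bus that joins the vertical parts of the macrotile; the lowest strip of the second
half separates the pads of the two halves.

In a strip of a comb, rows 0 and 3 are to be teeth of the first participant and row 2 a tooth of the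
second. A cell of row 1 goes to the first participant where its bit is 1 and to the second where its
bit is 0. Labels meet between rows 2 and 3. -/
def locOf (k g e h r κ : ℕ) : Loc :=
  if h = 0 ∧ r = 0 then .solid .body
  else if g % 4 = 3 then .solid (.far (decide (4 ≤ g)))
  else if e = 0 then
    if g % 4 = 0 then .solid .body
    else if r = 0 then .free
    else .solid (.pad (decide (4 ≤ g)) (decide (h = 1)) (decide (g % 4 = 2)))
  else if r = 0 then .free
  else .comb (decide (4 ≤ g)) (decide (h = 1)) (g % 4) ((r - 1) * k + (e - 1)) κ

def loc (k : ℕ) (z : ℤ × ℤ) : Loc :=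
  locOf k (colGrp k z.1) (colIdx k z.1) (rowHalf k z.2) (rowIdx k z.2) (rowKind z.2)

def blk (k : ℕ) (z : ℤ × ℤ) : ℤ × ℤ := (colBlk k z.1, rowBlk k z.2)

def combCell (k : ℕ) (q : ℤ × ℤ) (o h : Bool) (c i κ : ℕ) : ℤ × ℤ :=
  (colPos k q.1 (4 * o.toNat + c) (i % k + 1), rowPos k q.2 h.toNat (i / k + 1) κ)

theorem loc_pos {k : ℕ} (x y : ℤ) {g e h r κ : ℕ} (hg : g < 8) (he : e ≤ k) (hh : h < 2)
    (hr : r ≤ k) (hκ : κ < 4) : loc k (colPos k x g e, rowPos k y h r κ) = locOf k g e h r κ ∧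
      blk k (colPos k x g e, rowPos k y h r κ) = (x, y) := by
  obtain ⟨h1, h2, h3⟩ := parse_colPos (k := k) x hg he
  obtain ⟨h4, h5, h6, h7⟩ := parse_rowPos (k := k) y hh hr hκ
  simp only [loc, blk, h1, h2, h3, h4, h5, h6, h7, and_self]

theorem loc_combCell {k : ℕ} (q : ℤ × ℤ) (o h : Bool) {c i κ : ℕ} (hc : c < 3) (hi : i < k * k)
    (hκ : κ < 4) : loc k (combCell k q o h c i κ) = .comb o h c i κ ∧
      blk k (combCell k q o h c i κ) = q := by
  have hk : 0 < k := by
    rcases Nat.eq_zero_or_pos k with rfl | hk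
    · simp at hi
    · exact hk
  have h1 : i % k < k := Nat.mod_lt _ hk
  have h2 : i / k < k := Nat.div_lt_of_lt_mul hi
  have ho : o.toNat < 2 := by cases o <;> simp
  have hh : h.toNat < 2 := by cases h <;> simp
  obtain ⟨h3, h4⟩ := loc_pos q.1 q.2 (k := k) (g := 4 * o.toNat + c) (e := i % k + 1)
    (h := h.toNat) (r := i / k + 1) (by omega) (by omega) hh (by omega) hκ
  refine ⟨h3.trans ?_, h4⟩
  rw [locOf, if_neg (fun h => Nat.succ_ne_zero _ h.2), if_neg (by omega),
    if_neg (Nat.succ_ne_zero _), if_neg (Nat.succ_ne_zero _)]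
  have e1 : (4 * o.toNat + c) % 4 = c := by omega
  have e2 : decide (4 ≤ 4 * o.toNat + c) = o := by
    cases o
    · simp; omega
    · simp
  have e3 : decide (h.toNat = 1) = h := by cases h <;> simp
  have e4 : (i / k + 1 - 1) * k + (i % k + 1 - 1) = i := by
    rw [Nat.add_sub_cancel, Nat.add_sub_cancel, mul_comm]; exact Nat.div_add_mod i k
  rw [e1, e2, e3, e4]

theorem eq_combCell_of_loc {k : ℕ} {z : ℤ × ℤ} {o h : Bool} {c i κ : ℕ}
    (H : loc k z = .comb o h c i κ) :
    z = combCell k (blk k z) o h c i κ ∧ c < 3 ∧ i < k * k ∧ κ < 4 := by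
  unfold loc locOf at H
  split_ifs at H with h1 h2 h3 h4 h5 h6
  simp only [Loc.comb.injEq] at H
  obtain ⟨rfl, rfl, rfl, rfl, rfl⟩ := H
  have hg := colGrp_lt (k := k) z.1
  have he := colIdx_le (k := k) z.1
  have hh := rowHalf_lt (k := k) z.2
  have hr := rowIdx_le (k := k) z.2
  have hκ := rowKind_lt z.2
  have hk : 0 < k := by omega
  have e1 : ((rowIdx k z.2 - 1) * k + (colIdx k z.1 - 1)) % k = colIdx k z.1 - 1 := by
    rw [add_comm, Nat.add_mul_mod_self_right, Nat.mod_eq_of_lt (by omega)]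
  have e2 : ((rowIdx k z.2 - 1) * k + (colIdx k z.1 - 1)) / k = rowIdx k z.2 - 1 := by
    rw [add_comm, Nat.add_mul_div_right _ _ hk, Nat.div_eq_of_lt (by omega), zero_add]
  refine ⟨?_, by omega, ?_, hκ⟩
  · have e3 : 4 * (decide (4 ≤ colGrp k z.1)).toNat + colGrp k z.1 % 4 = colGrp k z.1 := by
      by_cases hg4 : 4 ≤ colGrp k z.1
      · simp [hg4]; omega
      · simp [hg4]; omega
    have e4 : (decide (rowHalf k z.2 = 1)).toNat = rowHalf k z.2 := by
      by_cases hg4 : rowHalf k z.2 = 1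
      · simp [hg4]
      · simp [hg4]; omega
    rw [combCell, e1, e2, e3, e4, Nat.sub_add_cancel (by omega), Nat.sub_add_cancel (by omega)]
    simp only [blk]
    rw [colPos_parse, rowPos_parse]
  · have : rowIdx k z.2 - 1 ≤ k - 1 := by omega
    calc (rowIdx k z.2 - 1) * k + (colIdx k z.1 - 1) < (rowIdx k z.2 - 1) * k + k := by omega
      _ ≤ (k - 1) * k + k := by gcongr
      _ = k * k := by
        obtain ⟨n, rfl⟩ : ∃ n, k = n + 1 := ⟨k - 1, by omega⟩
        simp; ring

theorem combCell_add {k : ℕ} (q v : ℤ × ℤ) (o h : Bool) (c i κ : ℕ) :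
    combCell k (q + v) o h c i κ =
      combCell k q o h c i κ + (8 * (k + 1) * v.1, 8 * (k + 1) * v.2) := by
  simp only [combCell, colPos, rowPos, Prod.fst_add, Prod.snd_add, Prod.mk_add_mk, Prod.mk.injEq]
  constructor <;> ring

theorem loc_add {k : ℕ} (z v : ℤ × ℤ) :
    loc k (z + (8 * (k + 1) * v.1, 8 * (k + 1) * v.2)) = loc k z ∧
      blk k (z + (8 * (k + 1) * v.1, 8 * (k + 1) * v.2)) = blk k z + v := by
  obtain ⟨a, b⟩ := z
  obtain ⟨x, g, e, hg, he, rfl⟩ := exists_colPos (k := k) a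
  obtain ⟨y, h, r, κ, hh, hr, hκ, rfl⟩ := exists_rowPos (k := k) b
  have : (colPos k x g e, rowPos k y h r κ) + (8 * ((k : ℤ) + 1) * v.1, 8 * ((k : ℤ) + 1) * v.2) =
      (colPos k (x + v.1) g e, rowPos k (y + v.2) h r κ) := by
    simp only [colPos, rowPos, Prod.mk_add_mk, Prod.mk.injEq]
    constructor <;> ring
  rw [this]
  obtain ⟨h1, h2⟩ := loc_pos (k := k) x y hg he hh hr hκ
  obtain ⟨h3, h4⟩ := loc_pos (k := k) (x + v.1) (y + v.2) hg he hh hr hκ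
  rw [h1, h2, h3, h4]
  exact ⟨rfl, rfl⟩

end TwoHAM

namespace TwoHAM
open Assembly

/-! ### Pieces: macrotiles and pads -/

/-- The orientations of slots: a slot lies between a block and its northern (`false`) or eastern
(`true`) neighbour. -/
def oDir : Bool → Dir
  | true => .east
  | false => .north

/-- The identity of a piece: a block together with nothing (for the macrotile of the block) or the
orientation, the half and the side of a pad. -/
abbrev Id : Type := (ℤ × ℤ) × Option (Bool × Bool × Bool)

def whoAt (q : ℤ × ℤ) : Who → Id
  | .body => (q, none)
  | .far o => (q + (oDir o).vec, none)
  | .pad o h s => (q, some (o, h, s))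

/-- The participants of a slot, from one macrotile over two pads to the other macrotile. -/
def part (o h : Bool) : ℕ → Who
  | 0 => .body
  | 1 => .pad o h false
  | 2 => .pad o h true
  | _ => .far o

theorem whoAt_add (q v : ℤ × ℤ) (w : Who) :
    whoAt (q + v) w = ((whoAt q w).1 + v, (whoAt q w).2) := by
  cases w <;> simp [whoAt, add_right_comm]

/-- The data of the construction for the tile set `T`: glue strengths, the size of the arrays, and
codes for tile types and for glues. -/
structure Design (T : Finset TileType) (τ : ℕ) where
  W : Weights τ
  k : ℕ
  K_le : W.K ≤ k * k
  k_pos : 0 < k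
  key : TileType → ℕ → Bool
  gc : Glue → ℕ → Bool
  key_anti : ∀ t ∈ T, ∀ t' ∈ T, (∀ i < k * k, key t i = true → key t' i = true) → t = t'
  gc_anti : ∀ t ∈ T, ∀ t' ∈ T, ∀ d d', (∀ i < k * k, gc (t.glue d) i = true →
    gc (t'.glue d') i = true) → t.glue d = t'.glue d'

theorem exists_Design (T : Finset TileType) {τ : ℕ} (W : Weights τ) :
    ∃ D : Design T τ, D.W = W ∧ D.k = gridSize T.card W.K := by
  classical
  let G : Finset Glue := T.image TileType.north ∪ T.image TileType.east ∪
    (T.image TileType.south ∪ T.image TileType.west)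
  have hG : ∀ t ∈ T, ∀ d, t.glue d ∈ G := by
    intro t ht d
    simp only [G, Finset.mem_union, Finset.mem_image]
    cases d
    · exact Or.inl (Or.inl ⟨t, ht, rfl⟩)
    · exact Or.inl (Or.inr ⟨t, ht, rfl⟩)
    · exact Or.inr (Or.inl ⟨t, ht, rfl⟩)
    · exact Or.inr (Or.inr ⟨t, ht, rfl⟩)
  have hGc : G.card ≤ 4 * T.card := by
    have h1 : (T.image TileType.north).card ≤ T.card := Finset.card_image_le
    have h2 : (T.image TileType.east).card ≤ T.card := Finset.card_image_le
    have h3 : (T.image TileType.south).card ≤ T.card := Finset.card_image_le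
    have h4 : (T.image TileType.west).card ≤ T.card := Finset.card_image_le
    have h5 := Finset.card_union_le (T.image TileType.north) (T.image TileType.east)
    have h6 := Finset.card_union_le (T.image TileType.south) (T.image TileType.west)
    have h7 := Finset.card_union_le (T.image TileType.north ∪ T.image TileType.east)
      (T.image TileType.south ∪ T.image TileType.west)
    simp only [G]
    omega
  have h2 := le_two_pow_codeBits T.card
  have h3 := le_gridSize_sq T.card W.K
  obtain ⟨key, hkey⟩ := exists_code T (codeBits T.card) (by omega)
  obtain ⟨gc, hgc⟩ := exists_code G (codeBits T.card) (by omega)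
  exact ⟨⟨W, gridSize T.card W.K, by omega, by simp [gridSize], key, gc,
    fun t ht t' ht' h => hkey t ht t' ht' fun i hi => h i (by omega),
    fun t ht t' ht' d d' h => hgc _ (hG t ht d) _ (hG t' ht' d') fun i hi => h i (by omega)⟩,
    rfl, rfl⟩

/-- The two parts into which a strength is divided. -/
def halfOf (h : Bool) (n : ℕ) : ℕ := if h then n / 2 else (n + 1) / 2

theorem halfOf_add (n : ℕ) : halfOf true n + halfOf false n = n := by
  simp [halfOf]; omega

/-- The glue that a tile at side `s` of a slot of orientation `o` has towards the slot. -/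
def slotDir (o s : Bool) : Dir := if s then oDir o else (oDir o).opp

namespace Design

variable {T : Finset TileType} {τ : ℕ} (D : Design T τ)

/-- The code word shown in comb `c` by the participant below (`true`) or above (`false`). -/
def face (o : Bool) (c : ℕ) (s : Bool) (t : TileType) : ℕ → Bool :=
  if c = 1 then D.gc (t.glue (slotDir o s)) else D.key t

/-- The strength of the bond in comb `c`. -/
def str (o h : Bool) (c : ℕ) (s : Bool) (t : TileType) : ℕ :=
  if c = 1 then halfOf h (min (t.glue (slotDir o s)).strength τ) else τ

def act (o h : Bool) (c : ℕ) (s : Bool) (t : TileType) : Finset ℕ := D.W.S (str (τ := τ) o h c s t)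

/-- Capping at τ is what allows arbitrarily strong glues of 𝒯 to be expressed by subset sums of the
weights. -/
theorem str_le (o h : Bool) (c : ℕ) (s : Bool) (t : TileType) : str (τ := τ) o h c s t ≤ τ := by
  unfold str halfOf; split_ifs <;> omega

include D in
-- Since `τ ≥ 2`, half of a strength capped at τ stays below τ even when rounded up. Hence one pad
-- alone is never held by the opposite pad.
theorem str_one_lt (o h : Bool) (s : Bool) (t : TileType) : str (τ := τ) o h 1 s t < τ := by
  have := D.W.two_le
  unfold str halfOf; split_ifs <;> omega

theorem act_sum (o h : Bool) (c : ℕ) (s : Bool) (t : TileType) :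
    ∑ j ∈ D.act o h c s t, D.W.w j = str (τ := τ) o h c s t :=
  D.W.S_sum _ (str_le ..)

theorem lt_of_mem_act {o h : Bool} {c : ℕ} {s : Bool} {t : TileType} {j : ℕ}
    (hj : j ∈ D.act o h c s t) : j < D.W.K := Finset.mem_range.1 (D.W.S_sub _ hj)

/-- Whether the piece `i` for the tile type `t` owns a cell of block `q` with a given role. -/
def ownsAt (i : Id) (t : TileType) (q : ℤ × ℤ) : Loc → Prop
  | .free => False
  | .solid w => i = whoAt q w
  | .comb o h c j κ =>
    if κ = 1 then
      (i = whoAt q (part o h c) ∧ D.face o c true t j = true) ∨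
      (i = whoAt q (part o h (c + 1)) ∧ D.face o c false t j = false)
    else if κ = 2 then i = whoAt q (part o h (c + 1))
    else i = whoAt q (part o h c)

def owns (i : Id) (t : TileType) (z : ℤ × ℤ) : Prop := D.ownsAt i t (blk D.k z) (loc D.k z)

/-! #### Connectedness -/

theorem locOf_spine {k : ℕ} (o h : Bool) {c r : ℕ} (κ : ℕ) (hc : c ≤ 3) (hr : 1 ≤ r) :
    locOf k (4 * o.toNat + c) 0 h.toNat r κ = .solid (part o h c) := by
  have hr0 : r ≠ 0 := by omega
  interval_cases c <;> cases o <;> cases h <;> simp [locOf, part, hr0]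

theorem locOf_comb {k : ℕ} (o h : Bool) {c r e : ℕ} (κ : ℕ) (hc : c < 3) (hr : 1 ≤ r)
    (he : 1 ≤ e) :
    locOf k (4 * o.toNat + c) e h.toNat r κ = .comb o h c ((r - 1) * k + (e - 1)) κ := by
  have hr0 : r ≠ 0 := by omega
  have he0 : e ≠ 0 := by omega
  interval_cases c <;> cases o <;> cases h <;> simp [locOf, hr0, he0]

theorem owns_pos {i : Id} {t : TileType} (x y : ℤ) {g e h r κ : ℕ} (hg : g < 8) (he : e ≤ D.k)
    (hh : h < 2) (hr : r ≤ D.k) (hκ : κ < 4) :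
    D.owns i t (colPos D.k x g e, rowPos D.k y h r κ) ↔
      D.ownsAt i t (x, y) (locOf D.k g e h r κ) := by
  obtain ⟨h1, h2⟩ := loc_pos (k := D.k) x y hg he hh hr hκ
  rw [owns, h1, h2]

theorem owns_spine {i : Id} {t : TileType} {q : ℤ × ℤ} {o h : Bool} {c r κ : ℕ} (hc : c ≤ 3)
    (hr : 1 ≤ r) (hrk : r ≤ D.k) (hκ : κ < 4) :
    D.owns i t (colPos D.k q.1 (4 * o.toNat + c) 0, rowPos D.k q.2 h.toNat r κ) ↔
      i = whoAt q (part o h c) := by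
  have ho : o.toNat < 2 := by cases o <;> simp
  have hh : h.toNat < 2 := by cases h <;> simp
  rw [owns_pos D q.1 q.2 (by omega) (Nat.zero_le _) hh hrk hκ, locOf_spine o h κ hc hr]
  rfl

theorem owns_comb {i : Id} {t : TileType} {q : ℤ × ℤ} {o h : Bool} {c r e κ : ℕ} (hc : c < 3)
    (hr : 1 ≤ r) (hrk : r ≤ D.k) (he : 1 ≤ e) (hek : e ≤ D.k) (hκ : κ < 4) :
    D.owns i t (colPos D.k q.1 (4 * o.toNat + c) e, rowPos D.k q.2 h.toNat r κ) ↔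
      D.ownsAt i t q (.comb o h c ((r - 1) * D.k + (e - 1)) κ) := by
  have ho : o.toNat < 2 := by cases o <;> simp
  have hh : h.toNat < 2 := by cases h <;> simp
  rw [owns_pos D q.1 q.2 (by omega) hek hh hrk hκ, locOf_comb o h κ hc hr he]

section Connected

variable {S : Set (ℤ × ℤ)} {f : ℤ × ℤ → Prop}

theorem hline (hf : ∀ x d, x ∈ S → x + Dir.vec d ∈ S → (f x ↔ f (x + d.vec))) {a b : ℤ} (N : ℕ)
    (h : ∀ n : ℕ, n ≤ N → (a + n, b) ∈ S) : f (a, b) ↔ f (a + N, b) := by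
  induction N with
  | zero => simp
  | succ N ih =>
    rw [ih fun n hn => h n (by omega)]
    have e : ((a + (N : ℤ), b) : ℤ × ℤ) + Dir.vec .east = (a + ((N + 1 : ℕ) : ℤ), b) := by
      simp [Dir.vec]; ring
    have := hf (a + (N : ℤ), b) .east (h N (by omega)) (by rw [e]; exact h _ le_rfl)
    rwa [e] at this

theorem vline (hf : ∀ x d, x ∈ S → x + Dir.vec d ∈ S → (f x ↔ f (x + d.vec))) {a b : ℤ} (N : ℕ)
    (h : ∀ n : ℕ, n ≤ N → (a, b + n) ∈ S) : f (a, b) ↔ f (a, b + N) := by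
  induction N with
  | zero => simp
  | succ N ih =>
    rw [ih fun n hn => h n (by omega)]
    have e : ((a, b + (N : ℤ)) : ℤ × ℤ) + Dir.vec .north = (a, b + ((N + 1 : ℕ) : ℤ)) := by
      simp [Dir.vec]; ring
    have := hf (a, b + (N : ℤ)) .north (h N (by omega)) (by rw [e]; exact h _ le_rfl)
    rwa [e] at this

theorem hseg (hf : ∀ x d, x ∈ S → x + Dir.vec d ∈ S → (f x ↔ f (x + d.vec))) {a a' b : ℤ}
    (haa : a ≤ a') (h : ∀ x, a ≤ x → x ≤ a' → (x, b) ∈ S) : f (a, b) ↔ f (a', b) := by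
  have := hline hf (a := a) (b := b) (a' - a).toNat fun n hn => h _ (by omega) (by omega)
  rwa [show a + ((a' - a).toNat : ℤ) = a' by omega] at this

theorem vseg (hf : ∀ x d, x ∈ S → x + Dir.vec d ∈ S → (f x ↔ f (x + d.vec))) {a b b' : ℤ}
    (hbb : b ≤ b') (h : ∀ y, b ≤ y → y ≤ b' → (a, y) ∈ S) : f (a, b) ↔ f (a, b') := by
  have := vline hf (a := a) (b := b) (b' - b).toNat fun n hn => h _ (by omega) (by omega)
  rwa [show b + ((b' - b).toNat : ℤ) = b' by omega] at this

end Connected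

/-- A tooth runs along its row to the spine of its owner, to the left in rows 0 and 3 and to the
right in row 2. A bit cell is first linked vertically to the tooth in row 0 or row 2 of the same
owner. -/
theorem comb_linked {i : Id} {t : TileType} {f : ℤ × ℤ → Prop}
    (hf : ∀ x d, x ∈ {z | D.owns i t z} → x + Dir.vec d ∈ {z | D.owns i t z} →
      (f x ↔ f (x + d.vec)))
    {z : ℤ × ℤ} {o h : Bool} {c j κ : ℕ} (hz : D.owns i t z)
    (hl : loc D.k z = .comb o h c j κ) :
    ∃ n r κ', n ≤ 3 ∧ 1 ≤ r ∧ r ≤ D.k ∧ κ' < 4 ∧ i = whoAt (blk D.k z) (part o h n) ∧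
      (f z ↔ f (colPos D.k (blk D.k z).1 (4 * o.toNat + n) 0,
        rowPos D.k (blk D.k z).2 h.toNat r κ')) := by
  obtain ⟨hzc, hc, hj, hκ⟩ := eq_combCell_of_loc hl
  have h1 : j % D.k < D.k := Nat.mod_lt _ D.k_pos
  have h2 : j / D.k < D.k := Nat.div_lt_of_lt_mul hj
  rw [owns, hl] at hz
  set q := blk D.k z
  set r := j / D.k + 1 with hr
  set e := j % D.k + 1 with he
  have hje : (r - 1) * D.k + (e - 1) = j := by
    rw [hr, he, Nat.add_sub_cancel, Nat.add_sub_cancel, mul_comm]; exact Nat.div_add_mod j D.k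
  have hzc' : z = (colPos D.k q.1 (4 * o.toNat + c) e, rowPos D.k q.2 h.toNat r κ) := hzc
  have hr1 : 1 ≤ r := Nat.le_add_left _ _
  have hrk : r ≤ D.k := by omega
  have hek : e ≤ D.k := by omega
  have low : ∀ κ, κ < 4 → κ ≠ 1 → κ ≠ 2 → i = whoAt q (part o h c) →
      (f (colPos D.k q.1 (4 * o.toNat + c) e, rowPos D.k q.2 h.toNat r κ) ↔
        f (colPos D.k q.1 (4 * o.toNat + c) 0, rowPos D.k q.2 h.toNat r κ)) := by
    intro κ hκ hn1 hn2 hi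
    have ec : ∀ n : ℕ, colPos D.k q.1 (4 * o.toNat + c) n =
        colPos D.k q.1 (4 * o.toNat + c) 0 + n := fun n => by simp [colPos]
    have := hline hf (a := colPos D.k q.1 (4 * o.toNat + c) 0)
      (b := rowPos D.k q.2 h.toNat r κ) e (fun n hn => by
        rw [← ec]
        rcases Nat.eq_zero_or_pos n with rfl | hn0
        · exact (owns_spine D (by omega) hr1 hrk hκ).2 hi
        · refine (owns_comb D hc hr1 hrk hn0 (by omega) hκ).2 ?_
          rw [ownsAt, if_neg hn1, if_neg hn2]; exact hi)
    rw [← ec] at this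
    exact this.symm
  have high : i = whoAt q (part o h (c + 1)) →
      (f (colPos D.k q.1 (4 * o.toNat + c) e, rowPos D.k q.2 h.toNat r 2) ↔
        f (colPos D.k q.1 (4 * o.toNat + (c + 1)) 0, rowPos D.k q.2 h.toNat r 2)) := by
    intro hi
    have ec : ∀ n : ℕ, e ≤ n → colPos D.k q.1 (4 * o.toNat + c) e + ((n - e : ℕ) : ℤ) =
        colPos D.k q.1 (4 * o.toNat + c) n := fun n hn => by simp [colPos]; omega
    have e0 : colPos D.k q.1 (4 * o.toNat + c) (D.k + 1) =
        colPos D.k q.1 (4 * o.toNat + (c + 1)) 0 := by simp [colPos]; ring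
    have := hline hf (a := colPos D.k q.1 (4 * o.toNat + c) e)
      (b := rowPos D.k q.2 h.toNat r 2) (D.k + 1 - e) (fun n hn => by
        have := ec (e + n) (by omega)
        rw [Nat.add_sub_cancel_left] at this
        rw [this]
        by_cases hn0 : e + n = D.k + 1
        · rw [hn0, e0]
          exact (owns_spine D (by omega) hr1 hrk (by norm_num)).2 hi
        · refine (owns_comb D hc hr1 hrk (by omega) (by omega) (by norm_num)).2 ?_
          rw [ownsAt, if_neg (by norm_num), if_pos rfl]; exact hi)
    rw [ec _ (by omega), e0] at this
    exact this
  have step : ∀ κ, κ < 3 →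
      D.owns i t (colPos D.k q.1 (4 * o.toNat + c) e, rowPos D.k q.2 h.toNat r κ) →
      D.owns i t (colPos D.k q.1 (4 * o.toNat + c) e, rowPos D.k q.2 h.toNat r (κ + 1)) →
      (f (colPos D.k q.1 (4 * o.toNat + c) e, rowPos D.k q.2 h.toNat r κ) ↔
        f (colPos D.k q.1 (4 * o.toNat + c) e, rowPos D.k q.2 h.toNat r (κ + 1))) := by
    intro κ hκ h1 h2
    have e0 : rowPos D.k q.2 h.toNat r κ + ((1 : ℕ) : ℤ) = rowPos D.k q.2 h.toNat r (κ + 1) := by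
      simp [rowPos]; ring
    have := vline hf (a := colPos D.k q.1 (4 * o.toNat + c) e)
      (b := rowPos D.k q.2 h.toNat r κ) 1 (fun n hn => by
        rcases Nat.le_one_iff_eq_zero_or_eq_one.1 hn with rfl | rfl
        · simpa using h1
        · rw [e0]; exact h2)
    rwa [e0] at this
  by_cases hκ1 : κ = 1
  · have hz1 : D.owns i t (colPos D.k q.1 (4 * o.toNat + c) e, rowPos D.k q.2 h.toNat r 1) := by
      rw [owns_comb D hc hr1 hrk (by omega) hek (by norm_num), hje, ← hκ1]; exact hz
    rw [ownsAt, if_pos hκ1] at hz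
    rcases hz with ⟨hi, -⟩ | ⟨hi, -⟩
    · refine ⟨c, r, 0, by omega, hr1, hrk, by norm_num, hi, ?_⟩
      rw [hzc', hκ1, ← low 0 (by norm_num) (by norm_num) (by norm_num) hi]
      refine (step 0 (by norm_num) ?_ hz1).symm
      rw [owns_comb D hc hr1 hrk (by omega) hek (by norm_num), ownsAt, if_neg (by norm_num),
        if_neg (by norm_num)]
      exact hi
    · refine ⟨c + 1, r, 2, by omega, hr1, hrk, by norm_num, hi, ?_⟩
      rw [hzc', hκ1, ← high hi]
      refine step 1 (by norm_num) hz1 ?_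
      rw [owns_comb D hc hr1 hrk (by omega) hek (by norm_num), ownsAt, if_neg (by norm_num),
        if_pos rfl]
      exact hi
  by_cases hκ2 : κ = 2
  · rw [ownsAt, if_neg hκ1, if_pos hκ2] at hz
    refine ⟨c + 1, r, 2, by omega, hr1, hrk, by norm_num, hz, ?_⟩
    rw [hzc', hκ2]
    exact high hz
  · rw [ownsAt, if_neg hκ1, if_neg hκ2] at hz
    refine ⟨c, r, κ, by omega, hr1, hrk, hκ, hz, ?_⟩
    rw [hzc']
    exact low κ hκ hκ1 hκ2 hz

/-- A pad is one vertical spine with teeth; every cell is linked to the lowest cell of the spine. -/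
theorem conn_pad (p : ℤ × ℤ) (o h s : Bool) (t : TileType) :
    Conn {z | D.owns (p, some (o, h, s)) t z} := by
  intro f hf
  let n : ℕ := if s then 2 else 1
  have hpart : part o h n = .pad o h s := by cases s <;> rfl
  have hn : n ≤ 3 := by simp only [n]; split_ifs <;> omega
  have hn3 : 4 * o.toNat + n < 8 := by simp only [n]; cases o <;> cases s <;> simp
  have hhh : h.toNat < 2 := by cases h <;> simp
  have key : ∀ r κ, 1 ≤ r → r ≤ D.k → κ < 4 →
      (f (colPos D.k p.1 (4 * o.toNat + n) 0, rowPos D.k p.2 h.toNat 1 0) ↔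
        f (colPos D.k p.1 (4 * o.toNat + n) 0, rowPos D.k p.2 h.toNat r κ)) := by
    intro r κ hr hrk hκ
    have e0 : ∀ r κ : ℕ, 1 ≤ r → rowPos D.k p.2 h.toNat r κ =
        rowPos D.k p.2 h.toNat 1 0 + ((4 * (r - 1) + κ : ℕ) : ℤ) := by
      intro r κ hr
      obtain ⟨r, rfl⟩ : ∃ n, r = n + 1 := ⟨r - 1, by omega⟩
      simp [rowPos]; ring
    have := vline hf (a := colPos D.k p.1 (4 * o.toNat + n) 0)
      (b := rowPos D.k p.2 h.toNat 1 0) (4 * (r - 1) + κ) (fun m hm => by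
        have h1 := e0 (m / 4 + 1) (m % 4) (by omega)
        rw [show 4 * (m / 4 + 1 - 1) + m % 4 = m by omega] at h1
        rw [← h1]
        refine (owns_spine D hn (by omega) (by omega) (by omega)).2 ?_
        rw [hpart]; rfl)
    rw [← e0 r κ hr] at this
    exact this
  have all : ∀ z, D.owns (p, some (o, h, s)) t z →
      (f (colPos D.k p.1 (4 * o.toNat + n) 0, rowPos D.k p.2 h.toNat 1 0) ↔ f z) := by
    intro z hz
    rcases hl : loc D.k z with _ | w | ⟨o', h', c, j, κ⟩
    · rw [owns, hl] at hz; exact hz.elim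
    · rw [owns, hl] at hz
      have hz' : (p, some (o, h, s)) = whoAt (blk D.k z) w := hz
      rcases w with _ | o' | ⟨o', h', s'⟩
      · simp [whoAt] at hz'
      · simp [whoAt] at hz'
      simp only [whoAt, Prod.mk.injEq, Option.some.injEq] at hz'
      obtain ⟨rfl, rfl, rfl, rfl⟩ := hz'
      have hg := colGrp_lt (k := D.k) z.1
      have hh := rowHalf_lt (k := D.k) z.2
      have hr := rowIdx_le (k := D.k) z.2
      have hκ := rowKind_lt z.2
      have e1 := colPos_parse (k := D.k) z.1
      have e2 := rowPos_parse (k := D.k) z.2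
      unfold loc locOf at hl
      split_ifs at hl with h1 h2 h3 h4 h5
      all_goals simp only [Loc.solid.injEq, Who.pad.injEq, reduceCtorEq] at hl
      have k1 : 4 * o.toNat + n = colGrp D.k z.1 := by
        rw [← hl.1]
        simp only [n, ← hl.2.2, decide_eq_true_eq]
        by_cases hg4 : 4 ≤ colGrp D.k z.1
        · simp only [hg4, decide_true, Bool.toNat_true]; split_ifs <;> omega
        · simp only [hg4, decide_false, Bool.toNat_false]; split_ifs <;> omega
      have k2 : h.toNat = rowHalf D.k z.2 := by
        rw [← hl.2.1]
        by_cases hg4 : rowHalf D.k z.2 = 1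
        · simp [hg4]
        · simp [hg4]; omega
      have := key (rowIdx D.k z.2) (rowKind z.2) (by omega) hr hκ
      rw [k1, k2] at this ⊢
      rw [this]
      simp only [blk]
      rw [← h3, e1, e2]
    · obtain ⟨m, r, κ', hm, hr1, hrk, hκ', hi, hfz⟩ := D.comb_linked hf hz hl
      have : m = n ∧ o' = o ∧ h' = h ∧ blk D.k z = p := by
        interval_cases m <;> cases s <;> simp [whoAt, part] at hi <;> simp [n, hi]
      obtain ⟨rfl, rfl, rfl, h4⟩ := this
      rw [hfz, h4]
      exact key r κ' hr1 hrk hκ'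
  intro x hx y hy
  exact (all x hx).symm.trans (all y hy)

/-- Every cell is linked to the lower left corner of the block. The bus reaches the spines in groups
0 and 4. The part in the block to the south ends directly below the bus, and the part in the block
to the west ends directly beside the spine in group 0. -/
theorem conn_body (p : ℤ × ℤ) (t : TileType) : Conn {z | D.owns (p, none) t z} := by
  intro f hf
  set M : ℤ := 8 * (D.k + 1) with hM
  have hM8 : 8 ≤ M := by omega
  have cb : ∀ {a q : ℤ}, colBlk D.k a = q ↔ M * q ≤ a ∧ a < M * q + M := colBlk_eq_iff
  have rb : ∀ {b q : ℤ}, rowBlk D.k b = q ↔ M * q ≤ b ∧ b < M * q + M := rowBlk_eq_iff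
  have bus_iff : ∀ b : ℤ, (rowHalf D.k b = 0 ∧ rowIdx D.k b = 0) ↔ b < M * rowBlk D.k b + 4 := by
    intro b
    obtain ⟨y, h, r, κ, hh, hr, hκ, rfl⟩ := exists_rowPos (k := D.k) b
    obtain ⟨h1, h2, h3, -⟩ := parse_rowPos (k := D.k) y hh hr hκ
    rw [h1, h2, h3]
    simp only [rowPos, hM]
    have h5 : (0 : ℤ) ≤ D.k := by omega
    interval_cases h
    · constructor
      · rintro ⟨-, rfl⟩
        push_cast
        nlinarith
      · intro H
        refine ⟨rfl, ?_⟩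
        by_contra hr0
        have : (1 : ℤ) ≤ r := by omega
        push_cast at H
        nlinarith
    · constructor
      · rintro ⟨h, -⟩; omega
      · intro H
        push_cast at H
        nlinarith
  have own_bus : ∀ a b : ℤ, colBlk D.k a = p.1 → rowBlk D.k b = p.2 → b < M * p.2 + 4 →
      D.owns (p, none) t (a, b) := by
    intro a b ha hb hb4
    have : loc D.k (a, b) = .solid .body := by
      rw [loc, locOf, if_pos ((bus_iff b).2 (by rw [hb]; exact hb4))]
    rw [owns, this]
    simp only [ownsAt, whoAt, blk, ha, hb]
  have own_col : ∀ (o : Bool) (b : ℤ), rowBlk D.k b = p.2 →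
      D.owns (p, none) t (colPos D.k p.1 (4 * o.toNat) 0, b) := by
    intro o b hb
    have ho : 4 * o.toNat < 8 := by cases o <;> simp
    obtain ⟨h1, h2, h3⟩ := parse_colPos (k := D.k) p.1 ho (Nat.zero_le _)
    have : loc D.k (colPos D.k p.1 (4 * o.toNat) 0, b) = .solid .body := by
      simp only [loc, h2, h3, locOf]
      split_ifs <;> first | rfl | omega
    rw [owns, this]
    simp only [ownsAt, whoAt, blk, h1, hb]
  have hcol0 : colPos D.k p.1 (4 * (false).toNat) 0 = M * p.1 := by simp [colPos, hM]; ring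
  have root_row : ∀ b, rowBlk D.k b = p.2 → (f (M * p.1, M * p.2) ↔ f (M * p.1, b)) := by
    intro b hb
    rw [← hcol0]
    rw [rb] at hb
    exact vseg hf hb.1 fun y h1 h2 => own_col false y (rb.2 ⟨h1, by omega⟩)
  have bus : ∀ a b : ℤ, colBlk D.k a = p.1 → rowBlk D.k b = p.2 → b < M * p.2 + 4 →
      (f (M * p.1, M * p.2) ↔ f (a, b)) := by
    intro a b ha hb hb4
    rw [root_row b hb]
    rw [cb] at ha
    exact hseg hf ha.1 fun x h1 h2 => own_bus x b (cb.2 ⟨h1, by omega⟩) hb hb4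
  have col : ∀ (o : Bool) (b : ℤ), rowBlk D.k b = p.2 →
      (f (M * p.1, M * p.2) ↔ f (colPos D.k p.1 (4 * o.toNat) 0, b)) := by
    intro o b hb
    have ho : 4 * o.toNat < 8 := by cases o <;> simp
    obtain ⟨h1, -⟩ := parse_colPos (k := D.k) p.1 ho (Nat.zero_le _)
    have hb' : rowBlk D.k (M * p.2) = p.2 := rb.2 ⟨le_rfl, by omega⟩
    rw [bus _ (M * p.2) h1 hb' (by omega)]
    rw [rb] at hb
    exact vseg hf hb.1 fun y h1 h2 => own_col o y (rb.2 ⟨h1, by omega⟩)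
  have far : ∀ (o : Bool) (z : ℤ × ℤ), loc D.k z = .solid (.far o) →
      p = blk D.k z + (oDir o).vec → (f (M * p.1, M * p.2) ↔ f z) := by
    rintro o ⟨a, b⟩ hl hp
    have hb4 : ¬ (b < M * rowBlk D.k b + 4) ∧ colGrp D.k a % 4 = 3 ∧
        decide (4 ≤ colGrp D.k a) = o := by
      rw [← bus_iff]
      unfold loc locOf at hl
      split_ifs at hl with h1 h2 h3 h4 h5
      all_goals simp only [Loc.solid.injEq, Who.far.injEq, reduceCtorEq] at hl
      exact ⟨h1, h2, hl⟩
    obtain ⟨hb4, hg3, hgo⟩ := hb4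
    have hb0 := rb.1 (rfl : rowBlk D.k b = rowBlk D.k b)
    have ha0 := cb.1 (rfl : colBlk D.k a = colBlk D.k a)
    cases o with
    | false =>
      have hpx : p.1 = colBlk D.k a := by rw [hp]; simp [blk, oDir, Dir.vec]
      have hpy : p.2 = rowBlk D.k b + 1 := by rw [hp]; simp [blk, oDir, Dir.vec]
      have hMp : M * p.2 = M * rowBlk D.k b + M := by rw [hpy]; ring
      have hb' : rowBlk D.k (M * p.2) = p.2 := rb.2 ⟨le_rfl, by omega⟩
      rw [bus a (M * p.2) hpx.symm hb' (by omega)]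
      refine (vseg hf (by omega) fun y h1 h2 => ?_).symm
      by_cases hy : y = M * p.2
      · rw [hy]; exact own_bus _ _ hpx.symm hb' (by omega)
      · have hyb : rowBlk D.k y = rowBlk D.k b := rb.2 ⟨by omega, by omega⟩
        have hly : loc D.k (a, y) = .solid (.far false) := by
          rw [loc, locOf, if_neg (by rw [bus_iff, hyb]; omega), if_pos hg3, hgo]
        change D.owns _ _ _
        rw [owns, hly]
        simp only [ownsAt, whoAt, blk, hyb]
        rw [hp]; rfl
    | true =>
      have hpx : p.1 = colBlk D.k a + 1 := by rw [hp]; simp [blk, oDir, Dir.vec]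
      have hpy : p.2 = rowBlk D.k b := by rw [hp]; simp [blk, oDir, Dir.vec]
      have hMp : M * p.1 = M * colBlk D.k a + M := by rw [hpx]; ring
      rw [root_row b hpy.symm]
      refine (hseg hf (by omega) fun x h1 h2 => ?_).symm
      by_cases hx : x = M * p.1
      · rw [hx, ← hcol0]; exact own_col false b hpy.symm
      · have hxb : colBlk D.k x = colBlk D.k a := cb.2 ⟨by omega, by omega⟩
        have hgx : colGrp D.k x = 7 := by
          have hga : colGrp D.k a = 7 := by
            have := colGrp_lt (k := D.k) a
            have := of_decide_eq_true hgo
            omega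
          have e1 := colPos_parse (k := D.k) a
          have e2 := colPos_parse (k := D.k) x
          have e3 := colIdx_le (k := D.k) x
          have e4 := colGrp_lt (k := D.k) x
          rw [hxb] at e2
          rw [hga] at e1
          by_contra hne
          have h6 : (colGrp D.k x : ℤ) ≤ 6 := by omega
          have h7 : ((D.k : ℤ) + 1) * (8 * colBlk D.k a + colGrp D.k x) ≤
              ((D.k : ℤ) + 1) * (8 * colBlk D.k a + 6) :=
            mul_le_mul_of_nonneg_left (by omega) (by omega)
          simp only [colPos] at e1 e2
          push_cast at e1
          have h8 : ((D.k : ℤ) + 1) * (8 * colBlk D.k a + 7) =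
            ((D.k : ℤ) + 1) * (8 * colBlk D.k a + 6) + (D.k + 1) := by ring
          omega
        have hlx : loc D.k (x, b) = .solid (.far true) := by
          rw [loc, locOf, if_neg (by rw [bus_iff]; exact hb4), if_pos (by rw [hgx]), hgx]; rfl
        change D.owns _ _ _
        rw [owns, hlx]
        simp only [ownsAt, whoAt, blk, hxb]
        rw [hp]; rfl
  have all : ∀ z, D.owns (p, none) t z → (f (M * p.1, M * p.2) ↔ f z) := by
    intro z hz
    have hh : ∀ h : Bool, h.toNat < 2 := by intro h; cases h <;> simp
    rcases hl : loc D.k z with _ | w | ⟨o', h', c, j, κ⟩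
    · rw [owns, hl] at hz; exact hz.elim
    · rw [owns, hl] at hz
      have hz' : (p, none) = whoAt (blk D.k z) w := hz
      rcases w with _ | o' | ⟨o', h', s'⟩
      · have hp : p = blk D.k z := by simpa [whoAt] using hz'
        have hpx : colBlk D.k z.1 = p.1 := by rw [hp]; rfl
        have hpy : rowBlk D.k z.2 = p.2 := by rw [hp]; rfl
        unfold loc locOf at hl
        split_ifs at hl with h1 h2 h3 h4 h5 <;> try simp at hl
        · rw [bus_iff, hpy] at h1
          exact bus z.1 z.2 hpx hpy h1
        · have e1 := colPos_parse (k := D.k) z.1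
          have hg := colGrp_lt (k := D.k) z.1
          rw [h3, hpx] at e1
          have : ∃ o : Bool, colGrp D.k z.1 = 4 * o.toNat := by
            by_cases h0 : colGrp D.k z.1 = 0
            · exact ⟨false, by simpa using h0⟩
            · exact ⟨true, by simp; omega⟩
          obtain ⟨o, ho⟩ := this
          have := col o z.2 hpy
          rw [← ho, e1] at this
          exact this
      · exact far o' z hl (by simpa [whoAt] using hz')
      · simp [whoAt] at hz'
    · obtain ⟨m, r, κ', hm, hr1, hrk, hκ', hi, hfz⟩ := D.comb_linked hf hz hl
      have ho : o'.toNat < 2 := by cases o' <;> simp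
      rw [hfz]
      interval_cases m
      · have hp : p = blk D.k z := by simpa [whoAt, part] using hi
        rw [← hp]
        exact col o' _ (parse_rowPos p.2 (hh h') hrk hκ').1
      · simp [whoAt, part] at hi
      · simp [whoAt, part] at hi
      · have hp : p = blk D.k z + (oDir o').vec := by simpa [whoAt, part] using hi
        obtain ⟨h1, h2⟩ := loc_pos (k := D.k) (blk D.k z).1 (blk D.k z).2
          (g := 4 * o'.toNat + 3) (e := 0) (by omega) (Nat.zero_le _) (hh h') hrk hκ'
        refine far o' _ (h1.trans (locOf_spine o' h' κ' le_rfl hr1)) ?_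
        rw [h2]; exact hp
  intro x hx y hy
  exact (all x hx).symm.trans (all y hy)

theorem conn_owns (i : Id) (t : TileType) : Conn {z | D.owns i t z} := by
  obtain ⟨p, _ | ⟨o, h, s⟩⟩ := i
  · exact D.conn_body p t
  · exact D.conn_pad p o h s t

end Design

end TwoHAM

namespace TwoHAM
open Assembly

namespace Design

variable {T : Finset TileType} {τ : ℕ} (D : Design T τ)

/-! ### The assemblies of the pieces -/

open Classical in
/-- The label that the tile of a piece at a given position carries, if any. -/
noncomputable def mark (t : TileType) (z : ℤ × ℤ) : Option (Bool × Lbl) :=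
  match loc D.k (cell z) with
  | .comb o h c j κ =>
    if z.1 % 2 = 0 ∧ z.2 % 2 = 0 ∧ κ = 3 ∧ j ∈ D.act o h c true t then some (true, o, h, c, j)
    else if z.1 % 2 = 0 ∧ z.2 % 2 = 1 ∧ κ = 2 ∧ j ∈ D.act o h c false t then
      some (false, o, h, c, j)
    else none
  | _ => none

open Classical in
/-- The assembly of the piece `i` for the tile type `t`. -/
noncomputable def piece (i : Id) (t : TileType) : Assembly := fun z =>
  if D.owns i t (cell z) then
    some (mkTile D.W (fun d => decide (D.owns i t (cell (z + d.vec)))) (D.mark t z))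
  else none

/-- The translation of tile positions that corresponds to a translation of blocks. -/
def scale (v : ℤ × ℤ) : ℤ × ℤ := (16 * (D.k + 1) * v.1, 16 * (D.k + 1) * v.2)

theorem scale_neg (u : ℤ × ℤ) : D.scale (-u) = -D.scale u := by
  simp [scale]

theorem cell_add_scale (z v : ℤ × ℤ) :
    cell (z + D.scale v) = cell z + (8 * (D.k + 1) * v.1, 8 * (D.k + 1) * v.2) := by
  simp only [cell, scale, Prod.fst_add, Prod.snd_add, Prod.mk_add_mk, Prod.mk.injEq]
  constructor
  · rw [show z.1 + 16 * ((D.k : ℤ) + 1) * v.1 = z.1 + 2 * (8 * (D.k + 1) * v.1) by ring]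
    omega
  · rw [show z.2 + 16 * ((D.k : ℤ) + 1) * v.2 = z.2 + 2 * (8 * (D.k + 1) * v.2) by ring]
    omega

theorem loc_cell_add (z v : ℤ × ℤ) : loc D.k (cell (z + D.scale v)) = loc D.k (cell z) := by
  rw [cell_add_scale]; exact (loc_add _ _).1

theorem blk_cell_add (z v : ℤ × ℤ) : blk D.k (cell (z + D.scale v)) = blk D.k (cell z) + v := by
  rw [cell_add_scale]; exact (loc_add _ _).2

theorem ownsAt_add (i : Id) (t : TileType) (q v : ℤ × ℤ) (l : Loc) :
    D.ownsAt (i.1 + v, i.2) t (q + v) l ↔ D.ownsAt i t q l := by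
  have key : ∀ w, (i.1 + v, i.2) = whoAt (q + v) w ↔ i = whoAt q w := by
    intro w
    rw [whoAt_add]
    constructor
    · intro h
      simp only [Prod.mk.injEq, add_left_inj] at h
      exact Prod.ext h.1 h.2
    · rintro rfl; rfl
  cases l <;> simp only [ownsAt, key]

theorem owns_cell_add (i : Id) (t : TileType) (z v : ℤ × ℤ) :
    D.owns (i.1 + v, i.2) t (cell (z + D.scale v)) ↔ D.owns i t (cell z) := by
  rw [owns, loc_cell_add, blk_cell_add, ownsAt_add, owns]

theorem mark_add (t : TileType) (z v : ℤ × ℤ) : D.mark t (z + D.scale v) = D.mark t z := by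
  have h1 : (z + D.scale v).1 % 2 = z.1 % 2 := by
    simp only [scale, Prod.fst_add]
    rw [show z.1 + 16 * ((D.k : ℤ) + 1) * v.1 = z.1 + 2 * (8 * (D.k + 1) * v.1) by ring]
    omega
  have h2 : (z + D.scale v).2 % 2 = z.2 % 2 := by
    simp only [scale, Prod.snd_add]
    rw [show z.2 + 16 * ((D.k : ℤ) + 1) * v.2 = z.2 + 2 * (8 * (D.k + 1) * v.2) by ring]
    omega
  simp only [mark, loc_cell_add, h1, h2]

theorem piece_add (i : Id) (t : TileType) (v : ℤ × ℤ) :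
    D.piece (i.1 + v, i.2) t = shift (D.scale v) (D.piece i t) := by
  funext z
  obtain ⟨y, rfl⟩ : ∃ y, z = y + D.scale v := ⟨z - D.scale v, by simp⟩
  have h1 : ∀ d : Dir, y + D.scale v + d.vec = (y + d.vec) + D.scale v := fun d => by abel
  classical
  unfold piece shift
  rw [add_sub_cancel_right, mark_add]
  beta_reduce
  have hb : (fun d : Dir => decide (D.owns (i.1 + v, i.2) t (cell (y + D.scale v + d.vec)))) =
      fun d : Dir => decide (D.owns i t (cell (y + d.vec))) :=
    funext fun d => by rw [h1]; exact decide_eq_decide.2 (D.owns_cell_add ..)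
  rw [hb]
  exact if_congr (D.owns_cell_add ..) rfl rfl

theorem mem_dom_piece {i : Id} {t : TileType} {z : ℤ × ℤ} :
    z ∈ (D.piece i t).dom ↔ D.owns i t (cell z) := by
  simp only [dom, piece, Set.mem_ofPred_eq]
  split_ifs with h <;> simp [h]

theorem eq_mkTile_of_piece {i : Id} {t s : TileType} {z : ℤ × ℤ} (h : D.piece i t z = some s) :
    ∃ b : Dir → Bool, (∀ d, b d = true ↔ z + d.vec ∈ (D.piece i t).dom) ∧
      s = mkTile D.W b (D.mark t z) := by
  classical
  unfold piece at h
  split_ifs at h with h1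
  simp only [Option.some.injEq] at h
  refine ⟨_, fun d => ?_, h.symm⟩
  simp only [decide_eq_true_eq]
  exact D.mem_dom_piece.symm

/-- Where two tiles of a piece meet, both carry the internal glue, so each such bond has strength at
least τ/2. -/
theorem piece_stable (i : Id) (t : TileType) : (D.piece i t).Stable τ := by
  refine stable_of_cells (D.conn_owns i t) (fun z => D.mem_dom_piece) fun z d h1 h2 => ?_
  obtain ⟨s, hs⟩ := mem_dom.1 (D.mem_dom_piece.2 h1)
  obtain ⟨s', hs'⟩ := mem_dom.1 (D.mem_dom_piece.2 h2)
  obtain ⟨b, hb, rfl⟩ := D.eq_mkTile_of_piece hs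
  obtain ⟨b', hb', rfl⟩ := D.eq_mkTile_of_piece hs'
  have e1 : sideGlue D.W b (D.mark t z) d = intGlue τ :=
    (sideGlue_eq_int D.W).2 ((hb d).2 (D.mem_dom_piece.2 h2))
  have e2 : sideGlue D.W b' (D.mark t (z + d.vec)) d.opp = intGlue τ :=
    (sideGlue_eq_int D.W).2 ((hb' d.opp).2 (by
      rw [Dir.vec_opp, add_neg_cancel_right]; exact D.mem_dom_piece.2 h1))
  rw [bond_eq_cross, cross_of hs hs', mkTile_glue, mkTile_glue, e1, e2, if_pos rfl]
  simp only [intGlue]; omega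

/-- The position of the tile that carries a given label, on the upper (`true`) or lower side of the
contact. -/
def labPos (q : ℤ × ℤ) (o h : Bool) (c j : ℕ) (sd : Bool) : ℤ × ℤ :=
  (2 * (combCell D.k q o h c j (if sd then 3 else 2)).1,
    2 * (combCell D.k q o h c j (if sd then 3 else 2)).2 + if sd then 0 else 1)

theorem labPos_add_vec (q : ℤ × ℤ) (o h : Bool) (c j : ℕ) (sd : Bool) :
    D.labPos q o h c j sd + (sideDir sd).vec = D.labPos q o h c j (!sd) := by
  cases sd
  · simp [labPos, combCell, sideDir, Dir.vec, rowPos]; ring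
  · simp [labPos, combCell, sideDir, Dir.vec, rowPos]; ring

theorem labPos_add (q v : ℤ × ℤ) (o h : Bool) (c j : ℕ) (sd : Bool) :
    D.labPos (q + v) o h c j sd = D.labPos q o h c j sd + D.scale v := by
  simp only [labPos, combCell_add, scale, Prod.fst_add, Prod.snd_add, Prod.mk_add_mk,
    Prod.mk.injEq]
  constructor <;> ring

theorem cell_labPos (q : ℤ × ℤ) (o h : Bool) (c j : ℕ) (sd : Bool) :
    cell (D.labPos q o h c j sd) = combCell D.k q o h c j (if sd then 3 else 2) := by
  cases sd
  · simp only [cell, labPos, Bool.false_eq_true, if_false]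
    refine Prod.ext ?_ ?_ <;> simp only <;> omega
  · simp only [cell, labPos, if_true]
    refine Prod.ext ?_ ?_ <;> simp only <;> omega

theorem lt_of_mem_act' {o h : Bool} {c : ℕ} {s : Bool} {t : TileType} {j : ℕ}
    (hj : j ∈ D.act o h c s t) : j < D.k * D.k := (D.lt_of_mem_act hj).trans_le D.K_le

theorem loc_labPos (q : ℤ × ℤ) (o h : Bool) {c j : ℕ} (sd : Bool) (hc : c < 3)
    (hj : j < D.k * D.k) : loc D.k (cell (D.labPos q o h c j sd)) =
      .comb o h c j (if sd then 3 else 2) ∧ blk D.k (cell (D.labPos q o h c j sd)) = q := by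
  rw [cell_labPos]
  exact loc_combCell q o h hc hj (by cases sd <;> simp)

theorem mark_labPos (q : ℤ × ℤ) {o h : Bool} {c j : ℕ} {sd : Bool} {t : TileType} (hc : c < 3)
    (hj : j ∈ D.act o h c sd t) :
    D.mark t (D.labPos q o h c j sd) = some (sd, o, h, c, j) := by
  have := (D.loc_labPos q o h sd hc (D.lt_of_mem_act' hj)).1
  unfold mark
  rw [this]
  cases sd
  · simp [labPos, hj]
  · simp [labPos, hj]

theorem of_mark {t : TileType} {z : ℤ × ℤ} {o h : Bool} {c j : ℕ} {sd : Bool}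
    (H : D.mark t z = some (sd, o, h, c, j)) :
    c < 3 ∧ j ∈ D.act o h c sd t ∧ loc D.k (cell z) = .comb o h c j (if sd then 3 else 2) ∧
      z = D.labPos (blk D.k (cell z)) o h c j sd := by
  unfold mark at H
  rcases hl : loc D.k (cell z) with _ | w | ⟨o', h', c', j', κ⟩
  · simp [hl] at H
  · simp [hl] at H
  have hz := eq_combCell_of_loc hl
  have key : ∀ b : ℤ, z.1 % 2 = 0 → z.2 % 2 = b →
      z = (2 * (cell z).1, 2 * (cell z).2 + b) := by
    intro b h1 h2
    refine Prod.ext ?_ ?_ <;> simp only [cell] <;> omega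
  rw [hl] at H
  simp only at H
  split_ifs at H with h1 h2
  · simp only [Option.some.injEq, Prod.mk.injEq] at H
    obtain ⟨rfl, rfl, rfl, rfl, rfl⟩ := H
    obtain ⟨h1, h2, rfl, h3⟩ := h1
    refine ⟨hz.2.1, h3, rfl, ?_⟩
    have := key 0 h1 h2
    rw [hz.1] at this
    exact this
  · simp only [Option.some.injEq, Prod.mk.injEq] at H
    obtain ⟨rfl, rfl, rfl, rfl, rfl⟩ := H
    obtain ⟨g1, g2, rfl, g3⟩ := h2
    refine ⟨hz.2.1, g3, rfl, ?_⟩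
    have := key 1 g1 g2
    rw [hz.1] at this
    exact this

theorem mark_mem (t : TileType) (z : ℤ × ℤ) : D.mark t z ∈ markSet D.W := by
  rcases h : D.mark t z with _ | ⟨sd, o, h', c, j⟩
  · simp [markSet]
  · obtain ⟨h1, h2, -⟩ := D.of_mark h
    exact (some_mem_markSet D.W).2 ⟨h1, D.lt_of_mem_act h2⟩

theorem piece_over (i : Id) (t : TileType) : (D.piece i t).Over (univTiles D.W) := by
  intro z s hs
  obtain ⟨b, hb, rfl⟩ := D.eq_mkTile_of_piece hs
  exact mkTile_mem _ _ (D.mark_mem _ _)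

/-- The participant at side `sd` of comb `c`. -/
def nbr (c : ℕ) (sd : Bool) : ℕ := if sd then c else c + 1

theorem owns_labPos {i : Id} {t : TileType} {q : ℤ × ℤ} {o h : Bool} {c j : ℕ} {sd : Bool}
    (hc : c < 3) (hj : j < D.k * D.k) :
    D.owns i t (cell (D.labPos q o h c j sd)) ↔ i = whoAt q (part o h (nbr c sd)) := by
  obtain ⟨h1, h2⟩ := D.loc_labPos q o h sd hc hj
  rw [owns, h1, h2]
  cases sd <;> simp [ownsAt, nbr]

/-- Internal glues are buried: they never face a position outside the piece, so another piece cannot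
bind to them. -/
theorem glue_int {i : Id} {t s : TileType} {z : ℤ × ℤ} {d : Dir} (hs : D.piece i t z = some s)
    (hg : s.glue d = intGlue τ) : z + d.vec ∈ (D.piece i t).dom := by
  obtain ⟨b, hb, rfl⟩ := D.eq_mkTile_of_piece hs
  rw [mkTile_glue, sideGlue_eq_int] at hg
  exact (hb d).1 hg

/-- A label names orientation, half, comb and index, hence its position up to the block, and the
side of the tile that shows it tells which of the two participants of the comb the piece is. -/
theorem glue_lab {i : Id} {t s : TileType} {z : ℤ × ℤ} {d : Dir} {o h : Bool} {c j : ℕ}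
    (hc : c < 3) (hs : D.piece i t z = some s) (hg : s.glue d = labGlue D.W (o, h, c, j)) :
    ∃ q sd, d = sideDir sd ∧ i = whoAt q (part o h (nbr c sd)) ∧ j ∈ D.act o h c sd t ∧
      z = D.labPos q o h c j sd := by
  have ho := D.mem_dom_piece.1 (mem_dom_of hs)
  obtain ⟨b, hb, rfl⟩ := D.eq_mkTile_of_piece hs
  rw [mkTile_glue] at hg
  obtain ⟨sd, ⟨o', h', c', j'⟩, h1, h2, h3⟩ := sideGlue_eq_lab D.W hg
  obtain ⟨h4, h5, h6, h7⟩ := D.of_mark h1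
  obtain ⟨rfl, rfl, rfl, rfl⟩ := labGlue_injective D.W h4 hc h3
  refine ⟨_, sd, h2, ?_, h5, h7⟩
  rw [h7, D.owns_labPos hc (D.lt_of_mem_act' h5)] at ho
  exact ho

theorem glue_cases {i : Id} {t s : TileType} {z : ℤ × ℤ} (d : Dir) (hs : D.piece i t z = some s) :
    s.glue d = intGlue τ ∨ (∃ o h c j, c < 3 ∧ s.glue d = labGlue D.W (o, h, c, j)) ∨
      (s.glue d).strength = 0 := by
  obtain ⟨b, hb, rfl⟩ := D.eq_mkTile_of_piece hs
  rw [mkTile_glue]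
  rcases sideGlue_cases D.W b (D.mark t z) d with h | ⟨-, sd, ⟨o, h, c, j⟩, h1, h2, h3⟩ | h
  · exact Or.inl h.2
  · exact Or.inr (Or.inl ⟨o, h, c, j, (D.of_mark h1).1, h3⟩)
  · rw [h.2]; exact Or.inr (Or.inr rfl)

theorem exists_labPos {i : Id} {t : TileType} {q : ℤ × ℤ} {o h : Bool} {c j : ℕ} {sd : Bool}
    (hc : c < 3) (hi : i = whoAt q (part o h (nbr c sd))) (hj : j ∈ D.act o h c sd t)
    (hn : D.labPos q o h c j (!sd) ∉ (D.piece i t).dom) :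
    ∃ s, D.piece i t (D.labPos q o h c j sd) = some s ∧
      s.glue (sideDir sd) = labGlue D.W (o, h, c, j) := by
  obtain ⟨s, hs⟩ := mem_dom.1 (D.mem_dom_piece.2
    ((D.owns_labPos (i := i) (t := t) hc (D.lt_of_mem_act' hj)).2 hi))
  refine ⟨s, hs, ?_⟩
  obtain ⟨b, hb, rfl⟩ := D.eq_mkTile_of_piece hs
  have : b (sideDir sd) = false := by
    rw [← Bool.not_eq_true, hb, labPos_add_vec]; exact hn
  rw [mkTile_glue]
  simp [sideGlue, this, D.mark_labPos q hc hj]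

/-- `i` lies directly below `j` in comb `c` of a slot. -/
structure Below (q : ℤ × ℤ) (o h : Bool) (c : ℕ) (i j : Id) : Prop where
  lt : c < 3
  left : i = whoAt q (part o h c)
  right : j = whoAt q (part o h (c + 1))

/-- Some cells of a piece do not depend on the tile type, for instance the upper tooth in the comb
to the right of its spine. So without overlaps an identity occurs with only one tile type. -/
theorem not_disjoint_self (i : Id) (t t' : TileType) :
    ¬ Disjoint (D.piece i t).dom (D.piece i t').dom := by
  have key : ∃ q o h n, n ≤ 2 ∧ i = whoAt q (part o h n) := by
    obtain ⟨p, _ | ⟨o, h, s⟩⟩ := i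
    · exact ⟨p, false, false, 0, by norm_num, rfl⟩
    · cases s
      · exact ⟨p, o, h, 1, by norm_num, rfl⟩
      · exact ⟨p, o, h, 2, by norm_num, rfl⟩
  obtain ⟨q, o, h, n, hn, hi⟩ := key
  have hk : 0 < D.k * D.k := Nat.mul_pos D.k_pos D.k_pos
  have := fun t => (D.owns_labPos (i := i) (t := t) (q := q) (o := o) (h := h) (c := n) (j := 0)
    (sd := true) (by omega) hk).2 hi
  intro hd
  exact Set.disjoint_left.1 hd (D.mem_dom_piece.2 (this t)) (D.mem_dom_piece.2 (this t'))

theorem piece_nonempty (i : Id) (t : TileType) : (D.piece i t).dom.Nonempty := by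
  by_contra h
  rw [Set.not_nonempty_iff_eq_empty] at h
  exact D.not_disjoint_self i t t (by rw [h]; simp)

/-- The lower participant fills the bit cell where its bit is 1, the upper one where its bit is 0.
Avoiding overlap forces the lower word to be contained in the upper one. -/
theorem face_of_disjoint {q : ℤ × ℤ} {o h : Bool} {c : ℕ} {i j : Id} {t t' : TileType}
    (H : Below q o h c i j) (hd : Disjoint (D.piece i t).dom (D.piece j t').dom) {n : ℕ}
    (hn : n < D.k * D.k) (h1 : D.face o c true t n = true) : D.face o c false t' n = true := by
  by_contra h2
  obtain ⟨h3, h4⟩ := loc_combCell q o h H.lt hn (κ := 1) (by norm_num)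
  set z := combCell D.k q o h c n 1
  have hz : cell (2 * z.1, 2 * z.2) = z := by
    refine Prod.ext ?_ ?_ <;> simp only [cell] <;> omega
  refine Set.disjoint_left.1 hd (show (2 * z.1, 2 * z.2) ∈ _ from ?_) ?_
  · rw [mem_dom_piece, hz, owns, h3, h4, ownsAt, if_pos rfl]
    exact Or.inl ⟨H.left, h1⟩
  · rw [mem_dom_piece, hz, owns, h3, h4, ownsAt, if_pos rfl]
    exact Or.inr ⟨H.right, by simpa using h2⟩

/-- Neighbouring disjoint pieces fit together: a macrotile and its pad belong to the same tile type,
and two pads belong to the same glue. -/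
theorem fit_of_disjoint {q : ℤ × ℤ} {o h : Bool} {c : ℕ} {i j : Id} {t t' : TileType}
    (H : Below q o h c i j) (ht : t ∈ T) (ht' : t' ∈ T)
    (hd : Disjoint (D.piece i t).dom (D.piece j t').dom) :
    (c ≠ 1 → t = t') ∧ (c = 1 → t.glue (slotDir o true) = t'.glue (slotDir o false)) := by
  have key := fun n hn => D.face_of_disjoint H hd (n := n) hn
  constructor
  · intro hc
    simp only [face, if_neg hc] at key
    exact D.key_anti t ht t' ht' key
  · intro hc
    simp only [face, if_pos hc] at key
    exact D.gc_anti t ht t' ht' _ _ key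

/-- The condition under which two pieces may be present together. -/
def Fits (i : Id) (t : TileType) (j : Id) (t' : TileType) : Prop :=
  ∀ q o h c, Below q o h c i j →
    (c ≠ 1 → t = t') ∧ (c = 1 → t.glue (slotDir o true) = t'.glue (slotDir o false))

/-- Every cell except the bit cells has an owner that does not depend on tile types. A bit cell is
contested only by the two participants of its comb, and equal words leave it to exactly one of them.
-/
theorem disjoint_of_fits {i j : Id} {t t' : TileType} (hij : i ≠ j) (h1 : Fits i t j t')
    (h2 : Fits j t' i t) : Disjoint (D.piece i t).dom (D.piece j t').dom := by
  have face_eq : ∀ {i j : Id} {t t' : TileType}, Fits i t j t' → ∀ {q o h c n}, c < 3 →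
      i = whoAt q (part o h c) → j = whoAt q (part o h (c + 1)) → D.face o c true t n = true →
      D.face o c false t' n = false → False := by
    intro i j t t' hF q o h c n hc hi hj h3 h4
    obtain ⟨h5, h6⟩ := hF q o h c ⟨hc, hi, hj⟩
    by_cases hc1 : c = 1
    · rw [face, if_pos hc1] at h3 h4
      rw [h6 hc1, h4] at h3
      exact Bool.noConfusion h3
    · rw [face, if_neg hc1] at h3 h4
      rw [h5 hc1, h4] at h3
      exact Bool.noConfusion h3
  rw [Set.disjoint_left]
  intro z hz hz'
  rw [mem_dom_piece, owns] at hz hz'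
  rcases hl : loc D.k (cell z) with _ | w | ⟨o, h, c, n, κ⟩
  · rw [hl] at hz; exact hz
  · rw [hl] at hz hz'
    have e1 : i = _ := hz
    have e2 : j = _ := hz'
    exact hij (e1.trans e2.symm)
  · have hc := (eq_combCell_of_loc hl).2.1
    rw [hl] at hz hz'
    simp only [ownsAt] at hz hz'
    split_ifs at hz hz' with h3 h4
    · rcases hz with ⟨e1, f1⟩ | ⟨e1, f1⟩ <;> rcases hz' with ⟨e2, f2⟩ | ⟨e2, f2⟩
      · exact hij (e1.trans e2.symm)
      · exact face_eq h1 hc e1 e2 f1 f2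
      · exact face_eq h2 hc e2 e1 f2 f1
      · exact hij (e1.trans e2.symm)
    · exact hij (hz.trans hz'.symm)
    · exact hij (hz.trans hz'.symm)

end Design

end TwoHAM

namespace TwoHAM
open Assembly

/-! ### Two summation inequalities for bond strengths -/

theorem sum_le_sum_of_injOn {ι κ : Type*} [DecidableEq κ] (F : Finset ι) (A : Finset κ)
    (val : ι → ℕ) (w : κ → ℕ) (g : ι → κ)
    (hg : ∀ e ∈ F, val e ≠ 0 → g e ∈ A ∧ val e = w (g e))
    (hinj : ∀ e ∈ F, ∀ e' ∈ F, val e ≠ 0 → val e' ≠ 0 → g e = g e' → e = e') :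
    ∑ e ∈ F, val e ≤ ∑ a ∈ A, w a := by
  classical
  calc ∑ e ∈ F, val e = ∑ e ∈ F.filter (fun e => val e ≠ 0), val e :=
        (Finset.sum_filter_ne_zero _).symm
    _ = ∑ e ∈ F.filter (fun e => val e ≠ 0), w (g e) :=
        Finset.sum_congr rfl fun e he => (hg e (Finset.mem_filter.1 he).1
          (Finset.mem_filter.1 he).2).2
    _ = ∑ a ∈ (F.filter (fun e => val e ≠ 0)).image g, w a := by
        rw [Finset.sum_image]
        intro e he e' he' h
        have he := Finset.mem_filter.1 he
        have he' := Finset.mem_filter.1 he'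
        exact hinj e he.1 e' he'.1 he.2 he'.2 h
    _ ≤ ∑ a ∈ A, w a := by
        refine Finset.sum_le_sum_of_subset fun a ha => ?_
        obtain ⟨e, he, rfl⟩ := Finset.mem_image.1 ha
        exact (hg e (Finset.mem_filter.1 he).1 (Finset.mem_filter.1 he).2).1

/-- Either one term already reaches τ, or no term is changed by the cap. -/
theorem le_sum_min {ι : Type*} (F : Finset ι) (s : ι → ℕ) {τ : ℕ} (h : τ ≤ ∑ e ∈ F, s e) :
    τ ≤ ∑ e ∈ F, min (s e) τ := by
  by_cases hb : ∃ e ∈ F, τ ≤ s e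
  · obtain ⟨e, he, hs⟩ := hb
    calc τ = min (s e) τ := by omega
      _ ≤ _ := Finset.single_le_sum (f := fun e => min (s e) τ) (fun _ _ => Nat.zero_le _) he
  · push Not at hb
    refine h.trans (le_of_eq (Finset.sum_congr rfl fun e he => ?_))
    have := hb e he; omega

theorem add_unit_cancel (p : ℤ × ℤ) : p + (0, 1) + (0, -1) = p ∧ p + (0, -1) + (0, 1) = p ∧
    p + (1, 0) + (-1, 0) = p ∧ p + (-1, 0) + (1, 0) = p := by
  refine ⟨?_, ?_, ?_, ?_⟩ <;> rw [add_assoc] <;> exact add_zero p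

/-! ### Configurations of pieces -/

/-- A set of pieces, each with a tile type. -/
abbrev Config : Type := Set (Id × TileType)

/-- The block of the macrotile to which a piece belongs. -/
def home : Id → ℤ × ℤ
  | (p, none) => p
  | (q, some (_, _, false)) => q
  | (q, some (o, _, true)) => q + (oDir o).vec

/-- The macrotile of a block. -/
def body (p : ℤ × ℤ) : Id := (p, none)

/-- The orientation of the slots on side `d` of a block, and whether the block is the southern or
western end of these slots. -/
def slotOf : Dir → Bool × Bool
  | .east => (true, true)
  | .west => (true, false)
  | .north => (false, true)
  | .south => (false, false)

theorem slotDir_slotOf (d : Dir) : slotDir (slotOf d).1 (slotOf d).2 = d := by cases d <;> rfl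

theorem slotOf_slotDir (o s : Bool) : slotOf (slotDir o s) = (o, s) := by
  cases o <;> cases s <;> rfl

theorem slotOf_opp (d : Dir) : slotOf d.opp = ((slotOf d).1, !(slotOf d).2) := by cases d <;> rfl

/-- The block that contains the slots on side `d` of block `p`. -/
def slotBlk (p : ℤ × ℤ) (d : Dir) : ℤ × ℤ := if (slotOf d).2 then p else p + d.vec

theorem slotBlk_opp (p : ℤ × ℤ) (d : Dir) : slotBlk (p + d.vec) d.opp = slotBlk p d := by
  cases d <;> simp [slotBlk, slotOf, Dir.opp, Dir.vec, add_unit_cancel]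

/-- The pad on side `d` of block `p`. -/
def padId (p : ℤ × ℤ) (d : Dir) (h : Bool) : Id :=
  (slotBlk p d, some ((slotOf d).1, h, !(slotOf d).2))

theorem home_padId (p : ℤ × ℤ) (d : Dir) (h : Bool) : home (padId p d h) = p := by
  cases d <;> simp [home, padId, slotBlk, slotOf, Dir.vec, oDir, add_unit_cancel]

theorem exists_padId (q : ℤ × ℤ) (o h s : Bool) :
    ∃ d, ((q, some (o, h, s)) : Id) = padId (home (q, some (o, h, s))) d h := by
  refine ⟨slotDir o (!s), ?_⟩
  cases s <;> cases o <;> simp [home, padId, slotBlk, slotOf, slotDir, Dir.vec, oDir, Dir.opp,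
    add_unit_cancel]

theorem padId_eq (p : ℤ × ℤ) (d : Dir) (h : Bool) :
    padId p d h = whoAt (slotBlk p d) (part (slotOf d).1 h (Design.nbr 1 (slotOf d).2)) := by
  cases d <;> rfl

theorem padId_injective {p p' : ℤ × ℤ} {d d' : Dir} {h h' : Bool}
    (H : padId p d h = padId p' d' h') : p = p' ∧ d = d' ∧ h = h' := by
  have h1 := congrArg home H
  rw [home_padId, home_padId] at h1
  subst h1
  simp only [padId, Prod.mk.injEq, Option.some.injEq] at H
  refine ⟨rfl, ?_, H.2.2.1⟩
  have h3 : slotOf d = slotOf d' := Prod.ext H.2.1 (by simpa using H.2.2.2)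
  rw [← slotDir_slotOf d, h3, slotDir_slotOf]

namespace Design

variable {T : Finset TileType} {τ : ℕ} (D : Design T τ)

theorem padId_part_one (q : ℤ × ℤ) (o h sd : Bool) :
    ∃ p, whoAt q (part o h (nbr 1 sd)) = padId p (slotDir o sd) h ∧
      slotBlk p (slotDir o sd) = q ∧ p + (slotDir o sd).vec =
        home (whoAt q (part o h (nbr 1 (!sd)))) := by
  refine ⟨home (whoAt q (part o h (nbr 1 sd))), ?_, ?_, ?_⟩ <;> cases o <;> cases sd <;>
    simp [padId, whoAt, part, nbr, home, slotBlk, slotDir, slotOf, oDir, Dir.vec, Dir.opp,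
      add_unit_cancel]

/-- The pieces of a configuration do not overlap. -/
def Disj (C : Config) : Prop :=
  ∀ x ∈ C, ∀ y ∈ C, x ≠ y → Disjoint (D.piece x.1 x.2).dom (D.piece y.1 y.2).dom

open Classical in
/-- The assembly of a configuration. -/
noncomputable def asm (C : Config) : Assembly := fun z =>
  if h : ∃ x ∈ C, z ∈ (D.piece x.1 x.2).dom then D.piece h.choose.1 h.choose.2 z else none

open Classical in
/-- The assembly that is represented by a configuration. -/
noncomputable def tileAsm (C : Config) : Assembly := fun p =>
  if h : ∃ t, (body p, t) ∈ C then some h.choose else none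

variable {D}

theorem asm_eq_some {C : Config} (hC : D.Disj C) {z : ℤ × ℤ} {s : TileType} :
    D.asm C z = some s ↔ ∃ x ∈ C, D.piece x.1 x.2 z = some s := by
  unfold asm
  constructor
  · intro h
    split_ifs at h with h1
    exact ⟨_, h1.choose_spec.1, h⟩
  · rintro ⟨x, hx, hs⟩
    have h1 : ∃ x ∈ C, z ∈ (D.piece x.1 x.2).dom := ⟨x, hx, mem_dom_of hs⟩
    rw [dif_pos h1]
    have : h1.choose = x := by
      by_contra hne
      exact Set.disjoint_left.1 (hC _ h1.choose_spec.1 _ hx hne) h1.choose_spec.2 (mem_dom_of hs)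
    rw [this]; exact hs

theorem mem_dom_asm {C : Config} {z : ℤ × ℤ} :
    z ∈ (D.asm C).dom ↔ ∃ x ∈ C, z ∈ (D.piece x.1 x.2).dom := by
  constructor
  · intro h
    by_contra hn
    exact h (by unfold asm; rw [dif_neg hn])
  · intro h
    have := h.choose_spec.2
    simp only [dom, Set.mem_ofPred_eq] at this ⊢
    unfold asm
    rw [dif_pos h]
    exact this

theorem piece_sub_asm {C : Config} (hC : D.Disj C) {x : Id × TileType} (hx : x ∈ C) :
    (D.piece x.1 x.2).Sub (D.asm C) := fun _ _ h => (asm_eq_some hC).2 ⟨x, hx, h⟩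

theorem Disj.mono {C C' : Config} (h : D.Disj C') (hs : C ⊆ C') : D.Disj C :=
  fun x hx y hy => h x (hs hx) y (hs hy)

theorem asm_mono {C C' : Config} (h : D.Disj C') (hs : C ⊆ C') : (D.asm C).Sub (D.asm C') := by
  intro z s hz
  obtain ⟨x, hx, hxs⟩ := (asm_eq_some (h.mono hs)).1 hz
  exact (asm_eq_some h).2 ⟨x, hs hx, hxs⟩

theorem Disj.eq_of_id {C : Config} (hC : D.Disj C) {i : Id} {t t' : TileType} (h : (i, t) ∈ C)
    (h' : (i, t') ∈ C) : t = t' := by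
  by_contra hne
  exact D.not_disjoint_self i t t' (hC _ h _ h' fun he => hne (by simpa using he))

theorem tileAsm_eq_some {C : Config} (hC : D.Disj C) {p : ℤ × ℤ} {t : TileType} :
    tileAsm C p = some t ↔ (body p, t) ∈ C := by
  unfold tileAsm
  constructor
  · intro h
    split_ifs at h with h1
    have := h1.choose_spec
    simp only [Option.some.injEq] at h
    rwa [h] at this
  · intro h
    have h1 : ∃ t, (body p, t) ∈ C := ⟨t, h⟩
    rw [dif_pos h1, hC.eq_of_id h1.choose_spec h]

theorem tileAsm_ext {C : Config} (hC : D.Disj C) {α : Assembly}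
    (h : ∀ p t, (body p, t) ∈ C ↔ α p = some t) : tileAsm C = α := by
  funext p
  refine Option.ext fun t => ?_
  rw [tileAsm_eq_some hC, h]

theorem asm_ext {C : Config} (hC : D.Disj C) {α : Assembly}
    (h : ∀ z s, (∃ x ∈ C, D.piece x.1 x.2 z = some s) ↔ α z = some s) : D.asm C = α := by
  funext z
  refine Option.ext fun s => ?_
  rw [asm_eq_some hC, h]

theorem asm_singleton (x : Id × TileType) : D.asm {x} = D.piece x.1 x.2 :=
  asm_ext (fun _ hy _ hz hne => absurd ((Set.mem_singleton_iff.1 hy).trans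
    (Set.mem_singleton_iff.1 hz).symm) hne) (by simp)

theorem disj_singleton (x : Id × TileType) : D.Disj {x} := fun _ hy _ hz hne =>
  absurd ((Set.mem_singleton_iff.1 hy).trans (Set.mem_singleton_iff.1 hz).symm) hne

theorem Disj.union {C C' : Config} (h : D.Disj C) (h' : D.Disj C')
    (hd : Disjoint (D.asm C).dom (D.asm C').dom) : D.Disj (C ∪ C') := by
  have key : ∀ x ∈ C, ∀ y ∈ C', Disjoint (D.piece x.1 x.2).dom (D.piece y.1 y.2).dom := by
    intro x hx y hy
    rw [Set.disjoint_left] at hd ⊢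
    exact fun z hz hz' => hd (mem_dom_asm.2 ⟨x, hx, hz⟩) (mem_dom_asm.2 ⟨y, hy, hz'⟩)
  rintro x (hx | hx) y (hy | hy) hne
  · exact h x hx y hy hne
  · exact key x hx y hy
  · exact (key y hy x hx).symm
  · exact h' x hx y hy hne

theorem asm_union {C C' : Config} (h : D.Disj (C ∪ C')) :
    D.asm (C ∪ C') = (D.asm C).union (D.asm C') := by
  funext z
  by_cases hz : z ∈ (D.asm C).dom
  · obtain ⟨s, hs⟩ := mem_dom.1 hz
    rw [sub_union_left _ _ _ _ hs, asm_mono h Set.subset_union_left _ _ hs]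
  · rw [union_apply_of_not_mem hz]
    refine Option.ext fun s => ?_
    rw [asm_eq_some h, asm_eq_some (h.mono Set.subset_union_right)]
    constructor
    · rintro ⟨x, hx | hx, hs⟩
      · exact absurd (mem_dom_asm.2 ⟨x, hx, mem_dom_of hs⟩) hz
      · exact ⟨x, hx, hs⟩
    · rintro ⟨x, hx, hs⟩
      exact ⟨x, Or.inr hx, hs⟩

theorem tileAsm_union {C C' : Config} (h : D.Disj (C ∪ C')) :
    tileAsm (C ∪ C') = (tileAsm C).union (tileAsm C') := by
  have h1 := h.mono (Set.subset_union_left (s := C) (t := C'))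
  have h2 := h.mono (Set.subset_union_right (s := C) (t := C'))
  refine tileAsm_ext h fun p t => ?_
  by_cases hp : p ∈ (tileAsm C).dom
  · obtain ⟨s, hs⟩ := mem_dom.1 hp
    rw [sub_union_left _ _ _ _ hs]
    have hs' := (tileAsm_eq_some h1).1 hs
    constructor
    · intro ht; rw [h.eq_of_id (Or.inl hs') ht]
    · intro ht; cases ht; exact Or.inl hs'
  · rw [union_apply_of_not_mem hp, tileAsm_eq_some h2]
    constructor
    · rintro (ht | ht)
      · exact absurd (mem_dom_of ((tileAsm_eq_some h1).2 ht)) hp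
      · exact ht
    · exact Or.inr

theorem tileAsm_disjoint {C C' : Config} (h : D.Disj C) (h' : D.Disj C')
    (hd : Disjoint (D.asm C).dom (D.asm C').dom) :
    Disjoint (tileAsm C).dom (tileAsm C').dom := by
  rw [Set.disjoint_left]
  intro p hp hp'
  obtain ⟨t, ht⟩ := mem_dom.1 hp
  obtain ⟨t', ht'⟩ := mem_dom.1 hp'
  rw [tileAsm_eq_some h] at ht
  rw [tileAsm_eq_some h'] at ht'
  refine D.not_disjoint_self (body p) t t' ?_
  rw [Set.disjoint_left] at hd ⊢
  exact fun z hz hz' => hd (mem_dom_asm.2 ⟨_, ht, hz⟩) (mem_dom_asm.2 ⟨_, ht', hz'⟩)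

/-- Translation of a configuration by a number of blocks. -/
def move (v : ℤ × ℤ) (C : Config) : Config := {x | ((x.1.1 - v, x.1.2), x.2) ∈ C}

theorem piece_move (x : Id × TileType) (v : ℤ × ℤ) :
    D.piece x.1 x.2 = shift (D.scale v) (D.piece (x.1.1 - v, x.1.2) x.2) := by
  rw [← piece_add]; simp

theorem Disj.move {C : Config} (h : D.Disj C) (v : ℤ × ℤ) : D.Disj (move v C) := by
  intro x hx y hy hne
  rw [D.piece_move x v, D.piece_move y v]
  refine disjoint_shift (h _ hx _ hy fun he => hne ?_)
  simp only [Prod.mk.injEq, sub_left_inj] at he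
  exact Prod.ext (Prod.ext he.1.1 he.1.2) he.2

theorem asm_move {C : Config} (h : D.Disj C) (v : ℤ × ℤ) :
    D.asm (move v C) = shift (D.scale v) (D.asm C) := by
  refine asm_ext (h.move v) fun z s => ?_
  change _ ↔ D.asm C (z - D.scale v) = some s
  rw [asm_eq_some h]
  constructor
  · rintro ⟨x, hx, hs⟩
    exact ⟨_, hx, by rw [D.piece_move x v] at hs; exact hs⟩
  · rintro ⟨x, hx, hs⟩
    refine ⟨((x.1.1 + v, x.1.2), x.2), ?_, ?_⟩
    · change ((x.1.1 + v - v, x.1.2), x.2) ∈ C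
      rw [add_sub_cancel_right]; exact hx
    · simp only
      rw [piece_add]; exact hs

theorem tileAsm_move {C : Config} (h : D.Disj C) (v : ℤ × ℤ) :
    tileAsm (move v C) = shift v (tileAsm C) := by
  refine tileAsm_ext (h.move v) fun p t => ?_
  change _ ↔ tileAsm C (p - v) = some t
  rw [tileAsm_eq_some h]; rfl

/-! ### Bonds between configurations -/

theorem labPos_injective {q q' : ℤ × ℤ} {o h : Bool} {c j : ℕ} {sd : Bool} {u v : ℤ × ℤ}
    (H : D.labPos q o h c j sd + u = D.labPos q' o h c j sd + v) :
    v = u + D.scale (q - q') := by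
  have h1 := D.labPos_add q' (q - q') o h c j sd
  rw [add_sub_cancel] at h1
  rw [h1] at H
  have := add_left_cancel (a := D.labPos q' o h c j sd) (b := D.scale (q - q') + u) (c := v)
    (by rw [← H]; abel)
  rw [← this, add_comm]

/-- A bond between two configurations that do not overlap comes from a label. -/
theorem exists_of_cross {C C' : Config} (hC : D.Disj C) (hC' : D.Disj C') {u v : ℤ × ℤ}
    (hd : Disjoint (shift u (D.asm C)).dom (shift v (D.asm C')).dom) {z : ℤ × ℤ} {d : Dir}
    (hz : cross (shift u (D.asm C)) (shift v (D.asm C')) z d ≠ 0) :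
    ∃ q q' o h c j sd, ∃ x ∈ C, ∃ x' ∈ C', c < 3 ∧ d = sideDir sd ∧
      z = D.labPos q o h c j sd + u ∧ v = u + D.scale (q - q') ∧
      x.1 = whoAt q (part o h (nbr c sd)) ∧ x'.1 = whoAt q' (part o h (nbr c (!sd))) ∧
      j ∈ D.act o h c sd x.2 ∧ j ∈ D.act o h c (!sd) x'.2 ∧
      cross (shift u (D.asm C)) (shift v (D.asm C')) z d = D.W.w j := by
  obtain ⟨s, s', hs, hs', hg, hw⟩ := exists_of_cross_ne_zero hz
  have hs1 : D.asm C (z - u) = some s := hs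
  have hs1' : D.asm C' (z + d.vec - v) = some s' := hs'
  obtain ⟨x, hx, hxs⟩ := (asm_eq_some hC).1 hs1
  obtain ⟨x', hx', hxs'⟩ := (asm_eq_some hC').1 hs1'
  rcases D.glue_cases d hxs with hi | ⟨o, h, c, j, hc, hl⟩ | h0
  · have := D.glue_int hxs hi
    refine absurd (mem_dom_of hs') (Set.disjoint_left.1 hd ?_)
    rw [mem_dom_shift, mem_dom_asm]
    refine ⟨x, hx, ?_⟩
    rwa [sub_add_eq_add_sub] at this
  · obtain ⟨q, sd, hd1, hx1, hj1, hz1⟩ := D.glue_lab hc hxs hl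
    rw [hg] at hl
    obtain ⟨q', sd', hd2, hx2, hj2, hz2⟩ := D.glue_lab hc hxs' hl
    have hsd : sd' = !sd := by
      apply sideDir_injective
      rw [sideDir_not, ← hd1, ← hd2]
    subst hsd
    refine ⟨q, q', o, h, c, j, sd, x, hx, x', hx', hc, hd1, ?_, ?_, hx1, hx2, hj1, hj2, ?_⟩
    · rw [← hz1]; simp
    · apply labPos_injective (o := o) (h := h) (c := c) (j := j) (sd := !sd)
      rw [← hz2, ← labPos_add_vec, ← hz1, ← hd1]
      abel
    · rw [hw, hg, hl]; rfl
  · rw [hw, h0] at hz; exact absurd rfl hz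

theorem scale_injective {u v : ℤ × ℤ} (h : D.scale u = D.scale v) : u = v := by
  simp only [scale, Prod.mk.injEq] at h
  have hk : (16 * ((D.k : ℤ) + 1)) ≠ 0 := by omega
  exact Prod.ext (mul_left_cancel₀ hk h.1) (mul_left_cancel₀ hk h.2)

/-- Configurations that are bound to each other are aligned. -/
theorem aligned_of_joint {C C' : Config} (hC : D.Disj C) (hC' : D.Disj C') {u v : ℤ × ℤ}
    (hd : Disjoint (shift u (D.asm C)).dom (shift v (D.asm C')).dom)
    (H : Joint τ (shift u (D.asm C)) (shift v (D.asm C'))) : ∃ w, v = u + D.scale w := by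
  obtain ⟨F, hF⟩ := H
  have : ∃ e ∈ F, cross (shift u (D.asm C)) (shift v (D.asm C')) e.1 e.2 ≠ 0 := by
    by_contra! hn
    rw [Finset.sum_eq_zero hn] at hF
    have := D.W.two_le
    omega
  obtain ⟨e, -, he⟩ := this
  obtain ⟨q, q', -, -, -, -, -, -, -, -, -, -, -, -, hv, -⟩ := exists_of_cross hC hC' hd he
  exact ⟨_, hv⟩

theorem exists_of_cross_asm {C C' : Config} (hC : D.Disj C) (hC' : D.Disj C')
    (hd : Disjoint (D.asm C).dom (D.asm C').dom) {z : ℤ × ℤ} {d : Dir}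
    (hz : cross (D.asm C) (D.asm C') z d ≠ 0) :
    ∃ q o h c j sd, ∃ x ∈ C, ∃ x' ∈ C', c < 3 ∧ (z, d) = (D.labPos q o h c j sd, sideDir sd) ∧
      x.1 = whoAt q (part o h (nbr c sd)) ∧ x'.1 = whoAt q (part o h (nbr c (!sd))) ∧
      j ∈ D.act o h c sd x.2 ∧ j ∈ D.act o h c (!sd) x'.2 ∧
      cross (D.asm C) (D.asm C') z d = D.W.w j := by
  have := exists_of_cross (u := 0) (v := 0) hC hC' (by simpa using hd) (by simpa using hz)
  obtain ⟨q, q', o, h, c, j, sd, x, hx, x', hx', hc, hd, hz, hv, h1, h2, h3, h3', h4⟩ := this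
  have hqq : q - q' = 0 := by
    apply D.scale_injective
    rw [zero_add] at hv
    rw [← hv]; simp only [scale, Prod.fst_zero, Prod.snd_zero, mul_zero]; rfl
  have hqq' := sub_eq_zero.1 hqq
  subst hqq'
  exact ⟨q, o, h, c, j, sd, x, hx, x', hx', hc, by rw [hz, hd, add_zero], h1, h2, h3, h3',
    by simpa using h4⟩

theorem cross_label {q : ℤ × ℤ} {o h : Bool} {c j : ℕ} {sd : Bool} {i i' : Id} {t t' : TileType}
    (hc : c < 3) (hi : i = whoAt q (part o h (nbr c sd)))
    (hi' : i' = whoAt q (part o h (nbr c (!sd)))) (hj : j ∈ D.act o h c sd t)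
    (hj' : j ∈ D.act o h c (!sd) t') (hd : Disjoint (D.piece i t).dom (D.piece i' t').dom) :
    cross (D.piece i t) (D.piece i' t') (D.labPos q o h c j sd) (sideDir sd) = D.W.w j := by
  have hm : D.labPos q o h c j sd ∈ (D.piece i t).dom :=
    D.mem_dom_piece.2 ((D.owns_labPos hc (D.lt_of_mem_act' hj)).2 hi)
  have hm' : D.labPos q o h c j (!sd) ∈ (D.piece i' t').dom :=
    D.mem_dom_piece.2 ((D.owns_labPos hc (D.lt_of_mem_act' hj)).2 hi')
  obtain ⟨s, hs, hg⟩ := D.exists_labPos hc hi hj (Set.disjoint_right.1 hd hm')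
  obtain ⟨s', hs', hg'⟩ := D.exists_labPos (sd := !sd) hc hi' hj' (by
    rw [Bool.not_not]; exact Set.disjoint_left.1 hd hm)
  rw [← labPos_add_vec] at hs'
  rw [sideDir_not] at hg'
  rw [cross_of hs hs', hg, hg', if_pos rfl]
  rfl

/-- A pad is bound to its macrotile with full strength. -/
theorem joint_dock {p : ℤ × ℤ} {d : Dir} {h : Bool} {t : TileType}
    (hd : Disjoint (D.piece (body p) t).dom (D.piece (padId p d h) t).dom) :
    Joint τ (D.piece (body p) t) (D.piece (padId p d h) t) := by
  -- The comb between a macrotile and its pad is comb 0 at the southern or western end of a slot and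
  -- comb 2 at the other end.
  set c := if (slotOf d).2 then 0 else 2 with hc
  set sd := (slotOf d).2 with hsd
  have hc3 : c < 3 := by rw [hc]; split_ifs <;> omega
  have hc1 : c ≠ 1 := by rw [hc]; split_ifs <;> omega
  have h1 : body p = whoAt (slotBlk p d) (part (slotOf d).1 h (nbr c sd)) := by
    cases d <;> simp [hc, hsd, body, whoAt, part, nbr, slotBlk, slotOf, oDir, Dir.vec,
      add_unit_cancel]
  have h2 : padId p d h = whoAt (slotBlk p d) (part (slotOf d).1 h (nbr c (!sd))) := by
    cases d <;> simp [hc, hsd, padId, whoAt, part, nbr, slotBlk, slotOf, Dir.vec]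
  have hact : ∀ s, D.act (slotOf d).1 h c s t = D.W.S τ := by
    intro s; rw [act, str, if_neg hc1]
  refine ⟨(D.W.S τ).image fun j => (D.labPos (slotBlk p d) (slotOf d).1 h c j sd, sideDir sd), ?_⟩
  rw [Finset.sum_image]
  · rw [Finset.sum_congr rfl fun j hj => cross_label (D := D) hc3 h1 h2 (by rwa [hact])
      (by rwa [hact]) hd, D.W.S_sum τ le_rfl]
  · intro j hj j' hj' he
    have hj := Finset.mem_coe.1 hj
    have hj' := Finset.mem_coe.1 hj'
    simp only [Prod.mk.injEq, and_true] at he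
    have m1 := D.mark_labPos (slotBlk p d) (sd := sd) (t := t) (h := h) (o := (slotOf d).1) hc3
      (j := j) (by rwa [hact])
    have m2 := D.mark_labPos (slotBlk p d) (sd := sd) (t := t) (h := h) (o := (slotOf d).1) hc3
      (j := j') (by rwa [hact])
    rw [he, m2] at m1
    simpa using m1.symm

/-- Position and direction of the bond with index `j` in the slots on side `d` of block `p`. -/
def bondEdge (D : Design T τ) (p : ℤ × ℤ) (d : Dir) (h : Bool) (j : ℕ) : (ℤ × ℤ) × Dir :=
  (D.labPos (slotBlk p d) (slotOf d).1 h 1 j (slotOf d).2, sideDir (slotOf d).2)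

theorem bondEdge_injective {p p' : ℤ × ℤ} {d d' : Dir} {h h' : Bool} {j j' : ℕ}
    (hj : j < D.k * D.k) (hj' : j' < D.k * D.k)
    (H : D.bondEdge p d h j = D.bondEdge p' d' h' j') : p = p' ∧ d = d' ∧ h = h' ∧ j = j' := by
  simp only [bondEdge, Prod.mk.injEq] at H
  obtain ⟨h1, h2⟩ := H
  have h3 := sideDir_injective h2
  obtain ⟨l1, b1⟩ := D.loc_labPos (slotBlk p d) (slotOf d).1 h (slotOf d).2 (c := 1)
    (by norm_num) hj
  obtain ⟨l2, b2⟩ := D.loc_labPos (slotBlk p' d') (slotOf d').1 h' (slotOf d').2 (c := 1)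
    (by norm_num) hj'
  rw [h1, l2] at l1
  rw [h1, b2] at b1
  simp only [Loc.comb.injEq] at l1
  have hdd : d = d' := by
    rw [← slotDir_slotOf d, ← slotDir_slotOf d', h3, l1.1]
  subst hdd
  refine ⟨?_, rfl, l1.2.1.symm, l1.2.2.2.1.symm⟩
  simp only [slotBlk] at b1
  split_ifs at b1
  · exact b1.symm
  · exact (add_right_cancel b1).symm

theorem act_one (D : Design T τ) (d : Dir) (h : Bool) (t : TileType) :
    D.act (slotOf d).1 h 1 (slotOf d).2 t = D.W.S (halfOf h (min (t.glue d).strength τ)) := by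
  rw [act, str, if_pos rfl, slotDir_slotOf]

/-- The labels that are used on a set of edges, for given strengths of the edges. -/
def labSet (D : Design T τ) (F : Finset ((ℤ × ℤ) × Dir)) (s : (ℤ × ℤ) × Dir → ℕ) :
    Finset (((ℤ × ℤ) × Dir) × Bool × ℕ) :=
  F.biUnion fun e => (Finset.univ : Finset Bool).biUnion fun h =>
    (D.W.S (halfOf h (min (s e) τ))).image fun j => (e, h, j)

theorem mem_labSet {F : Finset ((ℤ × ℤ) × Dir)} {s : (ℤ × ℤ) × Dir → ℕ}
    {x : ((ℤ × ℤ) × Dir) × Bool × ℕ} : x ∈ D.labSet F s ↔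
      x.1 ∈ F ∧ x.2.2 ∈ D.W.S (halfOf x.2.1 (min (s x.1) τ)) := by
  obtain ⟨e, h, j⟩ := x
  simp only [labSet, Finset.mem_biUnion, Finset.mem_image, Finset.mem_univ, true_and,
    Prod.mk.injEq]
  constructor
  · rintro ⟨e', he', h', j', hj', rfl, rfl, rfl⟩; exact ⟨he', hj'⟩
  · rintro ⟨he, hj⟩; exact ⟨e, he, h, j, hj, rfl, rfl, rfl⟩

/-- The labels of the two halves of a side add up to exactly its capped strength. -/
theorem sum_labSet (F : Finset ((ℤ × ℤ) × Dir)) (s : (ℤ × ℤ) × Dir → ℕ) :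
    ∑ x ∈ D.labSet F s, D.W.w x.2.2 = ∑ e ∈ F, min (s e) τ := by
  rw [labSet, Finset.sum_biUnion]
  · refine Finset.sum_congr rfl fun e he => ?_
    rw [Finset.sum_biUnion]
    · rw [Fintype.sum_bool]
      rw [Finset.sum_image (by simp), Finset.sum_image (by simp)]
      rw [D.W.S_sum _ (by simp only [halfOf]; split_ifs <;> omega),
        D.W.S_sum _ (by simp only [halfOf]; split_ifs <;> omega)]
      exact halfOf_add _
    · intro h _ h' _ hne
      simp only [Function.onFun, Finset.disjoint_left, Finset.mem_image]
      rintro _ ⟨j, -, rfl⟩ ⟨j', -, he⟩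
      simp only [Prod.mk.injEq] at he
      exact hne he.2.1.symm
  · intro e _ e' _ hne
    simp only [Function.onFun, Finset.disjoint_left, Finset.mem_biUnion, Finset.mem_image]
    rintro _ ⟨h, -, j, -, rfl⟩ ⟨h', -, j', -, he⟩
    simp only [Prod.mk.injEq] at he
    exact hne he.1.symm

theorem lt_of_mem_labSet {F : Finset ((ℤ × ℤ) × Dir)} {s : (ℤ × ℤ) × Dir → ℕ}
    {x : ((ℤ × ℤ) × Dir) × Bool × ℕ} (hx : x ∈ D.labSet F s) : x.2.2 < D.k * D.k :=
  (Finset.mem_range.1 (D.W.S_sub _ (mem_labSet.1 hx).2)).trans_le D.K_le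

/-- Lower bound for the strength of the bonds between pads. -/
theorem joint_of_pads {a b : Assembly} (F : Finset ((ℤ × ℤ) × Dir)) (t t' : (ℤ × ℤ) × Dir → TileType)
    (hg : ∀ e ∈ F, (t e).glue e.2 = (t' e).glue e.2.opp)
    (ha : ∀ e ∈ F, ∀ h, (D.piece (padId e.1 e.2 h) (t e)).Sub a)
    (hb : ∀ e ∈ F, ∀ h, (D.piece (padId (e.1 + e.2.vec) e.2.opp h) (t' e)).Sub b)
    (hd : ∀ e ∈ F, ∀ h, Disjoint (D.piece (padId e.1 e.2 h) (t e)).dom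
      (D.piece (padId (e.1 + e.2.vec) e.2.opp h) (t' e)).dom)
    (hF : τ ≤ ∑ e ∈ F, ((t e).glue e.2).strength) : Joint τ a b := by
  let s : (ℤ × ℤ) × Dir → ℕ := fun e => ((t e).glue e.2).strength
  refine ⟨(D.labSet F s).image fun x => D.bondEdge x.1.1 x.1.2 x.2.1 x.2.2, ?_⟩
  rw [Finset.sum_image]
  · refine (le_sum_min F s hF).trans ((sum_labSet F s).symm.le.trans
      (Finset.sum_le_sum fun x hx => ?_))
    obtain ⟨he, hj⟩ := mem_labSet.1 hx
    have hj1 : x.2.2 ∈ D.act (slotOf x.1.2).1 x.2.1 1 (slotOf x.1.2).2 (t x.1) := by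
      rw [act_one]; exact hj
    have hj2 : x.2.2 ∈ D.act (slotOf x.1.2).1 x.2.1 1 (!(slotOf x.1.2).2) (t' x.1) := by
      have := D.act_one x.1.2.opp x.2.1 (t' x.1)
      rw [slotOf_opp] at this
      rw [this, ← hg _ he]; exact hj
    have hi2 : padId (x.1.1 + x.1.2.vec) x.1.2.opp x.2.1 = whoAt (slotBlk x.1.1 x.1.2)
        (part (slotOf x.1.2).1 x.2.1 (nbr 1 (!(slotOf x.1.2).2))) := by
      rw [padId_eq, slotBlk_opp, slotOf_opp]
    have := cross_label (D := D) (c := 1) (by norm_num) (padId_eq x.1.1 x.1.2 x.2.1) hi2 hj1 hj2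
      (hd _ he _)
    rw [← this]
    exact cross_mono (ha _ he _) (hb _ he _) _ _
  · intro x hx x' hx' he
    have := bondEdge_injective (lt_of_mem_labSet hx) (lt_of_mem_labSet hx') he
    exact Prod.ext (Prod.ext this.1 this.2.1) (Prod.ext this.2.2.1 this.2.2.2)

end Design

end TwoHAM

namespace TwoHAM
open Assembly

theorem not_joint_of_unique {a b : Assembly} {τ : ℕ} (e₀ : (ℤ × ℤ) × Dir)
    (h : ∀ z d, cross a b z d ≠ 0 → (z, d) = e₀) (hlt : cross a b e₀.1 e₀.2 < τ) :
    ¬ Joint τ a b := by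
  rintro ⟨F, hF⟩
  have := sum_le_sum_of_injOn F {e₀} (fun e => cross a b e.1 e.2) (fun e => cross a b e.1 e.2) id
    (fun e _ he => ⟨by simpa using h e.1 e.2 he, rfl⟩) (fun e _ e' _ _ _ h => h)
  rw [Finset.sum_singleton] at this
  omega

theorem slotDir_opp (o s : Bool) : (slotDir o s).opp = slotDir o (!s) := by
  cases o <;> cases s <;> rfl

theorem single_apply_ne_none {t : TileType} {v z : ℤ × ℤ} {s : TileType}
    (h : shift v (single t) z = some s) : z = v ∧ s = t := by
  simp only [shift, single] at h
  split_ifs at h with h1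
  exact ⟨sub_eq_zero.1 h1, by simpa using h.symm⟩

namespace Design

variable {T : Finset TileType} {τ : ℕ} {D : Design T τ}

/-! ### Single tiles and single pads -/

/-- Two single tiles share at most one edge, and a single bond is weaker than τ. -/
theorem not_joint_single_single {t t' : TileType} (ht : t ∈ univTiles D.W) (v v' : ℤ × ℤ) :
    ¬ Joint τ (shift v (single t)) (shift v' (single t')) := by
  rintro ⟨F, hF⟩
  have hne : ∃ e ∈ F, cross (shift v (single t)) (shift v' (single t')) e.1 e.2 ≠ 0 := by
    by_contra! hn
    rw [Finset.sum_eq_zero hn] at hF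
    have := D.W.two_le
    omega
  obtain ⟨e₀, -, he₀⟩ := hne
  have key : ∀ z d, cross (shift v (single t)) (shift v' (single t')) z d ≠ 0 →
      z = v ∧ z + d.vec = v' ∧
        cross (shift v (single t)) (shift v' (single t')) z d = (t.glue d).strength := by
    intro z d h
    obtain ⟨s, s', hs, hs', hg, hw⟩ := exists_of_cross_ne_zero h
    obtain ⟨h1, h2⟩ := single_apply_ne_none hs
    exact ⟨h1, (single_apply_ne_none hs').1, h2 ▸ hw⟩
  refine not_joint_of_unique e₀ (fun z d h => ?_) ?_ ⟨F, hF⟩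
  · obtain ⟨h1, h2, -⟩ := key _ _ he₀
    obtain ⟨h3, h4, -⟩ := key _ _ h
    refine Prod.ext (h3.trans h1.symm) (Dir.vec_injective ?_)
    rw [h1] at h2
    rw [h3] at h4
    exact add_left_cancel (h4.trans h2.symm)
  · rw [(key _ _ he₀).2.2]
    exact strength_lt_of_mem D.W ht _

/-- The internal glues of the configuration face its own tiles, so the single tile can bind only on
the one side that carries its label. -/
theorem not_joint_single_asm {C : Config} (hC : D.Disj C) {t : TileType}
    (ht : t ∈ univTiles D.W) (v u : ℤ × ℤ)
    (hd : Disjoint (shift v (single t)).dom (shift u (D.asm C)).dom) :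
    ¬ Joint τ (shift v (single t)) (shift u (D.asm C)) := by
  have hlt := fun d => strength_lt_of_mem D.W ht d
  obtain ⟨b, mk, -, rfl⟩ := exists_of_mem_univTiles D.W ht
  have key : ∀ z d, cross (shift v (single (mkTile D.W b mk))) (shift u (D.asm C)) z d ≠ 0 →
      z = v ∧ (∃ sd l, mk = some (sd, l) ∧ d = sideDir sd) ∧
        cross (shift v (single (mkTile D.W b mk))) (shift u (D.asm C)) z d < τ := by
    intro z d h
    obtain ⟨s, s', hs, hs', hg, hw⟩ := exists_of_cross_ne_zero h
    obtain ⟨h1, rfl⟩ := single_apply_ne_none hs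
    refine ⟨h1, ?_, hw ▸ hlt d⟩
    rw [hw] at h
    rw [mkTile_glue] at hg h
    rcases sideGlue_cases D.W b mk d with hi | ⟨-, sd, l, h2, h3, -⟩ | hn
    · have hs2 : D.asm C (z + d.vec - u) = some s' := hs'
      obtain ⟨x, hx, hxs⟩ := (asm_eq_some hC).1 hs2
      have := D.glue_int hxs (hg.symm.trans hi.2)
      refine absurd (mem_dom_of hs) (Set.disjoint_right.1 hd ?_)
      rw [mem_dom_shift, mem_dom_asm]
      refine ⟨x, hx, ?_⟩
      rw [Dir.vec_opp] at this
      convert this using 1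
      abel
    · exact ⟨sd, l, h2, h3⟩
    · rw [hn.2] at h; exact absurd rfl h
  rintro ⟨F, hF⟩
  have hne : ∃ e ∈ F, cross (shift v (single (mkTile D.W b mk))) (shift u (D.asm C)) e.1 e.2 ≠ 0 := by
    by_contra! hn
    rw [Finset.sum_eq_zero hn] at hF
    have := D.W.two_le
    omega
  obtain ⟨e₀, -, he₀⟩ := hne
  obtain ⟨h1, ⟨sd, l, h2, h3⟩, h4⟩ := key _ _ he₀
  refine not_joint_of_unique e₀ (fun z d h => ?_) h4 ⟨F, hF⟩
  obtain ⟨h1', ⟨sd', l', h2', h3'⟩, -⟩ := key _ _ h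
  rw [h2] at h2'
  simp only [Option.some.injEq, Prod.mk.injEq] at h2'
  exact Prod.ext (h1'.trans h1.symm) (by rw [h3', h3, h2'.1])

/-- A pad binds only to a configuration that contains its macrotile. -/
theorem exists_body_of_joint_pad {C : Config} (hC : D.Disj C) {q : ℤ × ℤ} {o h s : Bool}
    {t : TileType} (hd : Disjoint (D.asm C).dom (D.piece (q, some (o, h, s)) t).dom)
    (H : Joint τ (D.asm C) (D.piece (q, some (o, h, s)) t)) :
    ∃ t', (body (home (q, some (o, h, s))), t') ∈ C := by
  by_contra hno
  rw [← asm_singleton ((q, some (o, h, s)), t)] at hd H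
  obtain ⟨F, hF⟩ := H
  set a := D.asm C
  set b := D.asm {((q, some (o, h, s)), t)}
  -- A bond in the comb of the dock would exhibit the macrotile in `C`. So all bonds lie in comb 1,
  -- where the index `j` determines the edge, and their total is at most one half-strength, less
  -- than τ.
  have key : ∀ e : (ℤ × ℤ) × Dir, ∃ j, cross a b e.1 e.2 ≠ 0 →
      e = (D.labPos q o h 1 j s, sideDir s) ∧ j ∈ D.act o h 1 (!s) t ∧
        cross a b e.1 e.2 = D.W.w j := by
    intro e
    by_cases h0 : cross a b e.1 e.2 = 0
    · exact ⟨0, fun h => absurd h0 h⟩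
    obtain ⟨q', o', h', c, j, sd, x, hx, x', hx', hc, he, h1, h2, -, h3, h4⟩ :=
      exists_of_cross_asm hC (disj_singleton _) hd h0
    refine ⟨j, fun _ => ?_⟩
    rw [Set.mem_singleton_iff] at hx'
    subst hx'
    simp only at h2 h3
    interval_cases c
    · cases sd
      · simp [nbr, part, whoAt] at h2
      · simp only [nbr, part, whoAt, Bool.not_true, Bool.false_eq_true, if_false, zero_add,
          Prod.mk.injEq, Option.some.injEq] at h2
        obtain ⟨rfl, rfl, rfl, rfl⟩ := h2
        exact absurd ⟨x.2, by
          have : x.1 = body q := h1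
          rw [home, ← this]; exact hx⟩ hno
    · have : q = q' ∧ o = o' ∧ h = h' ∧ s = sd := by
        cases sd <;> simpa [nbr, part, whoAt] using h2
      obtain ⟨rfl, rfl, rfl, rfl⟩ := this
      exact ⟨he, h3, h4⟩
    · cases sd
      · simp only [nbr, part, whoAt, Bool.not_false, if_true, Prod.mk.injEq,
          Option.some.injEq] at h2
        obtain ⟨rfl, rfl, rfl, rfl⟩ := h2
        exact absurd ⟨x.2, by
          have : x.1 = body (q + (oDir o).vec) := h1
          rw [home, ← this]; exact hx⟩ hno
      · simp [nbr, part, whoAt] at h2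
  choose g hg using key
  have := sum_le_sum_of_injOn F (D.act o h 1 (!s) t) (fun e => cross a b e.1 e.2) D.W.w g
    (fun e _ he => (hg e he).2) (fun e _ e' _ he he' hgg => by
      rw [(hg e he).1, (hg e' he').1, hgg])
  rw [act_sum] at this
  have := D.str_one_lt o h (!s) t
  omega

/-! ### Valid configurations -/

/-- Configurations in which the pieces do not overlap, have tile types in `T`, and in which every
pad is accompanied by its macrotile. -/
structure Valid (D : Design T τ) (C : Config) : Prop where
  disj : D.Disj C
  tiles : ∀ x ∈ C, x.2 ∈ T
  docked : ∀ x ∈ C, (body (home x.1), x.2) ∈ C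

theorem fit_of_below {C C' : Config} (hC : ∀ x ∈ C, x.2 ∈ T) (hC' : ∀ x ∈ C', x.2 ∈ T)
    (hd : Disjoint (D.asm C).dom (D.asm C').dom) {x x' : Id × TileType} (hx : x ∈ C)
    (hx' : x' ∈ C') {q : ℤ × ℤ} {o h sd : Bool} (h1 : x.1 = whoAt q (part o h (nbr 1 sd)))
    (h2 : x'.1 = whoAt q (part o h (nbr 1 (!sd)))) :
    x.2.glue (slotDir o sd) = x'.2.glue (slotDir o sd).opp := by
  have hdd : Disjoint (D.piece x.1 x.2).dom (D.piece x'.1 x'.2).dom := by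
    rw [Set.disjoint_left] at hd ⊢
    exact fun z hz hz' => hd (mem_dom_asm.2 ⟨x, hx, hz⟩) (mem_dom_asm.2 ⟨x', hx', hz'⟩)
  rw [slotDir_opp]
  cases sd
  · exact ((D.fit_of_disjoint (q := q) (o := o) (h := h) (c := 1) ⟨by norm_num, h2, h1⟩
      (hC' _ hx') (hC _ hx) hdd.symm).2 rfl).symm
  · exact (D.fit_of_disjoint (q := q) (o := o) (h := h) (c := 1) ⟨by norm_num, h1, h2⟩
      (hC _ hx) (hC' _ hx') hdd).2 rfl

/-- The bonds between two valid configurations are not stronger than the bonds between the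
assemblies that they represent. -/
theorem joint_tileAsm {C C' : Config} (hC : D.Valid C) (hC' : D.Valid C')
    (hd : Disjoint (D.asm C).dom (D.asm C').dom) (H : Joint τ (D.asm C) (D.asm C')) :
    Joint τ (tileAsm C) (tileAsm C') := by
  classical
  obtain ⟨F, hF⟩ := H
  set a := D.asm C with ha
  set b := D.asm C' with hb
  set α := tileAsm C with hα
  set β := tileAsm C' with hβ
  have hdt : Disjoint α.dom β.dom := tileAsm_disjoint hC.disj hC'.disj hd
  have hhome : ∀ x ∈ C, ∀ x' ∈ C', home x.1 ≠ home x'.1 := by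
    intro x hx x' hx' he
    refine Set.disjoint_left.1 hdt (mem_dom_of ((tileAsm_eq_some hC.disj).2 (hC.docked x hx))) ?_
    rw [he]
    exact mem_dom_of ((tileAsm_eq_some hC'.disj).2 (hC'.docked x' hx'))
  have key : ∀ e : (ℤ × ℤ) × Dir, ∃ y : ((ℤ × ℤ) × Dir) × Bool × ℕ, cross a b e.1 e.2 ≠ 0 →
      e = D.bondEdge y.1.1 y.1.2 y.2.1 y.2.2 ∧
      y.2.2 ∈ D.W.S (halfOf y.2.1 (min (cross α β y.1.1 y.1.2) τ)) ∧
        cross a b e.1 e.2 = D.W.w y.2.2 := by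
    intro e
    by_cases h0 : cross a b e.1 e.2 = 0
    · exact ⟨((0, .north), false, 0), fun h => absurd h0 h⟩
    obtain ⟨q, o, h, c, j, sd, x, hx, x', hx', hc, he, h1, h2, h3, -, h4⟩ :=
      exists_of_cross_asm hC.disj hC'.disj hd h0
    -- Combs 0 and 2 join pieces with the same home, but the homes of docked pieces of the two
    -- configurations differ.
    have hcc : c = 1 := by
      by_contra hc1
      refine hhome x hx x' hx' ?_
      rw [h1, h2]
      have : c = 0 ∨ c = 2 := by omega
      rcases this with rfl | rfl <;> cases sd <;> simp [nbr, part, whoAt, home]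
    subst hcc
    obtain ⟨p, hp, hq, hp'⟩ := padId_part_one q o h sd
    refine ⟨((p, slotDir o sd), h, j), fun _ => ⟨?_, ?_, h4⟩⟩
    · change e = D.bondEdge p (slotDir o sd) h j
      rw [bondEdge, hq, slotOf_slotDir]; exact he
    · change j ∈ D.W.S (halfOf h (min (cross α β p (slotDir o sd)) τ))
      have hg := fit_of_below hC.tiles hC'.tiles hd hx hx' h1 h2
      have hx1 := (tileAsm_eq_some hC.disj).2 (hC.docked x hx)
      have hx2 := (tileAsm_eq_some hC'.disj).2 (hC'.docked x' hx')
      rw [h1, hp, home_padId] at hx1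
      rw [h2, ← hp'] at hx2
      rw [cross_of hx1 hx2, if_pos hg]
      have := D.act_one (slotDir o sd) h x.2
      rw [slotOf_slotDir] at this
      rw [← this]; exact h3
  choose g hg using key
  -- The edges of the represented assemblies across which some bond in `F` lies. The labels used
  -- across one such edge cost at most its capped strength.
  let F' : Finset ((ℤ × ℤ) × Dir) := (F.filter fun e => cross a b e.1 e.2 ≠ 0).image
    fun e => (g e).1
  refine ⟨F', hF.trans ?_⟩
  have := sum_le_sum_of_injOn F (D.labSet F' fun e => cross α β e.1 e.2)
    (fun e => cross a b e.1 e.2) (fun y => D.W.w y.2.2) g (fun e he h0 => ⟨?_, (hg e h0).2.2⟩)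
    (fun e _ e' _ h0 h0' hgg => by rw [(hg e h0).1, (hg e' h0').1, hgg])
  · rw [sum_labSet] at this
    exact this.trans (Finset.sum_le_sum fun e _ => min_le_left _ _)
  · refine mem_labSet.2 ⟨?_, (hg e h0).2.1⟩
    exact Finset.mem_image.2 ⟨e, Finset.mem_filter.2 ⟨he, h0⟩, rfl⟩

/-- A valid configuration in which all bonds of a stable assembly are represented by pads is
stable. -/
theorem Valid.stable {C : Config} (hC : D.Valid C) (hs : (tileAsm C).Stable τ)
    (hp : ∀ p d t, (tileAsm C).bond p d ≠ 0 → tileAsm C p = some t →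
      ∀ h, (padId p d h, t) ∈ C) : (D.asm C).Stable τ := by
  intro A hA hne hne'
  by_contra hcut
  change ¬ Cut τ (D.asm C) A at hcut
  obtain ⟨z₁, hz₁⟩ := hne
  obtain ⟨z₂, hz₂, hz₂A⟩ : ∃ y ∈ (D.asm C).dom, y ∉ A := by
    by_contra! h; exact hne' (Set.Subset.antisymm hA h)
  have hsub : ∀ {x}, x ∈ C → (D.piece x.1 x.2).Sub (D.asm C) := fun hx => piece_sub_asm hC.disj hx
  -- A deficient cut cannot split a piece, as pieces are stable. By `hdock` below it cannot separate
  -- a pad from its macrotile either.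
  have mono : ∀ x ∈ C, ∀ z ∈ (D.piece x.1 x.2).dom, ∀ z' ∈ (D.piece x.1 x.2).dom,
      z ∈ A → z' ∈ A := by
    intro x hx z hz z' hz' hzA
    by_contra hn
    exact hcut ((D.piece_stable x.1 x.2).cut_of_sub (hsub hx) ⟨z, hz, hzA⟩ ⟨z', hz', hn⟩)
  let In : Id × TileType → Prop := fun x => (D.piece x.1 x.2).dom ⊆ A
  have hin : ∀ x ∈ C, ¬ In x → Disjoint (D.piece x.1 x.2).dom A := by
    intro x hx hn
    rw [Set.disjoint_left]
    exact fun z hz hzA => hn fun z' hz' => mono x hx z hz z' hz' hzA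
  have hdock : ∀ x ∈ C, (In x ↔ In (body (home x.1), x.2)) := by
    intro x hx
    obtain ⟨⟨p, i⟩, t⟩ := x
    rcases i with _ | ⟨o, h, s⟩
    · rfl
    have hb := hC.docked _ hx
    obtain ⟨d, hd⟩ := exists_padId p o h s
    set p' := home (p, some (o, h, s))
    have hj : Joint τ (D.piece (body p') t) (D.piece (p, some (o, h, s)) t) := by
      rw [hd]
      refine joint_dock (hC.disj _ hb (padId p' d h, t) (by rw [← hd]; exact hx) ?_)
      simp [body, padId]
    by_contra hne
    by_cases h1 : In ((p, some (o, h, s)), t)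
    · have h2 : ¬ In (body p', t) := fun h2 => hne ⟨fun _ => h2, fun _ => h1⟩
      exact hcut (hj.symm.cut (hsub hx) (hsub hb) h1 (hin _ hb h2))
    · have h2 : In (body p', t) := by
        by_contra h2
        exact hne ⟨fun h => absurd h h1, fun h => absurd h h2⟩
      exact hcut (hj.cut (hsub hb) (hsub hx) h2 (hin _ hx h1))
  set α := tileAsm C with hα
  have hαs : ∀ {p t}, α p = some t ↔ (body p, t) ∈ C := tileAsm_eq_some hC.disj
  -- The cut therefore comes from a cut `S` of the represented assembly. Its stability gives bonds
  -- of total strength τ across `S`, and these are realised by pads.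
  let S : Set (ℤ × ℤ) := {p | ∃ t, α p = some t ∧ In (body p, t)}
  have hIn : ∀ x ∈ C, (In x ↔ home x.1 ∈ S) := by
    intro x hx
    rw [hdock x hx]
    have hb := hC.docked x hx
    constructor
    · intro h; exact ⟨x.2, hαs.2 hb, h⟩
    · rintro ⟨t, ht, h⟩
      rw [hαs.2 hb] at ht; cases ht; exact h
  have hSd : S ⊆ α.dom := fun p ⟨t, ht, _⟩ => mem_dom_of ht
  obtain ⟨x₁, hx₁, hzx₁⟩ := mem_dom_asm.1 (hA hz₁)
  obtain ⟨x₂, hx₂, hzx₂⟩ := mem_dom_asm.1 hz₂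
  have hS1 : home x₁.1 ∈ S := (hIn _ hx₁).1 fun z hz => mono _ hx₁ z₁ hzx₁ z hz hz₁
  have hS2 : home x₂.1 ∉ S := fun h => hz₂A ((hIn _ hx₂).2 h hzx₂)
  obtain ⟨F, hF, hw⟩ := hs S hSd ⟨_, hS1⟩ fun he => hS2 (by
    rw [he]; exact mem_dom_of (hαs.2 (hC.docked _ hx₂)))
  have htile : ∀ p, ∃ t, p ∈ α.dom → α p = some t := by
    intro p
    by_cases hp : p ∈ α.dom
    · obtain ⟨t, ht⟩ := mem_dom.1 hp; exact ⟨t, fun _ => ht⟩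
    · exact ⟨⟨nullGlue, nullGlue, nullGlue, nullGlue⟩, fun h => absurd h hp⟩
  choose tl htl using htile
  let C₁ : Config := {x ∈ C | home x.1 ∈ S}
  let C₂ : Config := {x ∈ C | home x.1 ∉ S}
  have hd1 : D.Disj C₁ := hC.disj.mono fun x hx => hx.1
  have hd2 : D.Disj C₂ := hC.disj.mono fun x hx => hx.1
  have hedge : ∀ e ∈ F.filter (fun e => α.bond e.1 e.2 ≠ 0),
      (tl e.1).glue e.2 = (tl (e.1 + e.2.vec)).glue e.2.opp ∧
      α.bond e.1 e.2 = ((tl e.1).glue e.2).strength ∧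
      (∀ h, (padId e.1 e.2 h, tl e.1) ∈ C₁) ∧
      ∀ h, (padId (e.1 + e.2.vec) e.2.opp h, tl (e.1 + e.2.vec)) ∈ C₂ := by
    intro e he
    obtain ⟨heF, he0⟩ := Finset.mem_filter.1 he
    obtain ⟨s, s', hs, hs', hg, hbw⟩ := exists_of_cross_ne_zero he0
    have e1 := htl _ (mem_dom_of hs)
    have e2 := htl _ (mem_dom_of hs')
    rw [hs] at e1
    rw [hs'] at e2
    simp only [Option.some.injEq] at e1 e2
    obtain ⟨g1, g2⟩ := hF e heF
    rw [← e1, ← e2]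
    refine ⟨hg, hbw, fun h => ⟨hp _ _ _ he0 hs h, ?_⟩, fun h => ⟨hp _ _ _ ?_ hs' h, ?_⟩⟩
    · simp only [home_padId]; exact g1
    · rw [bond_eq_cross, ← cross_comm]; exact he0
    · simp only [home_padId]; exact g2
  have hJ : Joint τ (D.asm C₁) (D.asm C₂) := by
    refine joint_of_pads (F.filter fun e => α.bond e.1 e.2 ≠ 0) (fun e => tl e.1)
      (fun e => tl (e.1 + e.2.vec)) (fun e he => (hedge e he).1)
      (fun e he h => piece_sub_asm hd1 ((hedge e he).2.2.1 h))
      (fun e he h => piece_sub_asm hd2 ((hedge e he).2.2.2 h))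
      (fun e he h => hC.disj _ ((hedge e he).2.2.1 h).1 _ ((hedge e he).2.2.2 h).1 ?_) ?_
    · intro heq
      have := ((hedge e he).2.2.2 h).2
      rw [← heq] at this
      exact this ((hedge e he).2.2.1 h).2
    · rw [← Finset.sum_filter_ne_zero] at hw
      exact hw.trans (le_of_eq (Finset.sum_congr rfl fun e he => (hedge e he).2.1))
  refine hcut (hJ.cut (asm_mono hC.disj fun x hx => hx.1) (asm_mono hC.disj fun x hx => hx.1) ?_ ?_)
  · intro z hz
    obtain ⟨x, hx, hxz⟩ := mem_dom_asm.1 hz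
    exact (hIn x hx.1).2 hx.2 hxz
  · rw [Set.disjoint_left]
    intro z hz
    obtain ⟨x, hx, hxz⟩ := mem_dom_asm.1 hz
    exact Set.disjoint_left.1 (hin x hx.1 fun h => hx.2 ((hIn x hx.1).1 h)) hxz

end Design

end TwoHAM

namespace TwoHAM
open Assembly

theorem body_ne_padId (p p' : ℤ × ℤ) (d : Dir) (h : Bool) : body p ≠ padId p' d h := by
  simp [body, padId]

theorem body_or_padId (i : Id) : i = body (home i) ∨ ∃ d h, i = padId (home i) d h := by
  obtain ⟨q, _ | ⟨o, h, s⟩⟩ := i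
  · exact Or.inl rfl
  · obtain ⟨d, hd⟩ := exists_padId q o h s
    exact Or.inr ⟨d, h, hd⟩

namespace Design

variable {T : Finset TileType} {τ : ℕ} {D : Design T τ}

theorem Below.of_pad_left {q p : ℤ × ℤ} {o h' h : Bool} {c : ℕ} {d : Dir} {j : Id}
    (H : Below q o h' c (padId p d h) j) :
    (c = 1 ∧ j = padId (p + d.vec) d.opp h ∧ slotDir o true = d) ∨ (c = 2 ∧ j = body p) := by
  obtain ⟨hc, h1, rfl⟩ := H
  interval_cases c <;> cases o <;> cases d <;>
    simp_all [padId, whoAt, part, slotOf, slotBlk, slotDir, oDir, Dir.vec, Dir.opp, body,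
      add_unit_cancel]
  all_goals rw [← h1.1]; simp [add_unit_cancel]

theorem Below.of_pad_right {q p : ℤ × ℤ} {o h' h : Bool} {c : ℕ} {d : Dir} {i : Id}
    (H : Below q o h' c i (padId p d h)) :
    (c = 1 ∧ i = padId (p + d.vec) d.opp h ∧ slotDir o false = d) ∨ (c = 0 ∧ i = body p) := by
  obtain ⟨hc, rfl, h1⟩ := H
  interval_cases c <;> cases o <;> cases d <;>
    simp_all [padId, whoAt, part, slotOf, slotBlk, slotDir, oDir, Dir.vec, Dir.opp, body,
      add_unit_cancel]

theorem Below.not_body {q p p' : ℤ × ℤ} {o h : Bool} {c : ℕ} (H : Below q o h c (body p) (body p')) :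
    False := by
  obtain ⟨hc, h1, h2⟩ := H
  interval_cases c <;> simp [whoAt, part, body] at h1 h2

/-- Overlaps can occur only in combs. In a dock the words agree because a block has a single tile
type (`hu`), and between opposite pads they agree by `hm`. -/
theorem valid_of_match {C : Config} (ht : ∀ x ∈ C, x.2 ∈ T)
    (hd : ∀ x ∈ C, (body (home x.1), x.2) ∈ C)
    (hu : ∀ p t t', (body p, t) ∈ C → (body p, t') ∈ C → t = t')
    (hm : ∀ p d h t t', (padId p d h, t) ∈ C → (padId (p + d.vec) d.opp h, t') ∈ C →
      t.glue d = t'.glue d.opp) : D.Valid C := by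
  have hu' : ∀ x ∈ C, ∀ y ∈ C, home x.1 = home y.1 → x.2 = y.2 := fun x hx y hy he =>
    hu _ _ _ (hd x hx) (he ▸ hd y hy)
  have hfit : ∀ x ∈ C, ∀ y ∈ C, Fits x.1 x.2 y.1 y.2 := by
    rintro ⟨i, t⟩ hx ⟨j, t'⟩ hy q o h c H
    simp only at H ⊢
    have same : home i = home j → t = t' := hu' _ hx _ hy
    rcases body_or_padId i with hi | ⟨d, h', hi⟩
    · rcases body_or_padId j with hj | ⟨d', h'', hj⟩
      · rw [hi, hj] at H; exact H.not_body.elim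
      · have hj' := hj
        rw [hj] at H
        rcases H.of_pad_right with ⟨-, hi', -⟩ | ⟨rfl, hi'⟩
        · rw [hi] at hi'; exact absurd hi' (body_ne_padId _ _ _ _)
        · exact ⟨fun _ => same (by rw [hi']; rfl), fun h => absurd h (by norm_num)⟩
    · have hi1 := hi
      rw [hi] at H
      rcases H.of_pad_left with ⟨rfl, hj, hs⟩ | ⟨rfl, hj⟩
      · refine ⟨fun h => absurd rfl h, fun _ => ?_⟩
        rw [show slotDir o false = d.opp by rw [← hs, slotDir_opp]; rfl, hs]
        rw [hi] at hx
        rw [hj] at hy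
        exact hm _ _ _ _ _ hx hy
      · exact ⟨fun _ => same (by rw [hj]; rfl), fun h => absurd h (by norm_num)⟩
  refine ⟨fun x hx y hy hne => ?_, ht, hd⟩
  refine D.disjoint_of_fits (fun he => hne ?_) (hfit x hx y hy) (hfit y hy x hx)
  exact Prod.ext he (hu' x hx y hy (by rw [he]))

theorem Valid.match {C : Config} (hC : D.Valid C) {p : ℤ × ℤ} {d : Dir} {h : Bool}
    {t t' : TileType} (h1 : (padId p d h, t) ∈ C) (h2 : (padId (p + d.vec) d.opp h, t') ∈ C) :
    t.glue d = t'.glue d.opp := by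
  have hne : padId p d h ≠ padId (p + d.vec) d.opp h := fun he =>
    d.vec_ne_zero (by have := (padId_injective he).1; simpa using this.symm)
  have hd := hC.disj _ h1 _ h2 fun he => hne (congrArg Prod.fst he)
  have hi : padId (p + d.vec) d.opp h = whoAt (slotBlk p d)
      (part (slotOf d).1 h (nbr 1 (!(slotOf d).2))) := by
    rw [padId_eq, slotBlk_opp, slotOf_opp]
  have := fit_of_below (D := D) (C := {(padId p d h, t)})
    (C' := {(padId (p + d.vec) d.opp h, t')}) (by rintro x rfl; exact hC.tiles _ h1)
    (by rintro x rfl; exact hC.tiles _ h2) (by rw [asm_singleton, asm_singleton]; exact hd)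
    (Set.mem_singleton _) (Set.mem_singleton _) (padId_eq p d h) hi
  rwa [slotDir_slotOf] at this

theorem Valid.mem_dom {C : Config} (hC : D.Valid C) {x : Id × TileType} (hx : x ∈ C) :
    home x.1 ∈ (tileAsm C).dom :=
  mem_dom_of ((tileAsm_eq_some hC.disj).2 (hC.docked x hx))

theorem Valid.tileAsm_home {C : Config} (hC : D.Valid C) {x : Id × TileType} (hx : x ∈ C) :
    tileAsm C (home x.1) = some x.2 := (tileAsm_eq_some hC.disj).2 (hC.docked x hx)

theorem Valid.move {C : Config} (hC : D.Valid C) (v : ℤ × ℤ) : D.Valid (move v C) := by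
  refine ⟨hC.disj.move v, fun x hx => hC.tiles ((x.1.1 - v, x.1.2), x.2) hx, fun x hx => ?_⟩
  have := hC.docked ((x.1.1 - v, x.1.2), x.2) hx
  change (((body (home x.1)).1 - v, (body (home x.1)).2), x.2) ∈ C
  convert this using 2
  obtain ⟨⟨q, _ | ⟨o, h, s⟩⟩, t⟩ := x
  · rfl
  · cases s
    · rfl
    · simp [home, body, sub_add_eq_add_sub]

/-! ### Growth by pads -/

/-- The new pads are attached one at a time. Each is bound with strength τ to its macrotile, so the
order is irrelevant. -/
theorem grow {P : Set Supertile} {C C' : Config} (hC' : D.Valid C') (hsub : C ⊆ C')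
    (hfin : (C' \ C).Finite) (hpad : ∀ x ∈ C' \ C, ∃ d h, x.1 = padId (home x.1) d h)
    (hP : ∀ x ∈ C' \ C, Supertile.of (D.piece x.1 x.2) ∈ P) (hs : (D.asm C).Stable τ) :
    AttachStar P τ (D.asm C) (D.asm C') ∧ (D.asm C').Stable τ := by
  have key : ∀ S : Set (Id × TileType), S.Finite → S ⊆ C' \ C →
      AttachStar P τ (D.asm C) (D.asm (C ∪ S)) ∧ (D.asm (C ∪ S)).Stable τ := by
    intro S hS
    induction S, hS using Set.Finite.induction_on with
    | empty => intro _; rw [Set.union_empty]; exact ⟨.refl, hs⟩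
    | @insert x S hxS _ ih =>
      intro hsub'
      obtain ⟨ih1, ih2⟩ := ih fun y hy => hsub' (Set.mem_insert_of_mem _ hy)
      have hx := hsub' (Set.mem_insert _ _)
      have hle : C ∪ S ∪ {x} ⊆ C' := by
        rintro y ((hy | hy) | rfl)
        · exact hsub hy
        · exact (hsub' (Set.mem_insert_of_mem _ hy)).1
        · exact hx.1
      have hd := hC'.disj.mono hle
      rw [show C ∪ insert x S = C ∪ S ∪ {x} by
        rw [Set.union_assoc, Set.union_comm S, Set.singleton_union]]
      obtain ⟨d, h, hxp⟩ := hpad x hx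
      -- Only pads are new, so the macrotile is already in `C`.
      have hb : (body (home x.1), x.2) ∈ C := by
        by_contra hn
        obtain ⟨d', h', he⟩ := hpad _ ⟨hC'.docked x hx.1, hn⟩
        exact body_ne_padId _ _ _ _ he
      have hxn : x ∉ C ∪ S := by rintro (h | h); exacts [hx.2 h, hxS h]
      have hdis : Disjoint (D.asm (C ∪ S)).dom (D.piece x.1 x.2).dom := by
        rw [Set.disjoint_left]
        intro z hz
        obtain ⟨y, hy, hzy⟩ := mem_dom_asm.1 hz
        exact Set.disjoint_left.1 (hd y (Or.inl hy) x (Or.inr rfl) fun he => hxn (he ▸ hy)) hzy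
      have heq : D.asm (C ∪ S ∪ {x}) = (D.asm (C ∪ S)).union (D.piece x.1 x.2) := by
        rw [asm_union hd, asm_singleton]
      have hbp : Joint τ (D.piece (body (home x.1)) x.2) (D.piece x.1 x.2) := by
        rw [hxp, home_padId]
        refine joint_dock ?_
        rw [← hxp]
        refine hC'.disj _ (hsub hb) _ hx.1 fun he => body_ne_padId (home x.1) (home x.1) d h ?_
        rw [← hxp]; exact congrArg Prod.fst he
      have hst : ((D.asm (C ∪ S)).union (D.piece x.1 x.2)).Stable τ :=
        ih2.union (D.piece_stable _ _) hdis
          (hbp.mono (piece_sub_asm (hd.mono Set.subset_union_left) (Or.inl hb)) (sub_refl _))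
      rw [heq]
      exact ⟨ih1.tail ⟨_, hP x hx, hdis, hst, rfl⟩, hst⟩
  have := key (C' \ C) hfin subset_rfl
  rwa [Set.union_sdiff_cancel hsub] at this

/-- The configuration with additional pads on given sides of its macrotiles. -/
def addPads (C : Config) (E : Finset ((ℤ × ℤ) × Dir)) : Config :=
  C ∪ {x | ∃ e ∈ E, ∃ h, tileAsm C e.1 = some x.2 ∧ x.1 = padId e.1 e.2 h}

theorem body_mem_addPads {C : Config} {E : Finset ((ℤ × ℤ) × Dir)} {p : ℤ × ℤ} {t : TileType} :
    (body p, t) ∈ addPads C E ↔ (body p, t) ∈ C := by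
  constructor
  · rintro (h | ⟨e, -, h, -, he⟩)
    · exact h
    · exact absurd he (body_ne_padId _ _ _ _)
  · exact Or.inl

/-- The new pads face blocks without a macrotile. Since pads are docked, there is no opposite pad
with which a new one could clash. -/
theorem Valid.addPads {C : Config} (hC : D.Valid C) {E : Finset ((ℤ × ℤ) × Dir)}
    (hE : ∀ e ∈ E, e.1 + e.2.vec ∉ (tileAsm C).dom) : D.Valid (addPads C E) := by
  have hnew : ∀ e ∈ E, ∀ t, tileAsm C e.1 = some t → (body e.1, t) ∈ C := fun e _ t ht =>
    (tileAsm_eq_some hC.disj).1 ht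
  refine valid_of_match ?_ ?_ ?_ ?_
  · rintro x (hx | ⟨e, he, h, ht, -⟩)
    · exact hC.tiles x hx
    · exact hC.tiles (body e.1, x.2) (hnew e he _ ht)
  · rintro x (hx | ⟨e, he, h, ht, hxe⟩)
    · exact Or.inl (hC.docked x hx)
    · rw [hxe, home_padId]; exact Or.inl (hnew e he _ ht)
  · intro p t t' h h'
    rw [body_mem_addPads] at h h'
    exact hC.disj.eq_of_id h h'
  · rintro p d h t t' (h1 | ⟨e, he, h1, ht, hxe⟩) (h2 | ⟨e', he', h2, ht', hxe'⟩)
    · exact hC.match h1 h2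
    · obtain ⟨e1, e2, -⟩ := padId_injective hxe'
      refine absurd (hC.mem_dom h1) ?_
      have := hE e' he'
      rw [← e1, ← e2] at this
      rw [home_padId]
      simpa using this
    · obtain ⟨e1, e2, -⟩ := padId_injective hxe
      refine absurd (hC.mem_dom h2) ?_
      have := hE e he
      rw [← e1, ← e2] at this
      rwa [home_padId]
    · obtain ⟨e1, e2, -⟩ := padId_injective hxe
      obtain ⟨e1', e2', -⟩ := padId_injective hxe'
      refine absurd (mem_dom_of ht') ?_
      have := hE e he
      rw [← e1, ← e2] at this
      simp only at ht'
      rwa [← e1']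

theorem tileAsm_addPads {C : Config} (hC : D.Valid C) {E : Finset ((ℤ × ℤ) × Dir)}
    (hE : ∀ e ∈ E, e.1 + e.2.vec ∉ (tileAsm C).dom) : tileAsm (addPads C E) = tileAsm C :=
  tileAsm_ext (hC.addPads hE).disj fun p t => by
    rw [body_mem_addPads, tileAsm_eq_some hC.disj]

theorem grow_addPads {P : Set Supertile} {C : Config} (hC : D.Valid C)
    {E : Finset ((ℤ × ℤ) × Dir)} (hE : ∀ e ∈ E, e.1 + e.2.vec ∉ (tileAsm C).dom)
    (hP : ∀ p d h, ∀ t ∈ T, Supertile.of (D.piece (padId p d h) t) ∈ P)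
    (hs : (D.asm C).Stable τ) :
    AttachStar P τ (D.asm C) (D.asm (addPads C E)) ∧ (D.asm (addPads C E)).Stable τ := by
  have hV := hC.addPads hE
  have hx : ∀ x ∈ addPads C E \ C, ∃ e ∈ E, ∃ h, tileAsm C e.1 = some x.2 ∧
      x.1 = padId e.1 e.2 h := by
    rintro x ⟨hx | hx, hn⟩
    · exact absurd hx hn
    · exact hx
  refine grow hV Set.subset_union_left ?_ ?_ ?_ hs
  · refine Set.Finite.subset (((E ×ˢ (Finset.univ : Finset Bool) ×ˢ T).image
      fun y => (padId y.1.1 y.1.2 y.2.1, y.2.2)).finite_toSet) fun x hxC => ?_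
    obtain ⟨e, he, h, ht, hxe⟩ := hx x hxC
    rw [Finset.mem_coe, Finset.mem_image]
    refine ⟨(e, h, x.2), ?_, Prod.ext hxe.symm rfl⟩
    simp [he, hV.tiles x hxC.1]
  · intro x hxC
    obtain ⟨e, he, h, ht, hxe⟩ := hx x hxC
    exact ⟨e.2, h, by rw [hxe, home_padId]⟩
  · intro x hxC
    obtain ⟨e, he, h, ht, hxe⟩ := hx x hxC
    rw [hxe]
    exact hP _ _ _ _ (hV.tiles x hxC.1)

/-- All pads lie on sides that face a macrotile. -/
def Internal (C : Config) : Prop :=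
  ∀ p d h t, (padId p d h, t) ∈ C → p + d.vec ∈ (tileAsm C).dom

/-- Pads are added on both ends of each edge that carries a bond between the represented assemblies,
and these pads realise all of that bond. `C₁` may already have other outer pads, but `C₂` has none,
so the only pads of `C₂` that face `C₁` are new ones on edges with equal glues. Hence nothing
overlaps. -/
theorem exists_grown {C₁ C₂ : Config} (h₁ : D.Valid C₁) (h₂ : D.Valid C₂)
    (s₁ : (D.asm C₁).Stable τ) (s₂ : (D.asm C₂).Stable τ)
    (hd : Disjoint (tileAsm C₁).dom (tileAsm C₂).dom) (H : Joint τ (tileAsm C₁) (tileAsm C₂))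
    (hint : Internal C₂) {P : Set Supertile}
    (hP : ∀ p d h, ∀ t ∈ T, Supertile.of (D.piece (padId p d h) t) ∈ P) :
    ∃ C₁' C₂', D.Valid C₁' ∧ D.Valid C₂' ∧ D.Valid (C₁' ∪ C₂') ∧ C₁ ⊆ C₁' ∧
      tileAsm C₁' = tileAsm C₁ ∧ tileAsm C₂' = tileAsm C₂ ∧
      AttachStar P τ (D.asm C₁) (D.asm C₁') ∧ AttachStar P τ (D.asm C₂) (D.asm C₂') ∧
      Disjoint (D.asm C₁').dom (D.asm C₂').dom ∧
      ((D.asm C₁').union (D.asm C₂')).Stable τ ∧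
      (Internal C₁ → Internal (C₁' ∪ C₂')) := by
  classical
  obtain ⟨F, hF⟩ := H
  set α := tileAsm C₁ with hα
  set β := tileAsm C₂ with hβ
  set E := F.filter fun e => cross α β e.1 e.2 ≠ 0 with hE
  have hEs : ∀ e ∈ E, ∃ s t, α e.1 = some s ∧ β (e.1 + e.2.vec) = some t ∧
      s.glue e.2 = t.glue e.2.opp ∧ cross α β e.1 e.2 = (s.glue e.2).strength := fun e he =>
    exists_of_cross_ne_zero (Finset.mem_filter.1 he).2
  set E' := E.map revEdge.toEmbedding with hE'
  have hEs' : ∀ e ∈ E', ∃ e₀ ∈ E, e.1 = e₀.1 + e₀.2.vec ∧ e.2 = e₀.2.opp := by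
    intro e he
    obtain ⟨e₀, h0, rfl⟩ := Finset.mem_map.1 he
    exact ⟨e₀, h0, rfl, rfl⟩
  have hmem' : ∀ e ∈ E, (e.1 + e.2.vec, e.2.opp) ∈ E' := fun e he =>
    Finset.mem_map.2 ⟨e, he, rfl⟩
  have hx1 : ∀ e ∈ E, e.1 + e.2.vec ∉ α.dom := by
    intro e he
    obtain ⟨s, t, -, ht, -⟩ := hEs e he
    exact Set.disjoint_right.1 hd (mem_dom_of ht)
  have hx2 : ∀ e ∈ E', e.1 + e.2.vec ∉ β.dom := by
    intro e he
    obtain ⟨e₀, h0, h1, h2⟩ := hEs' e he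
    obtain ⟨s, t, hs, -⟩ := hEs e₀ h0
    rw [h1, h2, Dir.vec_opp, add_neg_cancel_right]
    exact Set.disjoint_left.1 hd (mem_dom_of hs)
  have V1 := h₁.addPads hx1
  have V2 := h₂.addPads hx2
  have t1 := tileAsm_addPads h₁ hx1
  have t2 := tileAsm_addPads h₂ hx2
  obtain ⟨g1, st1⟩ := grow_addPads h₁ hx1 hP s₁
  obtain ⟨g2, st2⟩ := grow_addPads h₂ hx2 hP s₂
  have home1 : ∀ x ∈ addPads C₁ E, α (home x.1) = some x.2 := fun x hx => by
    have := V1.tileAsm_home hx; rwa [t1] at this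
  have home2 : ∀ x ∈ addPads C₂ E', β (home x.1) = some x.2 := fun x hx => by
    have := V2.tileAsm_home hx; rwa [t2] at this
  have hne : ∀ x ∈ addPads C₁ E, ∀ y ∈ addPads C₂ E', home x.1 ≠ home y.1 :=
    fun x hx y hy he => Set.disjoint_left.1 hd (mem_dom_of (home1 x hx))
      (by rw [he]; exact mem_dom_of (home2 y hy))
  -- A pad on the second side that faces the first configuration cannot be an old one, by `hint`. It
  -- comes from a bonding edge, where the glues agree.
  have hfar : ∀ p d h t t', (padId p d h, t) ∈ addPads C₁ E →
      (padId (p + d.vec) d.opp h, t') ∈ addPads C₂ E' → t.glue d = t'.glue d.opp := by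
    rintro p d h t t' h1 h2
    have e1 := home1 _ h1
    have e2 := home2 _ h2
    rw [home_padId] at e1 e2
    rcases h2 with h2 | ⟨e, he, h', -, hxe⟩
    · have := hint _ _ _ _ h2
      rw [Dir.vec_opp, add_neg_cancel_right] at this
      exact absurd this (Set.disjoint_left.1 hd (mem_dom_of e1))
    · obtain ⟨f1, f2, -⟩ := padId_injective hxe
      obtain ⟨e₀, h0, g1, g2⟩ := hEs' e he
      have hdd : d = e₀.2 := by
        have := congrArg Dir.opp (f2.trans g2)
        simpa using this
      have hpp : p = e₀.1 := by
        have := f1.trans g1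
        rw [hdd] at this
        exact add_right_cancel this
      obtain ⟨s, t₂, hs, ht, hg, -⟩ := hEs e₀ h0
      rw [← hpp] at hs ht
      rw [← hdd] at ht hg
      rw [hs] at e1
      rw [ht] at e2
      cases e1
      cases e2
      exact hg
  have V : D.Valid (addPads C₁ E ∪ addPads C₂ E') := by
    refine valid_of_match ?_ ?_ ?_ ?_
    · rintro x (hx | hx)
      exacts [V1.tiles x hx, V2.tiles x hx]
    · rintro x (hx | hx)
      exacts [Or.inl (V1.docked x hx), Or.inr (V2.docked x hx)]
    · rintro p t t' (h | h) (h' | h')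
      · exact V1.disj.eq_of_id h h'
      · exact absurd rfl (hne (body p, t) h (body p, t') h')
      · exact absurd rfl (hne (body p, t') h' (body p, t) h)
      · exact V2.disj.eq_of_id h h'
    · rintro p d h t t' (h1 | h1) (h2 | h2)
      · exact V1.match h1 h2
      · exact hfar _ _ _ _ _ h1 h2
      · have := hfar (p + d.vec) d.opp h t' t h2 (by
          rw [Dir.vec_opp, add_neg_cancel_right, Dir.opp_opp]; exact h1)
        rw [Dir.opp_opp] at this
        exact this.symm
      · exact V2.match h1 h2
  have hdis : Disjoint (D.asm (addPads C₁ E)).dom (D.asm (addPads C₂ E')).dom := by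
    rw [Set.disjoint_left]
    intro z hz hz'
    obtain ⟨x, hx, hzx⟩ := mem_dom_asm.1 hz
    obtain ⟨y, hy, hzy⟩ := mem_dom_asm.1 hz'
    exact Set.disjoint_left.1 (V.disj x (Or.inl hx) y (Or.inr hy) fun he =>
      hne x hx y hy (by rw [he])) hzx hzy
  have htl : ∀ e : (ℤ × ℤ) × Dir, ∃ s t, e ∈ E → α e.1 = some s ∧ β (e.1 + e.2.vec) = some t ∧
      s.glue e.2 = t.glue e.2.opp ∧ cross α β e.1 e.2 = (s.glue e.2).strength := by
    intro e
    by_cases he : e ∈ E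
    · obtain ⟨s, t, h⟩ := hEs e he; exact ⟨s, t, fun _ => h⟩
    · exact ⟨⟨nullGlue, nullGlue, nullGlue, nullGlue⟩, ⟨nullGlue, nullGlue, nullGlue, nullGlue⟩,
        fun h => absurd h he⟩
  choose s t hst using htl
  have p1 : ∀ e ∈ E, ∀ h, (padId e.1 e.2 h, s e) ∈ addPads C₁ E := fun e he h =>
    Or.inr ⟨e, he, h, (hst e he).1, rfl⟩
  have p2 : ∀ e ∈ E, ∀ h, (padId (e.1 + e.2.vec) e.2.opp h, t e) ∈ addPads C₂ E' := fun e he h =>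
    Or.inr ⟨_, hmem' e he, h, (hst e he).2.1, rfl⟩
  have hJ : Joint τ (D.asm (addPads C₁ E)) (D.asm (addPads C₂ E')) := by
    refine joint_of_pads E s t (fun e he => (hst e he).2.2.1)
      (fun e he h => piece_sub_asm V1.disj (p1 e he h))
      (fun e he h => piece_sub_asm V2.disj (p2 e he h))
      (fun e he h => V.disj _ (Or.inl (p1 e he h)) _ (Or.inr (p2 e he h)) fun hh =>
        hne _ (p1 e he h) _ (p2 e he h) (by rw [hh])) ?_
    rw [← Finset.sum_filter_ne_zero] at hF
    exact hF.trans (le_of_eq (Finset.sum_congr rfl fun e he => (hst e he).2.2.2))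
  refine ⟨addPads C₁ E, addPads C₂ E', V1, V2, V, Set.subset_union_left, t1, t2, g1, g2, hdis,
    st1.union st2 hdis hJ, fun hint1 p d h t' hp => ?_⟩
  rw [tileAsm_union V.disj, t1, t2, dom_union]
  rcases hp with (hp | ⟨e, he, h', -, hxe⟩) | (hp | ⟨e, he, h', -, hxe⟩)
  · exact Or.inl (hint1 _ _ _ _ hp)
  · obtain ⟨f1, f2, -⟩ := padId_injective hxe
    rw [f1, f2]
    exact Or.inr (mem_dom_of (hst e he).2.1)
  · exact Or.inr (hint _ _ _ _ hp)
  · obtain ⟨f1, f2, -⟩ := padId_injective hxe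
    obtain ⟨e₀, h0, g1, g2⟩ := hEs' e he
    rw [f1, f2, g1, g2, Dir.vec_opp, add_neg_cancel_right]
    exact Or.inl (mem_dom_of (hst e₀ h0).1)

/-! ### The configuration of an assembly -/

/-- The macrotiles of the tiles of `β` together with all pads between matching sides. -/
def canon (β : Assembly) : Config :=
  {x | ∃ p t, β p = some t ∧ (x = (body p, t) ∨ ∃ d h t', β (p + d.vec) = some t' ∧
    t.glue d = t'.glue d.opp ∧ x = (padId p d h, t))}

theorem body_mem_canon {β : Assembly} {p : ℤ × ℤ} {t : TileType} :
    (body p, t) ∈ canon β ↔ β p = some t := by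
  constructor
  · rintro ⟨p', t', h, he | ⟨d, h', t'', -, -, he⟩⟩
    · simp only [body, Prod.mk.injEq, and_true] at he
      rw [he.1, he.2]; exact h
    · exact absurd (congrArg Prod.fst he) (body_ne_padId _ _ _ _)
  · exact fun h => ⟨p, t, h, Or.inl rfl⟩

theorem pad_mem_canon {β : Assembly} {p : ℤ × ℤ} {d : Dir} {h : Bool} {t : TileType} :
    (padId p d h, t) ∈ canon β ↔
      β p = some t ∧ ∃ t', β (p + d.vec) = some t' ∧ t.glue d = t'.glue d.opp := by
  constructor
  · rintro ⟨p', t', h, he | ⟨d, h', t'', h1, h2, he⟩⟩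
    · exact absurd (congrArg Prod.fst he).symm (body_ne_padId _ _ _ _)
    · simp only [Prod.mk.injEq] at he
      obtain ⟨he, rfl⟩ := he
      obtain ⟨rfl, rfl, -⟩ := padId_injective he
      exact ⟨h, t'', h1, h2⟩
  · rintro ⟨h1, t', h2, h3⟩
    exact ⟨p, t, h1, Or.inr ⟨d, h, t', h2, h3, rfl⟩⟩

theorem canon_valid (D : Design T τ) {β : Assembly} (hβ : β.Over T) : D.Valid (canon β) := by
  refine valid_of_match ?_ ?_ ?_ ?_
  · rintro x ⟨p, t, h, rfl | ⟨d, h', t', -, -, rfl⟩⟩ <;> exact hβ _ _ h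
  · rintro x ⟨p, t, h, rfl | ⟨d, h', t', -, -, rfl⟩⟩
    · exact body_mem_canon.2 h
    · rw [home_padId]; exact body_mem_canon.2 h
  · intro p t t' h h'
    rw [body_mem_canon] at h h'
    rw [h] at h'
    exact Option.some.inj h'
  · intro p d h t t' h1 h2
    rw [pad_mem_canon] at h1 h2
    obtain ⟨h1, t₂, h3, h4⟩ := h1
    rw [h2.1] at h3
    cases h3
    exact h4

theorem tileAsm_canon (D : Design T τ) {β : Assembly} (hβ : β.Over T) : tileAsm (canon β) = β :=
  tileAsm_ext (canon_valid D hβ).disj fun _ _ => body_mem_canon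

theorem canon_internal (D : Design T τ) {β : Assembly} (hβ : β.Over T) : Internal (canon β) := by
  intro p d h t hp
  rw [tileAsm_canon D hβ]
  obtain ⟨-, t', h', -⟩ := pad_mem_canon.1 hp
  exact mem_dom_of h'

theorem canon_stable (D : Design T τ) {β : Assembly} (hβ : β.Over T) (hs : β.Stable τ) :
    (D.asm (canon β)).Stable τ := by
  refine (canon_valid D hβ).stable (by rwa [tileAsm_canon D hβ]) fun p d t hb ht h => ?_
  rw [tileAsm_canon D hβ] at hb ht
  obtain ⟨s, t', h1, h2, h3, -⟩ := exists_of_cross_ne_zero hb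
  rw [ht] at h1
  cases h1
  exact pad_mem_canon.2 ⟨ht, t', h2, h3⟩

end Design

end TwoHAM

namespace TwoHAM
open Assembly

theorem home_whoAt (q : ℤ × ℤ) (w : Who) :
    home (whoAt q w) = q ∨ ∃ d : Dir, home (whoAt q w) = q + d.vec := by
  rcases w with _ | o | ⟨o, h, _ | _⟩
  · exact Or.inl rfl
  · exact Or.inr ⟨oDir o, rfl⟩
  · exact Or.inl rfl
  · exact Or.inr ⟨oDir o, rfl⟩

namespace Design

variable {T : Finset TileType} {τ : ℕ} (D : Design T τ)

/-! ### The block representation function -/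

/-- The scale of the simulation. -/
def size : ℕ := 16 * (D.k + 1)

theorem blk_cell_iff {z p : ℤ × ℤ} : blk D.k (cell z) = p ↔
    ∃ i j : Fin D.size, z = ((D.size : ℤ) * p.1 + (i : ℕ), (D.size : ℤ) * p.2 + (j : ℕ)) := by
  have hs : (D.size : ℤ) = 16 * ((D.k : ℤ) + 1) := by simp [size]
  have e : ∀ x : ℤ, 16 * ((D.k : ℤ) + 1) * x = 2 * (8 * (D.k + 1) * x) := fun x => by ring
  have key : blk D.k (cell z) = p ↔ (colBlk D.k (z.1 / 2) = p.1 ∧ rowBlk D.k (z.2 / 2) = p.2) := by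
    rw [Prod.ext_iff]; rfl
  rw [key, colBlk_eq_iff, rowBlk_eq_iff]
  constructor
  · rintro ⟨⟨h1, h2⟩, h3, h4⟩
    refine ⟨⟨(z.1 - D.size * p.1).toNat, ?_⟩, ⟨(z.2 - D.size * p.2).toNat, ?_⟩, ?_⟩
    · zify [Int.toNat_of_nonneg]; rw [hs, e]; omega
    · zify [Int.toNat_of_nonneg]; rw [hs, e]; omega
    · refine Prod.ext ?_ ?_ <;> simp only <;> rw [hs, e] <;> omega
  · rintro ⟨i, j, rfl⟩
    have hi : ((i : ℕ) : ℤ) < 16 * ((D.k : ℤ) + 1) := by rw [← hs]; exact_mod_cast i.2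
    have hj : ((j : ℕ) : ℤ) < 16 * ((D.k : ℤ) + 1) := by rw [← hs]; exact_mod_cast j.2
    simp only
    rw [hs, e, e]
    omega

theorem hasTile_iff {γ : Assembly} {p : ℤ × ℤ} :
    (γ.block D.size p).HasTile ↔ ∃ z ∈ γ.dom, blk D.k (cell z) = p := by
  constructor
  · rintro ⟨i, j, h⟩
    exact ⟨_, h, D.blk_cell_iff.2 ⟨i, j, rfl⟩⟩
  · rintro ⟨z, hz, hb⟩
    obtain ⟨i, j, rfl⟩ := D.blk_cell_iff.1 hb
    exact ⟨i, j, hz⟩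

open Classical in
/-- A block represents `t` if it contains the part of the macrotile of `t` in its own block. -/
noncomputable def rep (b : Block D.size) : Option TileType :=
  if h : ∃ t ∈ T, ∀ (i j : Fin D.size) (s : TileType),
      D.piece (body 0) t (((i : ℕ) : ℤ), ((j : ℕ) : ℤ)) = some s → b i j = some s then
    some h.choose else none

theorem piece_body (p : ℤ × ℤ) (t : TileType) (z : ℤ × ℤ) :
    D.piece (body p) t (z + D.scale p) = D.piece (body 0) t z := by
  have := D.piece_add (body 0) t p
  have h : ((body 0).1 + p, (body 0).2) = body p := by simp [body]
  rw [h] at this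
  rw [this]
  simp [shift]

theorem contains_iff {γ : Assembly} {p : ℤ × ℤ} {t : TileType} :
    (∀ (i j : Fin D.size) (s : TileType),
      D.piece (body 0) t (((i : ℕ) : ℤ), ((j : ℕ) : ℤ)) = some s →
        γ.block D.size p i j = some s) ↔
    ∀ z s, blk D.k (cell z) = p → D.piece (body p) t z = some s → γ z = some s := by
  have key : ∀ i j : Fin D.size,
      (((D.size : ℤ) * p.1 + (i : ℕ), (D.size : ℤ) * p.2 + (j : ℕ)) : ℤ × ℤ) =
        (((i : ℕ) : ℤ), ((j : ℕ) : ℤ)) + D.scale p := by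
    intro i j
    simp [scale, size, add_comm]
  constructor
  · intro H z s hz hs
    obtain ⟨i, j, rfl⟩ := D.blk_cell_iff.1 hz
    rw [key, piece_body] at hs
    exact H i j s hs
  · intro H i j s hs
    refine H _ s (D.blk_cell_iff.2 ⟨i, j, rfl⟩) ?_
    rw [key, piece_body]; exact hs

theorem rep_spec {γ : Assembly} {p : ℤ × ℤ} {t : TileType}
    (h : D.rep (γ.block D.size p) = some t) :
    t ∈ T ∧ ∀ z s, blk D.k (cell z) = p → D.piece (body p) t z = some s → γ z = some s := by
  unfold rep at h
  split_ifs at h with h1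
  obtain ⟨h2, h3⟩ := h1.choose_spec
  simp only [Option.some.injEq] at h
  rw [h] at h2 h3
  exact ⟨h2, D.contains_iff.1 h3⟩

theorem rep_mem {b : Block D.size} {t : TileType} (h : D.rep b = some t) : t ∈ T := by
  unfold rep at h
  split_ifs at h with h1
  simp only [Option.some.injEq] at h
  exact h ▸ h1.choose_spec.1

theorem exists_rep {γ : Assembly} {p : ℤ × ℤ} {t : TileType} (ht : t ∈ T)
    (h : ∀ z s, blk D.k (cell z) = p → D.piece (body p) t z = some s → γ z = some s) :
    ∃ t', D.rep (γ.block D.size p) = some t' := by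
  have h1 : ∃ t ∈ T, ∀ (i j : Fin D.size) (s : TileType),
      D.piece (body 0) t (((i : ℕ) : ℤ), ((j : ℕ) : ℤ)) = some s →
        γ.block D.size p i j = some s := ⟨t, ht, D.contains_iff.2 h⟩
  unfold rep
  rw [dif_pos h1]
  exact ⟨_, rfl⟩

theorem exists_act (t : TileType) : ∃ j, j ∈ D.act false false 0 true t := by
  obtain ⟨j, hj⟩ := D.W.S_nonempty
  exact ⟨j, by rw [act, str, if_neg (by norm_num)]; exact hj⟩

/-- The tile that marks the position of a macrotile. -/
theorem exists_marker (p : ℤ × ℤ) {t : TileType} {j : ℕ} (hj : j ∈ D.act false false 0 true t) :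
    ∃ s, D.piece (body p) t (D.labPos p false false 0 j true) = some s ∧
      s.glue (sideDir true) = labGlue D.W (false, false, 0, j) := by
  refine D.exists_labPos (by norm_num) rfl hj fun h => ?_
  rw [mem_dom_piece, D.owns_labPos (by norm_num) (D.lt_of_mem_act' hj)] at h
  simp [body, whoAt, part, nbr] at h

/-- The upper left tile of a cell of a tooth. -/
def toothPos (p : ℤ × ℤ) (n : ℕ) : ℤ × ℤ :=
  (2 * (combCell D.k p false false 0 n 0).1, 2 * (combCell D.k p false false 0 n 0).2 + 1)

theorem cell_toothPos (p : ℤ × ℤ) (n : ℕ) :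
    cell (D.toothPos p n) = combCell D.k p false false 0 n 0 ∧
      cell (D.toothPos p n + Dir.vec .north) = combCell D.k p false false 0 n 1 := by
  have h : (combCell D.k p false false 0 n 1).1 = (combCell D.k p false false 0 n 0).1 ∧
    (combCell D.k p false false 0 n 1).2 = (combCell D.k p false false 0 n 0).2 + 1 := by
    simp [combCell, rowPos]
  constructor
  · refine Prod.ext ?_ ?_ <;> simp only [cell, toothPos] <;> omega
  · refine Prod.ext ?_ ?_ <;> simp only [cell, toothPos, Dir.vec, Prod.fst_add, Prod.snd_add] <;>
      omega

theorem owns_tooth {i : Id} {t : TileType} {p : ℤ × ℤ} {n : ℕ} (hn : n < D.k * D.k) :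
    D.toothPos p n ∈ (D.piece i t).dom ↔ i = body p := by
  obtain ⟨h1, h2⟩ := loc_combCell p false false (c := 0) (by norm_num) hn (κ := 0) (by norm_num)
  rw [mem_dom_piece, (D.cell_toothPos p n).1, owns, h1, h2]
  simp [ownsAt, whoAt, part, body]

theorem owns_bit {t : TileType} {p : ℤ × ℤ} {n : ℕ} (hn : n < D.k * D.k) :
    D.toothPos p n + Dir.vec .north ∈ (D.piece (body p) t).dom ↔ D.key t n = true := by
  obtain ⟨h1, h2⟩ := loc_combCell p false false (c := 0) (by norm_num) hn (κ := 1) (by norm_num)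
  rw [mem_dom_piece, (D.cell_toothPos p n).2, owns, h1, h2]
  simp [ownsAt, whoAt, part, body, face]

theorem blk_toothPos {p : ℤ × ℤ} {n : ℕ} (hn : n < D.k * D.k) :
    blk D.k (cell (D.toothPos p n)) = p := by
  rw [(D.cell_toothPos p n).1]
  exact (loc_combCell p false false (c := 0) (by norm_num) hn (κ := 0) (by norm_num)).2

theorem toothPos_add (p v : ℤ × ℤ) (n : ℕ) :
    D.toothPos (p + v) n = D.toothPos p n + D.scale v := by
  simp only [toothPos, combCell_add, scale, Prod.fst_add, Prod.snd_add, Prod.mk_add_mk,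
    Prod.mk.injEq]
  constructor <;> ring

variable {D}

/-- The marker label of the macrotile is found in the configuration, which fixes the translation and
shows that a macrotile `x` is there. Each bit 1 of `t` makes the tile below the bit cell carry an
internal glue, which in turn forces the bit of `x.2` to be 1. As no key contains another, the types
agree. -/
theorem of_rep {C : Config} (hC : D.Disj C) (hT : ∀ x ∈ C, x.2 ∈ T) {u p : ℤ × ℤ} {t : TileType}
    (H : D.rep ((shift u (D.asm C)).block D.size p) = some t) :
    ∃ v, u = D.scale v ∧ (body (p - v), t) ∈ C := by
  obtain ⟨ht, H⟩ := D.rep_spec H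
  obtain ⟨j, hj⟩ := D.exists_act t
  obtain ⟨s, hs, hg⟩ := D.exists_marker p hj
  have h1 := H _ s (D.loc_labPos p false false true (by norm_num) (D.lt_of_mem_act' hj)).2 hs
  have h1' : D.asm C (D.labPos p false false 0 j true - u) = some s := h1
  obtain ⟨x, hx, hxs⟩ := (asm_eq_some hC).1 h1'
  obtain ⟨q, sd, hsd, hxq, -, hz⟩ := D.glue_lab (by norm_num) hxs hg
  obtain rfl := sideDir_injective hsd
  have hu : u = D.scale (p - q) := by
    have : D.labPos q false false 0 j true + u = D.labPos p false false 0 j true + 0 := by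
      rw [← hz, add_zero, sub_add_cancel]
    have := labPos_injective this
    rw [← neg_sub q p, scale_neg]
    exact eq_neg_of_add_eq_zero_left this.symm
  refine ⟨p - q, hu, ?_⟩
  rw [sub_sub_cancel]
  have hxb : x.1 = body q := hxq
  have : t = x.2 := by
    refine D.key_anti t ht _ (hT x hx) fun n hn hk => ?_
    obtain ⟨s', hs'⟩ := mem_dom.1 ((D.owns_tooth (t := t) (p := p) hn).2 rfl)
    have h2 := H _ s' (D.blk_toothPos hn) hs'
    have hp : D.toothPos p n - u = D.toothPos q n := by
      have := D.toothPos_add q (p - q) n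
      rw [add_sub_cancel] at this
      rw [this, hu, add_sub_cancel_right]
    have h2' : D.asm C (D.toothPos p n - u) = some s' := h2
    rw [hp] at h2'
    obtain ⟨y, hy, hys⟩ := (asm_eq_some hC).1 h2'
    have hyb := (D.owns_tooth hn).1 (mem_dom_of hys)
    have hyx : y.2 = x.2 := hC.eq_of_id (i := body q) (by rw [← hyb]; exact hy)
      (by rw [← hxb]; exact hx)
    -- The bit cell above belongs to the macrotile, so the two tiles are joined internally. The part
    -- of the block that is compared need not contain more than this tile.
    have hint : s'.glue .north = intGlue τ := by
      obtain ⟨b, hb, rfl⟩ := D.eq_mkTile_of_piece hs'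
      rw [mkTile_glue]
      exact (sideGlue_eq_int D.W).2 ((hb _).2 ((D.owns_bit hn).2 hk))
    have := D.glue_int hys hint
    rw [hyb, hyx] at this
    exact (D.owns_bit hn).1 this
  rw [this, ← hxb]
  exact hx

theorem rep_asm {C : Config} (hC : D.Valid C) (v : ℤ × ℤ) :
    repAssembly D.rep (shift (D.scale v) (D.asm C)) = shift v (tileAsm C) := by
  funext p
  refine Option.ext fun t => ?_
  change D.rep _ = some t ↔ tileAsm C (p - v) = some t
  rw [tileAsm_eq_some hC.disj]
  have key : ∀ t, D.rep ((shift (D.scale v) (D.asm C)).block D.size p) = some t →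
      (body (p - v), t) ∈ C := by
    intro t h
    obtain ⟨v', hv, h'⟩ := of_rep hC.disj hC.tiles h
    rwa [scale_injective hv]
  refine ⟨key t, fun h => ?_⟩
  obtain ⟨t', ht'⟩ := D.exists_rep (γ := shift (D.scale v) (D.asm C)) (p := p) (hC.tiles _ h)
    fun z s _ hs => by
      change D.asm C (z - D.scale v) = some s
      refine piece_sub_asm hC.disj h _ _ ?_
      have := D.piece_add (body (p - v)) t v
      rw [show ((body (p - v)).1 + v, (body (p - v)).2) = body p by simp [body]] at this
      rw [this] at hs
      exact hs
  rw [ht', hC.disj.eq_of_id h (key t' ht')]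

/-- By `of_rep`, a translate that is not aligned with the blocks has empty image, and an aligned one
represents the corresponding translate of `tileAsm C`. -/
theorem represents_asm {C : Config} (hC : D.Valid C) (hne : (tileAsm C).dom.Nonempty) :
    Represents D.rep (Supertile.of (D.asm C)) (Supertile.of (tileAsm C)) := by
  ext β
  constructor
  · rintro ⟨⟨p, hp⟩, α, hα, rfl⟩
    obtain ⟨u, rfl⟩ := Supertile.of_eq_iff.1 hα.symm
    obtain ⟨t, ht⟩ := mem_dom.1 hp
    obtain ⟨v, rfl, -⟩ := of_rep hC.disj hC.tiles ht
    rw [rep_asm hC]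
    exact Supertile.of_shift _ _
  · intro h
    obtain ⟨v, rfl⟩ := Supertile.of_eq_iff.1 (show Supertile.of β = _ from h).symm
    refine ⟨?_, shift (D.scale v) (D.asm C), Supertile.of_shift _ _, rep_asm hC v⟩
    obtain ⟨p, hp⟩ := hne
    exact ⟨p + v, by rw [mem_dom_shift, add_sub_cancel_right]; exact hp⟩

theorem exists_whoAt_of_owns {i : Id} {t : TileType} {z : ℤ × ℤ} (h : D.owns i t z) :
    ∃ w, i = whoAt (blk D.k z) w := by
  unfold owns at h
  rcases hl : loc D.k z with _ | w | ⟨o, h', c, j, κ⟩ <;> rw [hl] at h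
  · exact h.elim
  · exact ⟨w, h⟩
  · simp only [ownsAt] at h
    split_ifs at h
    · rcases h with h | h <;> exact ⟨_, h.1⟩
    · exact ⟨_, h⟩
    · exact ⟨_, h⟩

/-- A block with a tile contains a cell of some piece, and the home of that piece is this block or
an adjacent one. The macrotile at the home is present because pads are docked. -/
theorem clean_asm {C : Config} (hC : D.Valid C) : CleanSupertile D.rep (Supertile.of (D.asm C)) := by
  have key : ∀ v, MapsCleanly D.size (shift (D.scale v) (D.asm C))
      (repAssembly D.rep (shift (D.scale v) (D.asm C))) := by
    intro v
    refine Or.inl fun p hp => ?_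
    obtain ⟨z, hz, hzp⟩ := D.hasTile_iff.1 hp
    rw [rep_asm hC]
    rw [mem_dom_shift, mem_dom_asm] at hz
    obtain ⟨x, hx, hxz⟩ := hz
    rw [mem_dom_piece] at hxz
    obtain ⟨w, hw⟩ := exists_whoAt_of_owns hxz
    have hb : blk D.k (cell (z - D.scale v)) = p - v := by
      have := D.blk_cell_add (z - D.scale v) v
      rw [sub_add_cancel, hzp] at this
      exact eq_sub_of_add_eq this.symm
    rw [hb] at hw
    have hd := hC.mem_dom hx
    rw [hw] at hd
    rcases home_whoAt (p - v) w with h | ⟨d, h⟩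
    · left; rw [h] at hd; exact hd
    · right
      refine ⟨d, ?_⟩
      rw [h] at hd
      rw [mem_dom_shift, add_sub_right_comm]
      exact hd
  constructor
  · rintro α hα ⟨p, hp⟩
    obtain ⟨u, rfl⟩ := Supertile.of_eq_iff.1 hα.symm
    obtain ⟨t, ht⟩ := mem_dom.1 hp
    obtain ⟨v, rfl, -⟩ := of_rep hC.disj hC.tiles ht
    exact key v
  · exact ⟨_, Supertile.of_shift (D.scale 0) _, key 0⟩

/-- Supertiles that represent nothing: single tiles and single pads. -/
def Inert (D : Design T τ) (A : Supertile) : Prop :=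
  A ∈ singletons (univTiles D.W) ∨
    ∃ q o h s, ∃ t ∈ T, A = Supertile.of (D.piece (q, some (o, h, s)) t)

/-- A represented tile requires a marker tile and a tooth tile at two different positions, which one
tile cannot supply. A single pad contains no macrotile. -/
theorem Inert.rep_eq {A : Supertile} (hA : D.Inert A) {α : Assembly} (hα : Supertile.of α = A)
    (p : ℤ × ℤ) : repAssembly D.rep α p = none := by
  rw [Option.eq_none_iff_forall_ne_some]
  intro t ht
  rcases hA with ⟨t', -, rfl⟩ | ⟨q, o, h, s, t', ht', rfl⟩
  · obtain ⟨u, rfl⟩ := Supertile.of_eq_iff.1 hα.symm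
    obtain ⟨-, H⟩ := D.rep_spec ht
    obtain ⟨j, hj⟩ := D.exists_act t
    have hjk := D.lt_of_mem_act' hj
    obtain ⟨s, hs, -⟩ := D.exists_marker p hj
    obtain ⟨s', hs'⟩ := mem_dom.1 ((D.owns_tooth (t := t) (p := p) hjk).2 rfl)
    obtain ⟨l1, l2⟩ := D.loc_labPos p false false true (c := 0) (by norm_num) hjk
    have e1 := (single_apply_ne_none (H _ _ l2 hs)).1
    have e2 := (single_apply_ne_none (H _ _ (D.blk_toothPos hjk) hs')).1
    have l3 := (loc_combCell p false false (c := 0) (by norm_num) hjk (κ := 0) (by norm_num)).1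
    rw [← (D.cell_toothPos p j).1, e2, ← e1, l1] at l3
    simp at l3
  · rw [← asm_singleton ((q, some (o, h, s)), t')] at hα
    obtain ⟨u, rfl⟩ := Supertile.of_eq_iff.1 hα.symm
    obtain ⟨v, -, hv⟩ := of_rep (disj_singleton _) (by rintro x rfl; exact ht') ht
    simp [body] at hv

theorem Inert.blank {A : Supertile} (hA : D.Inert A) : Blank D.rep A := by
  refine Set.eq_empty_iff_forall_notMem.2 ?_
  rintro β ⟨⟨p, hp⟩, α, hα, rfl⟩
  exact hp (hA.rep_eq hα p)

theorem Inert.clean {A : Supertile} (hA : D.Inert A) : CleanSupertile D.rep A := by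
  refine ⟨fun α hα ⟨p, hp⟩ => absurd (hA.rep_eq hα p) hp, ?_⟩
  have key : ∀ α : Assembly, (∃ p, ∀ z ∈ α.dom, blk D.k (cell z) = p) →
      MapsCleanly D.size α (repAssembly D.rep α) := by
    rintro α ⟨p, hp⟩
    refine Or.inr fun q q' h h' => ?_
    obtain ⟨z, hz, rfl⟩ := D.hasTile_iff.1 h
    obtain ⟨z', hz', rfl⟩ := D.hasTile_iff.1 h'
    rw [hp z hz, hp z' hz']
  rcases hA with ⟨t, -, rfl⟩ | ⟨q, o, h, s, t, -, rfl⟩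
  · refine ⟨_, rfl, key _ ⟨blk D.k (cell 0), fun z hz => ?_⟩⟩
    obtain ⟨s, hs⟩ := mem_dom.1 hz
    rw [← shift_zero (single t)] at hs
    rw [(single_apply_ne_none hs).1]
  · refine ⟨_, rfl, key _ ⟨q, fun z hz => ?_⟩⟩
    rw [mem_dom_piece] at hz
    obtain ⟨w, hw⟩ := exists_whoAt_of_owns hz
    rcases w with _ | o | ⟨o, h, s⟩ <;> simp only [whoAt, Prod.mk.injEq, reduceCtorEq,
      and_false] at hw
    exact hw.1.symm

end Design

end TwoHAM

namespace TwoHAM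
open Assembly

theorem exists_seq_of_step {α : Type*} {P : ℕ → α → Prop} {r : α → α → Prop} {x : α} (h0 : P 0 x)
    (h : ∀ n x, P n x → ∃ y, P (n + 1) y ∧ r x y) :
    ∃ f : ℕ → α, (∀ n, P n (f n)) ∧ ∀ n, r (f n) (f (n + 1)) := by
  choose! g hg using h
  let f : ℕ → α := fun n => Nat.rec x g n
  have hf : ∀ n, P n (f n) := fun n => by
    induction n with
    | zero => exact h0
    | succ n ih => exact (hg n _ ih).1
  exact ⟨f, hf, fun n => (hg n _ (hf n)).2⟩

theorem eq_of_subs {c : ℕ → Assembly} {a b : Assembly} (ha : ∀ i, (c i).Sub a)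
    (hb : ∀ i, (c i).Sub b) (da : a.dom = ⋃ i, (c i).dom) (db : b.dom = ⋃ i, (c i).dom) :
    a = b := by
  refine ext_of_sub (fun p t hp => ?_) (by rw [da, db])
  have := mem_dom_of hp
  rw [da, Set.mem_iUnion] at this
  obtain ⟨i, hi⟩ := this
  obtain ⟨s, hs⟩ := mem_dom.1 hi
  rw [ha i _ _ hs] at hp
  rw [← hp]
  exact hb i _ _ hs

theorem IsSeq.drop {P : Set Supertile} {τ : ℕ} {c : ℕ → Assembly} {b : Assembly}
    (h : IsSeq (AttachStar P τ) c b) (N : ℕ) : IsSeq (AttachStar P τ) (fun n => c (N + n)) b := by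
  refine ⟨fun i => h.step _, fun i => h.sub _,
    Set.Subset.antisymm ?_ (Set.iUnion_subset fun i => (h.sub _).dom_subset)⟩
  rw [h.dom]
  exact Set.iUnion_subset fun i => Set.subset_iUnion_of_subset i
    (h.star_le (show i ≤ N + i by omega)).sub.dom_subset

theorem TAS.producible_of_star {𝒯 : TAS} {α β : Assembly}
    (h : AttachStar 𝒯.producible 𝒯.temp α β) (hα : Supertile.of α ∈ 𝒯.producible) :
    Supertile.of β ∈ 𝒯.producible := by
  induction h with
  | refl => exact hα
  | tail _ h ih =>
    obtain ⟨δ, hδ, hd, hs, rfl⟩ := h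
    exact producible_combine ih hδ ⟨_, _, rfl, rfl, hd, hs, rfl⟩

namespace Design

variable {T : Finset TileType} {τ : ℕ} {D : Design T τ}

/-! ### Increasing unions of configurations -/

section

variable {c : ℕ → Config} (hc : ∀ n, D.Valid (c n)) (hm : Monotone c)

include hc hm

theorem valid_iUnion : D.Valid (⋃ n, c n) := by
  refine ⟨fun x hx y hy hne => ?_, fun x hx => ?_, fun x hx => ?_⟩
  · obtain ⟨i, hi⟩ := Set.mem_iUnion.1 hx
    obtain ⟨j, hj⟩ := Set.mem_iUnion.1 hy
    exact (hc (max i j)).disj x (hm (le_max_left _ _) hi) y (hm (le_max_right _ _) hj) hne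
  · obtain ⟨i, hi⟩ := Set.mem_iUnion.1 hx
    exact (hc i).tiles x hi
  · obtain ⟨i, hi⟩ := Set.mem_iUnion.1 hx
    exact Set.mem_iUnion.2 ⟨i, (hc i).docked x hi⟩

theorem asm_iUnion : (∀ n, (D.asm (c n)).Sub (D.asm (⋃ n, c n))) ∧
    (D.asm (⋃ n, c n)).dom = ⋃ n, (D.asm (c n)).dom := by
  refine ⟨fun n => asm_mono (valid_iUnion hc hm).disj (Set.subset_iUnion c n), ?_⟩
  ext z
  simp only [Set.mem_iUnion, mem_dom_asm]
  constructor
  · rintro ⟨x, ⟨n, hn⟩, hz⟩; exact ⟨n, x, hn, hz⟩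
  · rintro ⟨n, x, hn, hz⟩; exact ⟨x, ⟨n, hn⟩, hz⟩

theorem tileAsm_iUnion : (∀ n, (tileAsm (c n)).Sub (tileAsm (⋃ n, c n))) ∧
    (tileAsm (⋃ n, c n)).dom = ⋃ n, (tileAsm (c n)).dom := by
  have hV := valid_iUnion hc hm
  constructor
  · intro n p t h
    rw [tileAsm_eq_some (hc n).disj] at h
    exact (tileAsm_eq_some hV.disj).2 (Set.mem_iUnion.2 ⟨n, h⟩)
  · ext p
    simp only [Set.mem_iUnion, mem_dom, tileAsm_eq_some hV.disj]
    exact ⟨fun ⟨t, n, h⟩ => ⟨n, t, (tileAsm_eq_some (hc n).disj).2 h⟩,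
      fun ⟨n, t, h⟩ => ⟨t, n, (tileAsm_eq_some (hc n).disj).1 h⟩⟩

theorem internal_iUnion (hi : ∀ n, Internal (c n)) : Internal (⋃ n, c n) := by
  intro p d h t hp
  obtain ⟨n, hn⟩ := Set.mem_iUnion.1 hp
  exact ((tileAsm_iUnion hc hm).1 n).dom_subset (hi n _ _ _ _ hn)

end

theorem Internal.move {C : Config} (hC : D.Valid C) (hi : Internal C) (v : ℤ × ℤ) :
    Internal (move v C) := by
  intro p d h t hp
  rw [tileAsm_move hC.disj, mem_dom_shift, add_sub_right_comm]
  refine hi (p - v) d h t ?_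
  have : padId (p - v) d h = ((padId p d h).1 - v, (padId p d h).2) := by
    cases d <;> simp [padId, slotBlk, slotOf, sub_add_eq_add_sub]
  rw [this]
  exact hp

theorem tileAsm_mono {C C' : Config} (h : D.Disj C') (hs : C ⊆ C') :
    (tileAsm C).Sub (tileAsm C') := fun _ _ hp =>
  (tileAsm_eq_some h).2 (hs ((tileAsm_eq_some (h.mono hs)).1 hp))

/-! ### Attachments -/

/-- Macrotile and pad show their keys to each other in the comb of the dock, so the absence of
overlap forces equal types. -/
theorem dock_fit {p : ℤ × ℤ} {d : Dir} {h : Bool} {t t' : TileType} (ht : t ∈ T) (ht' : t' ∈ T)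
    (hd : Disjoint (D.piece (body p) t).dom (D.piece (padId p d h) t').dom) : t = t' := by
  cases hs : (slotOf d).2
  · have hB : Below (slotBlk p d) (slotOf d).1 h 2 (padId p d h) (body p) := by
      refine ⟨by norm_num, ?_, ?_⟩ <;> cases d <;>
        simp_all [slotOf, padId, whoAt, part, body, slotBlk, oDir, Dir.vec, add_unit_cancel]
    exact ((D.fit_of_disjoint hB ht' ht hd.symm).1 (by norm_num)).symm
  · have hB : Below (slotBlk p d) (slotOf d).1 h 0 (body p) (padId p d h) := by
      refine ⟨by norm_num, ?_, ?_⟩ <;> cases d <;>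
        simp_all [slotOf, padId, whoAt, part, body, slotBlk]
    exact (D.fit_of_disjoint hB ht ht' hd).1 (by norm_num)

/-- Supertiles of valid configurations that represent supertiles in `Q`. -/
def Macro (D : Design T τ) (Q : Set Supertile) (A : Supertile) : Prop :=
  ∃ C, D.Valid C ∧ Supertile.of (tileAsm C) ∈ Q ∧ A = Supertile.of (D.asm C)

/-- Single tiles do not bind. A pad binds only to its own macrotile and leaves the represented
assembly unchanged. Another configuration is aligned with `C`, and the represented assemblies are
bound at least as strongly, which is a genuine attachment. -/
theorem exists_of_joint {C : Config} (hC : D.Valid C) {u : ℤ × ℤ} {δ : Assembly}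
    {Q : Set Supertile} (hδ : D.Inert (Supertile.of δ) ∨ D.Macro Q (Supertile.of δ))
    (hd : Disjoint (shift u (D.asm C)).dom δ.dom) (H : Joint τ (shift u (D.asm C)) δ) :
    ∃ C', D.Valid C' ∧ C ⊆ C' ∧ (shift u (D.asm C)).union δ = shift u (D.asm C') ∧
      (tileAsm C' = tileAsm C ∨ ∃ β, Supertile.of β ∈ Q ∧ Disjoint (tileAsm C).dom β.dom ∧
        Joint τ (tileAsm C) β ∧ tileAsm C' = (tileAsm C).union β) := by
  have aligned : ∀ C₂, D.Disj C₂ → Supertile.of δ = Supertile.of (D.asm C₂) →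
      ∃ w, δ = shift u (D.asm (move w C₂)) ∧
        Disjoint (D.asm C).dom (D.asm (move w C₂)).dom ∧
        Joint τ (D.asm C) (D.asm (move w C₂)) := by
    intro C₂ h2 he
    obtain ⟨v, rfl⟩ := Supertile.of_eq_iff.1 he.symm
    obtain ⟨w, rfl⟩ := aligned_of_joint hC.disj h2 hd H
    have e : shift (u + D.scale w) (D.asm C₂) = shift u (D.asm (move w C₂)) := by
      rw [asm_move h2, shift_shift]
    rw [e] at hd H
    refine ⟨w, e, ?_, ?_⟩
    · simpa using disjoint_shift (u := -u) hd
    · simpa using H.shift (-u)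
  rcases hδ with (⟨t, ht, he⟩ | ⟨q, o, h, s, t, ht, he⟩) | ⟨C₂, hV, hQ, he⟩
  · obtain ⟨v, rfl⟩ := Supertile.of_eq_iff.1 he.symm
    exact absurd H.symm (not_joint_single_asm hC.disj ht v u hd.symm)
  · rw [← asm_singleton ((q, some (o, h, s)), t)] at he
    obtain ⟨w, rfl, hd', H'⟩ := aligned _ (disj_singleton _) he
    set x : Id × TileType := ((q + w, some (o, h, s)), t) with hx
    have hmv : move w {((q, some (o, h, s)), t)} = {x} := by
      ext ⟨⟨a, b⟩, c⟩
      change ((a - w, b), c) = ((q, some (o, h, s)), t) ↔ ((a, b), c) = x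
      simp only [hx, Prod.mk.injEq, sub_eq_iff_eq_add]
    rw [hmv] at hd' H' ⊢
    have hdp := hd'
    have hJp := H'
    rw [asm_singleton] at hdp hJp
    obtain ⟨t', ht'⟩ := exists_body_of_joint_pad hC.disj hdp hJp
    obtain ⟨d, hpad⟩ := exists_padId (q + w) o h s
    have htt : t' = t := by
      refine dock_fit (D := D) (hC.tiles _ ht') ht (p := home x.1) (d := d) (h := h) ?_
      rw [← hpad]
      exact Set.disjoint_of_subset_left (piece_sub_asm hC.disj ht').dom_subset hdp
    subst htt
    have hD : D.Disj (C ∪ {x}) := hC.disj.union (disj_singleton x) hd'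
    refine ⟨C ∪ {x}, ⟨hD, ?_, ?_⟩, Set.subset_union_left, ?_, Or.inl ?_⟩
    · rintro y (hy | rfl)
      exacts [hC.tiles y hy, ht]
    · rintro y (hy | rfl)
      exacts [Or.inl (hC.docked y hy), Or.inl ht']
    · rw [asm_union hD]; rfl
    · refine tileAsm_ext hD fun p s' => ?_
      rw [tileAsm_eq_some hC.disj]
      refine ⟨fun hp => hp.resolve_right fun he => ?_, Or.inl⟩
      simp [body, hx] at he
  · obtain ⟨w, rfl, hd', H'⟩ := aligned C₂ hV.disj he
    have hV' := hV.move w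
    have hD := hC.disj.union hV'.disj hd'
    refine ⟨C ∪ move w C₂, ⟨hD, ?_, ?_⟩, Set.subset_union_left, ?_,
      Or.inr ⟨tileAsm (move w C₂), ?_, tileAsm_disjoint hC.disj hV'.disj hd',
        joint_tileAsm hC hV' hd' H', tileAsm_union hD⟩⟩
    · rintro y (hy | hy)
      exacts [hC.tiles y hy, hV'.tiles y hy]
    · rintro y (hy | hy)
      exacts [Or.inl (hC.docked y hy), Or.inr (hV'.docked y hy)]
    · rw [asm_union hD]; rfl
    · rw [tileAsm_move hV.disj, Supertile.of_shift]; exact hQ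

/-- For two pads, binding would require the macrotile of one of them to be present. -/
theorem Inert.not_joint {α β : Assembly} (hα : D.Inert (Supertile.of α))
    (hβ : D.Inert (Supertile.of β)) (hd : Disjoint α.dom β.dom) : ¬ Joint τ α β := by
  rcases hα with ⟨t, ht, he⟩ | ⟨q, o, h, s, t, ht, he⟩ <;>
    rcases hβ with ⟨t', ht', he'⟩ | ⟨q', o', h', s', t', ht', he'⟩
  · obtain ⟨u, rfl⟩ := Supertile.of_eq_iff.1 he.symm
    obtain ⟨v, rfl⟩ := Supertile.of_eq_iff.1 he'.symm
    exact not_joint_single_single ht u v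
  · rw [← asm_singleton ((q', some (o', h', s')), t')] at he'
    obtain ⟨u, rfl⟩ := Supertile.of_eq_iff.1 he.symm
    obtain ⟨v, rfl⟩ := Supertile.of_eq_iff.1 he'.symm
    exact not_joint_single_asm (disj_singleton _) ht u v hd
  · rw [← asm_singleton ((q, some (o, h, s)), t)] at he
    obtain ⟨u, rfl⟩ := Supertile.of_eq_iff.1 he.symm
    obtain ⟨v, rfl⟩ := Supertile.of_eq_iff.1 he'.symm
    exact fun H => not_joint_single_asm (disj_singleton _) ht' v u hd.symm H.symm
  · intro H
    rw [← asm_singleton ((q, some (o, h, s)), t)] at he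
    rw [← asm_singleton ((q', some (o', h', s')), t')] at he'
    obtain ⟨u, rfl⟩ := Supertile.of_eq_iff.1 he.symm
    obtain ⟨v, rfl⟩ := Supertile.of_eq_iff.1 he'.symm
    obtain ⟨w, rfl⟩ := aligned_of_joint (disj_singleton _) (disj_singleton _) hd H
    have e : shift (u + D.scale w) (D.asm {((q', some (o', h', s')), t')}) =
        shift u (D.piece (q' + w, some (o', h', s')) t') := by
      rw [asm_singleton, ← shift_shift, ← D.piece_add (q', some (o', h', s')) t' w]
    rw [e] at hd H
    have hd' := disjoint_shift (u := -u) hd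
    have H' := H.shift (-u)
    simp only [shift_neg_shift] at hd' H'
    obtain ⟨t₂, h2⟩ := exists_body_of_joint_pad (disj_singleton _) hd' H'
    simp [body] at h2

/-- At least one operand is a configuration, since inert supertiles do not bind to each other; to it
`exists_of_joint` applies. `Q` stands for a class closed under combination. -/
theorem combine_cases {A B C : Supertile} {Q : Set Supertile}
    (hA : D.Inert A ∨ D.Macro Q A) (hB : D.Inert B ∨ D.Macro Q B)
    (hQ : ∀ β, Supertile.of β ∈ Q → β.Stable τ ∧ β.dom.Nonempty)
    (hQc : ∀ A ∈ Q, ∀ B ∈ Q, ∀ C ∈ combine τ A B, C ∈ Q) (hC : C ∈ combine τ A B) :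
    D.Macro Q C := by
  obtain ⟨α, β, rfl, rfl, hd, hs, rfl⟩ := hC
  have nonempty : ∀ α, (D.Inert (Supertile.of α) ∨ D.Macro Q (Supertile.of α)) →
      α.dom.Nonempty := by
    have sh : ∀ {α : Assembly} (u : ℤ × ℤ), α.dom.Nonempty → (shift u α).dom.Nonempty :=
      fun u ⟨z, hz⟩ => ⟨z + u, by rw [mem_dom_shift, add_sub_cancel_right]; exact hz⟩
    rintro α ((⟨t, -, he⟩ | ⟨q, o, h, s, t, -, he⟩) | ⟨C, hV, hC, he⟩) <;>
      obtain ⟨u, rfl⟩ := Supertile.of_eq_iff.1 he.symm <;> refine sh u ?_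
    · exact ⟨0, by simp [dom, single]⟩
    · exact D.piece_nonempty _ _
    · obtain ⟨p, hp⟩ := (hQ _ hC).2
      obtain ⟨t, ht⟩ := mem_dom.1 hp
      obtain ⟨z, hz⟩ := D.piece_nonempty (body p) t
      exact ⟨z, mem_dom_asm.2 ⟨_, (tileAsm_eq_some hV.disj).1 ht, hz⟩⟩
  have H := hs.joint hd (nonempty α hA) (nonempty β hB)
  have main : ∀ {α β : Assembly}, D.Macro Q (Supertile.of α) →
      (D.Inert (Supertile.of β) ∨ D.Macro Q (Supertile.of β)) → Disjoint α.dom β.dom →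
      Joint τ α β → D.Macro Q (Supertile.of (α.union β)) := by
    rintro α β ⟨C, hV, hQC, he⟩ hβ hd H
    obtain ⟨u, rfl⟩ := Supertile.of_eq_iff.1 he.symm
    obtain ⟨C', hV', -, heq, ht⟩ := exists_of_joint hV hβ hd H
    refine ⟨C', hV', ?_, by rw [heq, Supertile.of_shift]⟩
    rcases ht with ht | ⟨γ, hγ, hdγ, hJ, ht⟩
    · rwa [ht]
    · rw [ht]
      exact hQc _ hQC _ hγ _ ⟨_, _, rfl, rfl, hdγ, (hQ _ hQC).1.union (hQ _ hγ).1 hdγ hJ, rfl⟩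
  rcases hA with hA | hA
  · rcases hB with hB' | hB'
    · exact absurd H (hA.not_joint hB' hd)
    · rw [union_comm hd]
      exact main hB' (Or.inl hA) hd.symm H.symm
  · exact main hA hB hd H

end Design

end TwoHAM

namespace TwoHAM
open Assembly

/-! ### The input supertiles and the simulating system -/

namespace Design

variable {T : Finset TileType} {τ : ℕ} (D : Design T τ)

theorem asm_over {C : Config} (hC : D.Disj C) : (D.asm C).Over (univTiles D.W) := by
  intro z s hs
  obtain ⟨x, -, hx⟩ := (asm_eq_some hC).1 hs
  exact D.piece_over _ _ _ _ hx

theorem asm_nonempty {C : Config} (hC : D.Disj C) (h : (tileAsm C).dom.Nonempty) :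
    (D.asm C).dom.Nonempty := by
  obtain ⟨p, hp⟩ := h
  obtain ⟨t, ht⟩ := mem_dom.1 hp
  obtain ⟨z, hz⟩ := D.piece_nonempty (body p) t
  exact ⟨z, mem_dom_asm.2 ⟨_, (tileAsm_eq_some hC).1 ht, hz⟩⟩

/-- The supertiles of the pads. -/
def pads : Set Supertile :=
  {A | ∃ o h s, ∃ t ∈ T, A = Supertile.of (D.piece (0, some (o, h, s)) t)}

/-- The input supertiles of the simulation. -/
noncomputable def inputs (σ : Set Supertile) : Set Supertile :=
  (fun A => Supertile.of (D.asm (canon (Quotient.out A)))) '' σ ∪ D.pads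

theorem encard_pads : D.pads.encard ≤ 8 * T.card := by
  have : D.pads ⊆ ((((Finset.univ : Finset (Bool × Bool × Bool)) ×ˢ T : Finset _) : Set _).image
      fun y : (Bool × Bool × Bool) × TileType =>
        Supertile.of (D.piece (0, some y.1) y.2)) := by
    rintro A ⟨o, h, s, t, ht, rfl⟩
    exact ⟨((o, h, s), t), by simpa using ht, rfl⟩
  refine (Set.encard_le_encard this).trans ((Set.encard_image_le _ _).trans ?_)
  rw [Set.encard_coe_eq_coe_finsetCard, Finset.card_product]
  simp

theorem encard_inputs (σ : Set Supertile) : (D.inputs σ).encard ≤ 8 * (T.card + σ.encard) := by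
  refine (Set.encard_union_le _ _).trans ?_
  rw [mul_add, add_comm]
  refine add_le_add D.encard_pads ((Set.encard_image_le _ _).trans ?_)
  calc σ.encard = 1 * σ.encard := (one_mul _).symm
    _ ≤ 8 * σ.encard := by gcongr; norm_num

/-- Supertiles are taken up to translation, so the pads of block 0 account for all pads. -/
theorem pad_mem (p : ℤ × ℤ) (d : Dir) (h : Bool) {t : TileType} (ht : t ∈ T) :
    Supertile.of (D.piece (padId p d h) t) ∈ D.pads := by
  refine ⟨(slotOf d).1, h, !(slotOf d).2, t, ht, ?_⟩
  have := D.piece_add (0, some ((slotOf d).1, h, !(slotOf d).2)) t (slotBlk p d)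
  rw [zero_add] at this
  change Supertile.of (D.piece (slotBlk p d, _) t) = _
  rw [this, Supertile.of_shift]

end Design

open Design

section

variable {𝒯 : TAS} (D : Design 𝒯.tiles 𝒯.temp)

theorem of_out (A : Supertile) : Supertile.of (Quotient.out A) = A := Quotient.out_eq A

theorem init_out {A : Supertile} (hA : A ∈ 𝒯.init) : (Quotient.out A : Assembly).Over 𝒯.tiles ∧
    (Quotient.out A : Assembly).dom.Nonempty ∧ (Quotient.out A : Assembly).Stable 𝒯.temp := by
  have h := of_out A ▸ hA
  exact ⟨𝒯.init_over _ h, 𝒯.init_nonempty _ h, 𝒯.init_stable _ h⟩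

theorem exists_good_of_init {α : Assembly}
    (h : Supertile.of α ∈ singletons (univTiles D.W) ∪ D.inputs 𝒯.init) :
    ∃ γ u, α = shift u γ ∧ γ.Over (univTiles D.W) ∧ γ.dom.Nonempty ∧ γ.Stable 𝒯.temp := by
  rcases h with ⟨t, ht, he⟩ | ⟨A, hA, he⟩ | ⟨o, h, s, t, ht, he⟩
  · obtain ⟨u, hu⟩ := Supertile.of_eq_iff.1 he.symm
    refine ⟨_, u, hu.symm, fun p s hs => ?_, ⟨0, by simp [dom, single]⟩, single_stable _ _⟩
    rw [← shift_zero (single t)] at hs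
    rw [(single_apply_ne_none hs).2]; exact ht
  · obtain ⟨u, hu⟩ := Supertile.of_eq_iff.1 he
    obtain ⟨h1, h2, h3⟩ := init_out hA
    have hV := canon_valid D h1
    exact ⟨_, u, hu.symm, D.asm_over hV.disj,
      D.asm_nonempty hV.disj (by rwa [tileAsm_canon D h1]), canon_stable D h1 h3⟩
  · obtain ⟨u, hu⟩ := Supertile.of_eq_iff.1 he.symm
    exact ⟨_, u, hu.symm, D.piece_over _ _, D.piece_nonempty _ _, D.piece_stable _ _⟩

/-- The system that simulates `𝒯`. -/
noncomputable def simulator : TAS where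
  tiles := univTiles D.W
  init := singletons (univTiles D.W) ∪ D.inputs 𝒯.init
  temp := 𝒯.temp
  init_over α h := by
    obtain ⟨γ, u, rfl, h1, -, -⟩ := exists_good_of_init D h
    exact h1.shift u
  init_nonempty α h := by
    obtain ⟨γ, u, rfl, -, ⟨z, hz⟩, -⟩ := exists_good_of_init D h
    exact ⟨z + u, by rw [mem_dom_shift, add_sub_cancel_right]; exact hz⟩
  init_stable α h := by
    obtain ⟨γ, u, rfl, -, -, h1⟩ := exists_good_of_init D h
    exact h1.shift u

theorem reached_pad (p : ℤ × ℤ) (d : Dir) (h : Bool) {t : TileType} (ht : t ∈ 𝒯.tiles) :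
    (simulator D).Reached (Supertile.of (D.piece (padId p d h) t)) :=
  .init (Or.inr (Or.inr (D.pad_mem p d h ht)))

/-! ### Everything that is produced represents something producible -/

theorem reached_cases {A : Supertile} (h : (simulator D).Reached A) :
    D.Inert A ∨ D.Macro {B | 𝒯.Reached B} A := by
  induction h with
  | init h =>
    rcases h with h | ⟨A, hA, rfl⟩ | ⟨o, h, s, t, ht, rfl⟩
    · exact Or.inl (Or.inl h)
    · obtain ⟨h1, h2, h3⟩ := init_out hA
      refine Or.inr ⟨_, canon_valid D h1, ?_, rfl⟩
      rw [tileAsm_canon D h1]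
      exact (congrArg 𝒯.Reached (of_out A)).mpr (.init hA)
    · exact Or.inl (Or.inr ⟨_, _, _, _, t, ht, rfl⟩)
  | combine _ _ hC ihA ihB =>
    exact Or.inr (combine_cases ihA ihB (fun β hβ => ⟨(hβ.stable _ rfl).1, (hβ.stable _ rfl).2.1⟩)
      (fun A hA B hB C hC => .combine hA hB hC) hC)

/-- Once a stage of the sequence is a configuration, all later stages are described by an increasing
sequence of configurations with one common translation, and their union describes the result. -/
theorem producible_cases {A : Supertile} (h : A ∈ (simulator D).producible) :
    D.Inert A ∨ D.Macro 𝒯.producible A := by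
  obtain ⟨b, rfl⟩ := A.exists_of
  obtain ⟨c, hc, h0⟩ := TAS.exists_seq_of_producible h
  have hr := TAS.seq_reached hc.star (.init h0)
  by_cases hN : ∃ N, D.Macro {B | 𝒯.Reached B} (Supertile.of (c N))
  · right
    obtain ⟨N, C₀, hV₀, hR₀, he⟩ := hN
    obtain ⟨u, hu⟩ := Supertile.of_eq_iff.1 he.symm
    obtain ⟨f, hf, hfs⟩ := exists_seq_of_step
      (P := fun n C => D.Valid C ∧ 𝒯.Reached (Supertile.of (tileAsm C)) ∧
        shift u (D.asm C) = c (N + n))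
      (r := fun C C' => C ⊆ C' ∧
        AttachStar {B | 𝒯.Reached B} 𝒯.temp (tileAsm C) (tileAsm C'))
      (x := C₀) ⟨hV₀, hR₀, hu⟩ (by
        rintro n C ⟨hV, hR, hCu⟩
        rcases hc.step (N + n) with h | ⟨δ, hδ, hd, hs, h⟩
        · exact ⟨C, ⟨hV, hR, by rw [hCu, ← h]; rfl⟩, subset_rfl, .refl⟩
        · have hne := ((hr (N + n)).stable _ rfl).2.1
          have H := hs.joint hd hne ((TAS.Reached.stable hδ) _ rfl).2.1
          rw [← hCu] at hd H
          obtain ⟨C', hV', hsub, heq, ht⟩ := exists_of_joint hV (reached_cases D hδ) hd H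
          have hst : AttachStar {B | 𝒯.Reached B} 𝒯.temp (tileAsm C) (tileAsm C') := by
            rcases ht with ht | ⟨β, hβ, hdβ, hJ, ht⟩
            · rw [ht]
            · rw [ht]
              exact .single ⟨β, hβ, hdβ, (hR.stable _ rfl).1.union
                ((TAS.Reached.stable hβ) _ rfl).1 hdβ hJ, rfl⟩
          refine ⟨C', ⟨hV', TAS.Reached.of_star hst hR, ?_⟩, hsub, hst⟩
          rw [← heq, hCu, ← h]; rfl)
    have hm : Monotone f := monotone_nat_of_le_succ fun n => (hfs n).1
    have hV := fun n => (hf n).1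
    have hdrop := hc.star.drop N
    have hasm := asm_iUnion hV hm
    have htile := tileAsm_iUnion hV hm
    refine ⟨⋃ n, f n, valid_iUnion hV hm, ?_, ?_⟩
    · exact TAS.producible_of_seq (c := fun n => tileAsm (f n))
        ⟨fun n => (hfs n).2, htile.1, htile.2⟩ (hf 0).2.1
    · have : b = shift u (D.asm (⋃ n, f n)) := by
        refine eq_of_subs hdrop.sub (fun n => ?_) hdrop.dom ?_
        · rw [← (hf n).2.2]; exact (hasm.1 n).shift u
        · ext z
          rw [mem_dom_shift, hasm.2]
          simp only [Set.mem_iUnion]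
          exact exists_congr fun n => by rw [← (hf n).2.2]; rfl
      rw [this, Supertile.of_shift]
  · left
    have hin : ∀ n, D.Inert (Supertile.of (c n)) := fun n =>
      (reached_cases D (hr n)).resolve_right fun h => hN ⟨n, h⟩
    -- Any proper attachment would produce a configuration, so a sequence that stays inert never
    -- moves.
    have hconst : ∀ n, c n = c 0 := by
      intro n
      induction n with
      | zero => rfl
      | succ n ih =>
        rw [← ih]
        rcases hc.step n with h | ⟨δ, hδ, hd, hs, h⟩
        · exact h
        · have h2 : Supertile.of (c (n + 1)) ∈ combine 𝒯.temp (Supertile.of (c n))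
              (Supertile.of δ) := ⟨_, _, rfl, rfl, hd, hs, by rw [h]⟩
          refine absurd ⟨n + 1, combine_cases (reached_cases D (hr n)) (reached_cases D hδ)
            (fun β hβ => ?_) (fun A hA B hB C hC => .combine hA hB hC) h2⟩ hN
          exact ⟨(TAS.Reached.stable hβ _ rfl).1, (TAS.Reached.stable hβ _ rfl).2.1⟩
    have : b = c 0 := by
      refine (ext_of_sub (hc.sub 0) ?_).symm
      rw [hc.dom]
      exact Set.iUnion_subset fun i => by rw [hconst i]
    rw [this]; exact hin 0

/-! ### Everything producible is represented -/

/-- `δ` is represented by a stable configuration without outer pads whose supertile lies in `Q`. -/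
def Built (Q : Set Supertile) (δ : Assembly) : Prop :=
  ∃ C, D.Valid C ∧ Internal C ∧ tileAsm C = δ ∧ (D.asm C).Stable 𝒯.temp ∧
    Supertile.of (D.asm C) ∈ Q

variable {D}

theorem Built.shift {Q : Set Supertile} {δ : Assembly} (h : Built D Q δ) (u : ℤ × ℤ) :
    Built D Q (shift u δ) := by
  obtain ⟨C, h1, h2, rfl, h4, h5⟩ := h
  refine ⟨move u C, h1.move u, h2.move h1 u, tileAsm_move h1.disj u, ?_, ?_⟩
  · rw [asm_move h1.disj]; exact h4.shift _
  · rw [asm_move h1.disj, Supertile.of_shift]; exact h5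

variable (D)

/-- Initial supertiles are represented by their canonical configurations, and a combination is
realised by `exists_grown`. Its pads go only on sides where the two parts meet, so no outer pads
arise and the induction continues. -/
theorem built_of_reached {A : Supertile} (h : 𝒯.Reached A) :
    ∀ δ, Supertile.of δ = A → Built D {B | (simulator D).Reached B} δ := by
  induction h with
  | @init A h =>
    intro δ hδ
    obtain ⟨u, rfl⟩ := Supertile.of_eq_iff.1 ((of_out A).trans hδ.symm)
    obtain ⟨h1, h2, h3⟩ := init_out h
    exact Built.shift ⟨_, canon_valid D h1, canon_internal D h1, tileAsm_canon D h1,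
      canon_stable D h1 h3, .init (Or.inr (Or.inl ⟨A, h, rfl⟩))⟩ u
  | combine hA hB hC ihA ihB =>
    rintro δ rfl
    obtain ⟨α, β, h1, h2, hd, hs, he⟩ := hC
    obtain ⟨u, rfl⟩ := Supertile.of_eq_iff.1 he
    have H := hs.joint hd (hA.stable _ h1).2.1 (hB.stable _ h2).2.1
    obtain ⟨C₁, v1, i1, rfl, s1, r1⟩ := ihA α h1
    obtain ⟨C₂, v2, i2, rfl, s2, r2⟩ := ihB β h2
    obtain ⟨C₁', C₂', w1, w2, w, -, t1, t2, g1, g2, hd', hs', hint⟩ :=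
      exists_grown v1 v2 s1 s2 hd H i2 (P := {B | (simulator D).Reached B})
        fun p d h t ht => reached_pad D p d h ht
    refine Built.shift ⟨C₁' ∪ C₂', w, hint i1, ?_, ?_, ?_⟩ u
    · rw [tileAsm_union w.disj, t1, t2]
    · rw [asm_union w.disj]; exact hs'
    · rw [asm_union w.disj]
      exact .combine (TAS.Reached.of_star (𝒯 := simulator D) g1 r1)
        (TAS.Reached.of_star (𝒯 := simulator D) g2 r2) ⟨_, _, rfl, rfl, hd', hs', rfl⟩

/-- The configuration is extended stage by stage with reached supertiles, and the increasing union
represents the result. Using nested configurations, not merely some representative of each stage, is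
what makes the union meaningful. -/
theorem built_of_producible {δ : Assembly} (h : Supertile.of δ ∈ 𝒯.producible) :
    Built D (simulator D).producible δ := by
  obtain ⟨c, hc, h0⟩ := TAS.exists_seq_of_producible h
  have hr := TAS.seq_reached hc.star (.init h0)
  obtain ⟨C₀, v0, i0, t0, s0, r0⟩ := built_of_reached D (.init h0) (c 0) rfl
  obtain ⟨f, hf, hfs⟩ := exists_seq_of_step
    (P := fun n C => D.Valid C ∧ Internal C ∧ tileAsm C = c n ∧ (D.asm C).Stable 𝒯.temp ∧
      (simulator D).Reached (Supertile.of (D.asm C)))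
    (r := fun C C' => C ⊆ C' ∧
      AttachStar {B | (simulator D).Reached B} 𝒯.temp (D.asm C) (D.asm C'))
    (x := C₀) ⟨v0, i0, t0, s0, r0⟩ (by
      rintro n C ⟨hV, hI, ht, hs, hR⟩
      rcases hc.step n with h | ⟨ε, hε, hd, hst, h⟩
      · exact ⟨C, ⟨hV, hI, by rw [ht, h], hs, hR⟩, subset_rfl, .refl⟩
      · have H := hst.joint hd ((hr n).stable _ rfl).2.1 (TAS.Reached.stable hε _ rfl).2.1
        obtain ⟨C₂, v2, i2, rfl, s2, r2⟩ := built_of_reached D hε ε rfl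
        rw [← ht] at hd H
        obtain ⟨C₁', C₂', w1, w2, w, hsub, t1, t2, g1, g2, hd', hs', hint⟩ :=
          exists_grown hV v2 hs s2 hd H i2 (P := {B | (simulator D).Reached B})
            fun p d h t ht => reached_pad D p d h ht
        have hstar : AttachStar {B | (simulator D).Reached B} 𝒯.temp (D.asm C)
            (D.asm (C₁' ∪ C₂')) := by
          rw [asm_union w.disj]
          exact g1.tail ⟨_, TAS.Reached.of_star (𝒯 := simulator D) g2 r2, hd', hs', rfl⟩
        refine ⟨C₁' ∪ C₂', ⟨w, hint hI, ?_, ?_, TAS.Reached.of_star (𝒯 := simulator D) hstar hR⟩,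
          hsub.trans Set.subset_union_left, hstar⟩
        · rw [tileAsm_union w.disj, t1, t2, ht, h]
        · rw [asm_union w.disj]; exact hs')
  have hm : Monotone f := monotone_nat_of_le_succ fun n => (hfs n).1
  have hV := fun n => (hf n).1
  have hasm := asm_iUnion hV hm
  have htile := tileAsm_iUnion hV hm
  have hprod : Supertile.of (D.asm (⋃ n, f n)) ∈ (simulator D).producible :=
    TAS.producible_of_seq (𝒯 := simulator D) (c := fun n => D.asm (f n))
      ⟨fun n => (hfs n).2, hasm.1, hasm.2⟩ (hf 0).2.2.2.2
  refine ⟨⋃ n, f n, valid_iUnion hV hm, internal_iUnion hV hm fun n => (hf n).2.1, ?_,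
    (TAS.producible_stable hprod).1, hprod⟩
  refine eq_of_subs (c := c) (fun n => ?_) hc.sub ?_ hc.dom
  · rw [← (hf n).2.2.1]; exact htile.1 n
  · rw [htile.2]
    exact Set.iUnion_congr fun n => by rw [(hf n).2.2.1]

/-! ### The simulation -/

theorem eq_of_represents {A B : Supertile} {C : Config} (hC : D.Valid C)
    (hne : (tileAsm C).dom.Nonempty) (hA : A = Supertile.of (D.asm C))
    (h : Represents D.rep A B) : B = Supertile.of (tileAsm C) := by
  obtain ⟨β, rfl⟩ := B.exists_of
  have h1 := represents_asm hC hne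
  rw [← hA] at h1
  have h2 : β ∈ repSupertile D.rep A := by rw [h]; rfl
  rw [h1] at h2
  exact h2

theorem exists_config_of_represents {A B : Supertile} (hA : A ∈ (simulator D).producible)
    (h : Represents D.rep A B) : ∃ C, D.Valid C ∧ Supertile.of (tileAsm C) ∈ 𝒯.producible ∧
      (tileAsm C).dom.Nonempty ∧ A = Supertile.of (D.asm C) ∧ B = Supertile.of (tileAsm C) := by
  rcases producible_cases D hA with hi | ⟨C, hV, hC, he⟩
  · obtain ⟨β, rfl⟩ := B.exists_of
    have h2 : β ∈ repSupertile D.rep A := by rw [h]; rfl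
    rw [hi.blank] at h2
    exact h2.elim
  · have hne := (TAS.producible_stable hC).2.1
    exact ⟨C, hV, hC, hne, he, eq_of_represents D hV hne he h⟩

theorem equivalentProductions : EquivalentProductions D.rep (simulator D) 𝒯 := by
  refine ⟨fun A hA => ?_, fun B hB => ?_, fun A hA => ?_⟩
  · rcases producible_cases D hA with hi | ⟨C, hV, hC, rfl⟩
    · exact Or.inl hi.blank
    · exact Or.inr ⟨_, hC, represents_asm hV (TAS.producible_stable hC).2.1⟩
  · obtain ⟨δ, rfl⟩ := B.exists_of
    obtain ⟨C, hV, -, rfl, -, hC⟩ := built_of_producible D hB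
    exact ⟨_, hC, represents_asm hV (TAS.producible_stable hB).2.1⟩
  · rcases producible_cases D hA with hi | ⟨C, hV, hC, rfl⟩
    · exact hi.clean
    · exact clean_asm hV

/-- An attachment either adds a pad, which is invisible in 𝒯, or is an attachment of represented
assemblies. -/
theorem follows : Follows D.rep (simulator D) 𝒯 := by
  rintro A' hA' B' hB' ⟨E, hE, α, δ, rfl, rfl, hd, hs, rfl⟩ A hA
  obtain ⟨C, hV, hC, hne, he, rfl⟩ := exists_config_of_represents D hA' hA
  obtain ⟨u, rfl⟩ := Supertile.of_eq_iff.1 he.symm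
  have H := hs.joint hd (TAS.producible_stable hA').2.1 (TAS.producible_stable hE).2.1
  obtain ⟨C', hV', hsub, heq, ht⟩ := exists_of_joint hV (producible_cases D hE) hd H
  rw [heq, Supertile.of_shift]
  have hne' := hne.mono (tileAsm_mono hV'.disj hsub).dom_subset
  refine ⟨_, represents_asm hV' hne', ?_⟩
  rcases ht with ht | ⟨β, hβ, hdβ, hJ, ht⟩
  · exact Or.inl (by rw [ht])
  · refine Or.inr ⟨_, hβ, _, _, rfl, rfl, hdβ, ?_, by rw [ht]⟩
    exact (TAS.producible_stable hC).1.union (TAS.producible_stable hβ).1 hdβ hJ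

/-- The given `A'` may carry outer pads that cannot be removed, so it is extended as it is, while
the partner is chosen without outer pads. The intermediate supertile is `A'` with pads on all
bonding sides. -/
theorem weaklyModels : WeaklyModels D.rep (simulator D) 𝒯 := by
  rintro A hA B hB ⟨E, hE, α, δ, rfl, rfl, hd, hs, rfl⟩ A' hA' hrep
  obtain ⟨C₀, hV₀, hC₀, hne₀, he₀, hα⟩ := exists_config_of_represents D hA' hrep
  obtain ⟨v, hv⟩ := Supertile.of_eq_iff.1 hα.symm
  have hV := hV₀.move v
  have ht := tileAsm_move hV₀.disj v
  rw [hv] at ht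
  have he : A' = Supertile.of (D.asm (move v C₀)) := by
    rw [he₀, asm_move hV₀.disj, Supertile.of_shift]
  set C := move v C₀
  subst he
  subst ht
  have H := hs.joint hd (TAS.producible_stable hA).2.1 (TAS.producible_stable hE).2.1
  obtain ⟨C₂, v2, i2, rfl, s2, r2⟩ := built_of_producible D hE
  obtain ⟨C₁', C₂', w1, w2, w, hsub, t1, t2, g1, g2, hd', hs', -⟩ :=
    exists_grown hV v2 (TAS.producible_stable hA').1 s2 hd H i2 (P := (simulator D).producible)
      fun p d h t ht => (reached_pad D p d h ht).producible
  have p1 := TAS.producible_of_star (𝒯 := simulator D) g1 hA'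
  have p2 := TAS.producible_of_star (𝒯 := simulator D) g2 r2
  have hne := (TAS.producible_stable hA).2.1
  have hmem : Supertile.of (D.asm (C₁' ∪ C₂')) ∈ combine (simulator D).temp
      (Supertile.of (D.asm C₁')) (Supertile.of (D.asm C₂')) :=
    ⟨_, _, rfl, rfl, hd', hs', by rw [asm_union w.disj]⟩
  refine ⟨Supertile.of (D.asm C₁'), p1, ?_, g1.growsFrom, Supertile.of (D.asm (C₁' ∪ C₂')),
    TAS.producible_combine p1 p2 hmem, ?_, _, p2, hmem⟩
  · rw [← t1]
    exact represents_asm w1 (by rwa [t1])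
  · rw [← t1, ← t2, ← tileAsm_union w.disj]
    refine represents_asm w ?_
    rw [tileAsm_union w.disj, dom_union, t1]
    exact hne.mono Set.subset_union_left

theorem simulates : Simulates D.size (simulator D) 𝒯 :=
  ⟨D.rep, fun _ _ h => D.rep_mem h, equivalentProductions D, follows D, weaklyModels D⟩

end

end TwoHAM

theorem mainTheorem12 :
    ∃ C : ℕ, ∀ τ : ℕ, 2 ≤ τ →
      ∃ U : Finset TwoHAM.TileType, (U.card : ℝ) ≤ C * Real.log τ ∧
        ∀ 𝒯 : TwoHAM.TAS, 𝒯.temp = τ →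
          ∃ I : Set TwoHAM.Supertile,
            I.encard ≤ C * (𝒯.tiles.card + 𝒯.init.encard) ∧
            ∃ 𝒰 : TwoHAM.TAS,
              𝒰.tiles = U ∧ 𝒰.init = TwoHAM.singletons U ∪ I ∧ 𝒰.temp = τ ∧
              ∃ m : ℕ, 0 < m ∧
                (m : ℝ) ≤ C * Real.sqrt (Real.log 𝒯.tiles.card + Real.log τ) ∧
                TwoHAM.Simulates m 𝒰 𝒯 := by
  -- The tile count is what requires 1200; the inputs need only 8 and the scale only 200.
  refine ⟨1200, fun τ hτ => ?_⟩
  obtain ⟨W⟩ := TwoHAM.exists_Weights hτ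
  refine ⟨TwoHAM.univTiles W, by exact_mod_cast TwoHAM.card_univTiles_le_log W, fun 𝒯 h𝒯 => ?_⟩
  subst h𝒯
  obtain ⟨D, rfl, hk⟩ := TwoHAM.exists_Design 𝒯.tiles W
  refine ⟨D.inputs 𝒯.init, (D.encard_inputs _).trans ?_, TwoHAM.simulator D, rfl, rfl, rfl, D.size,
    by simp [TwoHAM.Design.size], ?_, TwoHAM.simulates D⟩
  · gcongr
    norm_num
  · rw [TwoHAM.Design.size, hk]
    refine (TwoHAM.gridSize_le D.W _).trans ?_
    gcongr
    norm_num
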